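/- **Setting.** Manifolds are smooth, Hausdorff and second countable. Let $\pi\colon E\to M$ be a smooth fibre bundle with $\dim M=m\ge 1$ and $\dim E=m+n$, let $\eta$ be a volume form on $M$, and orient $M$ by $\eta$. Let $J^1\pi$ be the first jet bundle of $\pi$, with projections $\pi_1\colon J^1\pi\to M$ and $\pi_{10}\colon J^1\pi\to E$, and let $L\colon J^1\pi\to\mathbb R$ be a smooth function. The pullback of $\eta$ to $J^1\pi$ is denoted by $\eta$ as well. The canonical form on $J^1\pi$ is $\theta|_{j^1_xs}=T_{j^1_xs}\pi_{10}-T_xs\circ T_{j^1_xs}\pi_1$. The contact subbundle $I^m_{\mathrm{con},2}\subset\Lambda^m(J^1\pi)$ consists of those $m$-covectors that are finite sums of products $(\alpha\circ\theta)\wedge\beta$, with $\alpha$ a covector on $E$ and $\beta$ an $(m-1)$-covector on $J^1\pi$, and that vanish whenever two of their arguments are $\pi_1$-vertical. Put $W_{L\eta}=L\eta+I^m_{\mathrm{con},2}\subset\Lambda^m(J^1\pi)$, with projection $\pi_{L\eta}\colon W_{L\eta}\to J^1\pi$, and let $\lambda_{L\eta}$ be the Cartan $m$-form on $W_{L\eta}$,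 $\lambda_{L\eta}|_\alpha(v_1,\dots,v_m)=\alpha(T\pi_{L\eta}(v_1),\dots,T\pi_{L\eta}(v_m))$. A smooth section $s\colon U\to E$ over an open set $U\subset M$ is *critical* for $(\pi,L\eta)$ if $\frac{d}{d\varepsilon}\big|_{\varepsilon=0}\int_K (j^1s_\varepsilon)^*(L\eta)=0$ for every compact set $K\subset U$ and every smooth family $(s_\varepsilon)_{|\varepsilon|<\delta}$ of sections over $U$ with $s_0=s$ and $s_\varepsilon=s$ on $U\setminus K$ for all $\varepsilon$. **Proposition.** Let $U\subset M$ be open. A smooth section $s\colon U\to E$ of $\pi$ is critical for $(\pi,L\eta)$ if and only if there is a smooth section $\Gamma\colon U\to W_{L\eta}$ of $W_{L\eta}\to M$ such that 1. $\Gamma$ covers $s$, that is, $\pi_{10}\circ\pi_{L\eta}\circ\Gamma=s$, and 2. $\Gamma^*(X\lrcorner\, d\lambda_{L\eta})=0$ for all smooth vector fields $X$ on $W_{L\eta}$ that are vertical with respect to the projection $W_{L\eta}\to M$. -/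

import Mathlib

set_option linter.unusedSectionVars false

open scoped Manifold ContDiff

noncomputable section

namespace LFT

/-! ### Smooth manifolds given by an atlas on a bare type -/

/-- A smooth atlas, modelled on the normed space `V`, on a type without a given topology. -/
structure SmoothAtlas (V : Type*) [NormedAddCommGroup V] [NormedSpace ℝ V] (X : Type*) where
  charts : Set (PartialEquiv X V)
  chartAt : X → PartialEquiv X V
  mem_source : ∀ x, x ∈ (chartAt x).source
  mem_charts : ∀ x, chartAt x ∈ charts
  open_source : ∀ e e', e ∈ charts → e' ∈ charts → IsOpen (e.symm.trans e').source
  contDiffOn : ∀ e e', e ∈ charts → e' ∈ charts →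
    ContDiffOn ℝ ∞ (e.symm.trans e') (e.symm.trans e').source

namespace SmoothAtlas

variable {V : Type*} [NormedAddCommGroup V] [NormedSpace ℝ V] {X : Type*} (A : SmoothAtlas V X)

/-- The underlying topological atlas. -/
def toCore : ChartedSpaceCore V X where
  atlas := A.charts
  chartAt := A.chartAt
  mem_chart_source := A.mem_source
  chart_mem_atlas := A.mem_charts
  open_source := A.open_source
  continuousOn_toFun := fun e e' he he' => (A.contDiffOn e e' he he').continuousOn

theorem isManifold :
    @IsManifold ℝ _ V _ _ V _ 𝓘(ℝ, V) ∞ X A.toCore.toTopologicalSpace A.toCore.toChartedSpace := by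
  let _ := A.toCore.toTopologicalSpace
  let _ := A.toCore.toChartedSpace
  apply isManifold_of_contDiffOn
  intro e e' he he'
  obtain ⟨f, hf, rfl⟩ : ∃ f, ∃ hf : f ∈ A.charts, e = A.toCore.openPartialHomeomorph f hf := by
    have h : e ∈ ⋃ (f : PartialEquiv X V) (hf : f ∈ A.charts),
      ({A.toCore.openPartialHomeomorph f hf} : Set _) := he
    simpa using h
  obtain ⟨f', hf', rfl⟩ : ∃ f, ∃ hf : f ∈ A.charts, e' = A.toCore.openPartialHomeomorph f hf := by
    have h : e' ∈ ⋃ (f : PartialEquiv X V) (hf : f ∈ A.charts),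
      ({A.toCore.openPartialHomeomorph f hf} : Set _) := he'
    simpa using h
  have := A.contDiffOn f f' hf hf'
  refine ContDiffOn.congr_mono (f := f.symm.trans f') this ?_ ?_
  · intro x _; rfl
  · intro x hx; exact hx.1

end SmoothAtlas

/-! ### Tangent maps and differential forms

Mathlib's tangent space `TangentSpace 𝓘(ℝ, V) p` of a manifold modelled on `V` is, by definition,
the vector space `V`, read in the preferred chart at `p`. -/

/-- The tangent map `T_p f : T_p N → T_{f p} N'`. -/
def tmap {V V' : Type*} [NormedAddCommGroup V] [NormedSpace ℝ V] [NormedAddCommGroup V']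
    [NormedSpace ℝ V'] {N N' : Type*} [TopologicalSpace N] [ChartedSpace V N]
    [TopologicalSpace N'] [ChartedSpace V' N'] (f : N → N') (p : N) : V →L[ℝ] V' :=
  mfderiv 𝓘(ℝ, V) 𝓘(ℝ, V') f p

/-- Differential forms of degree `q` (not necessarily smooth) on `N`: at each point an alternating
`q`-linear form on the tangent space. -/
abbrev DForm (V N : Type*) [NormedAddCommGroup V] [NormedSpace ℝ V] [TopologicalSpace N]
    [ChartedSpace V N] (q : ℕ) : Type _ :=
  N → V [⋀^Fin q]→L[ℝ] ℝ

section Forms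

variable {V N : Type*} [NormedAddCommGroup V] [NormedSpace ℝ V] [TopologicalSpace N]
  [ChartedSpace V N] {q : ℕ}

/-- The representative of a form in the preferred chart at `p`: the pullback of the form under the
inverse of the chart. -/
def chartRep (α : DForm V N q) (p : N) : V → V [⋀^Fin q]→L[ℝ] ℝ := fun y =>
  (α ((chartAt V p).symm y)).compContinuousLinearMap (tmap (V := V) (chartAt V p).symm y)

/-- A form is smooth if all its chart representatives are. -/
def IsSmoothForm (α : DForm V N q) : Prop :=
  ∀ p, ContDiffOn ℝ ∞ (chartRep α p) (chartAt V p).target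

/-- The exterior derivative, computed at `p` in the preferred chart at `p`. -/
def extD (α : DForm V N q) : DForm V N (q + 1) := fun p =>
  (extDeriv (chartRep α p) (chartAt V p p)).compContinuousLinearMap
    (tmap (V' := V) (chartAt V p) p)

/-- The interior product `X ⌟ α` of a vector field with a form. -/
def interior (X : ∀ p : N, TangentSpace 𝓘(ℝ, V) p) (α : DForm V N (q + 1)) : DForm V N q :=
  fun p => (α p).curryLeft (X p)

/-- The pullback `f^* α` of a form under a map. -/
def pullback {V' N' : Type*} [NormedAddCommGroup V'] [NormedSpace ℝ V'] [TopologicalSpace N']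
    [ChartedSpace V' N'] (f : N' → N) (α : DForm V N q) : DForm V' N' q :=
  fun p => (α (f p)).compContinuousLinearMap (tmap f p)

/-- A vector field is smooth if it is smooth as a section of the tangent bundle. -/
def IsSmoothField [IsManifold 𝓘(ℝ, V) 1 N] (X : ∀ p : N, TangentSpace 𝓘(ℝ, V) p) : Prop :=
  ContMDiff 𝓘(ℝ, V) 𝓘(ℝ, V).tangent ∞ (fun p => (⟨p, X p⟩ : TangentBundle 𝓘(ℝ, V) N))

end Forms

/-- The wedge product `τ ∧ β` of a `1`-form and a `k`-form on a vector space: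
`(τ ∧ β)(v₀, …, v_k) = ∑ᵢ (-1)ⁱ τ(vᵢ) β(v₀, …, v̂ᵢ, …, v_k)`. -/
def wedge {T : Type*} [NormedAddCommGroup T] [NormedSpace ℝ T] {k : ℕ} (τ : T →L[ℝ] ℝ)
    (β : T [⋀^Fin k]→L[ℝ] ℝ) : T [⋀^Fin (k + 1)]→L[ℝ] ℝ :=
  ContinuousAlternatingMap.alternatizeUncurryFin (τ.smulRight β)

section LinearAlgebra

variable {T G B : Type*} [NormedAddCommGroup T] [NormedSpace ℝ T] [NormedAddCommGroup G]
  [NormedSpace ℝ G] [NormedAddCommGroup B] [NormedSpace ℝ B] {k q : ℕ}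

/-- The forms of degree `q` on `T` that vanish as soon as `r` of their arguments are vertical, that
is, are in the kernel of `b`. -/
def horizontalForms (b : T →L[ℝ] B) (r q : ℕ) : Submodule ℝ (T [⋀^Fin q]→L[ℝ] ℝ) where
  carrier := {ρ | ∀ (v : Fin q → T) (S : Finset (Fin q)), S.card = r → (∀ i ∈ S, b (v i) = 0) →
    ρ v = 0}
  add_mem' := fun h h' v S hS hv => by simp [h v S hS hv, h' v S hS hv]
  zero_mem' := fun _ _ _ _ => rfl
  smul_mem' := fun c ρ h v S hS hv => by simp [h v S hS hv]

/-- The forms of degree `k + 1` in the ideal generated by the `1`-forms `α ∘ θ`: the sums of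
products `(α ∘ θ) ∧ β`. -/
def idealForms (θ : T →L[ℝ] G) (k : ℕ) : Submodule ℝ (T [⋀^Fin (k + 1)]→L[ℝ] ℝ) :=
  Submodule.span ℝ {ρ | ∃ (α : G →L[ℝ] ℝ) (β : T [⋀^Fin k]→L[ℝ] ℝ), ρ = wedge (α.comp θ) β}

/-- For a volume form `η` on `B` and a linear map `Φ`, the form
`v ↦ ∑ᵢ η(b v₀, …, Φ (θ vᵢ), …, b v_k)`. If `Φ = p^i_a du^a ⊗ ∂_i`, it is `p^i_a θ^a ∧ η_i`. -/
def multiplierForm (η : B [⋀^Fin (k + 1)]→L[ℝ] ℝ) (b : T →L[ℝ] B) (θ : T →L[ℝ] G)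
    (Φ : G →L[ℝ] B) : T [⋀^Fin (k + 1)]→L[ℝ] ℝ :=
  ContinuousAlternatingMap.alternatizeUncurryFin
    ((ContinuousAlternatingMap.compContinuousLinearMapCLM b).comp
      (η.curryLeft.comp (Φ.comp θ)))

theorem wedge_apply (τ : T →L[ℝ] ℝ) (β : T [⋀^Fin k]→L[ℝ] ℝ) (v : Fin (k + 1) → T) :
    wedge τ β v = ∑ i : Fin (k + 1), (-1) ^ (i : ℕ) * (τ (v i) * β (i.removeNth v)) := by
  simp [wedge, ContinuousAlternatingMap.alternatizeUncurryFin_apply]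

theorem multiplierForm_apply (η : B [⋀^Fin (k + 1)]→L[ℝ] ℝ) (b : T →L[ℝ] B) (θ : T →L[ℝ] G)
    (Φ : G →L[ℝ] B) (v : Fin (k + 1) → T) :
    multiplierForm η b θ Φ v = ∑ i : Fin (k + 1),
      (-1) ^ (i : ℕ) * η (Matrix.vecCons (Φ (θ (v i))) (fun l => b (i.removeNth v l))) := by
  simp [multiplierForm, ContinuousAlternatingMap.alternatizeUncurryFin_apply]
  rfl

theorem map_cons_removeNth (f : B [⋀^Fin (k + 1)]→L[ℝ] ℝ) (v : Fin (k + 1) → B) (i : Fin (k + 1))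
    (x : B) : f (Matrix.vecCons x (i.removeNth v)) =
      (-1) ^ (i : ℕ) * f (Function.update v i x) := by
  have h := f.toAlternatingMap.map_insertNth i x (i.removeNth v)
  rw [Fin.insertNth_removeNth] at h
  have h' : f (Function.update v i x) = (-1) ^ (i : ℕ) * f (Matrix.vecCons x (i.removeNth v)) := by
    simpa using h
  rw [h', ← mul_assoc, ← mul_pow]
  simp

theorem map_update_basis (η : B [⋀^Fin (k + 1)]→L[ℝ] ℝ) {e : Module.Basis (Fin (k + 1)) ℝ B}
    {v : Fin (k + 1) → B} (he : ∀ i, e i = v i) (x : B) (i : Fin (k + 1)) :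
    η (Function.update v i x) = e.repr x i * η v := by
  have h0 : η (Function.update v i x) =
      η.toAlternatingMap (Function.update v i (∑ l, e.repr x l • e l)) := by rw [e.sum_repr x]; rfl
  rw [h0, AlternatingMap.map_update_sum, Finset.sum_eq_single i]
  · rw [AlternatingMap.map_update_smul, he, Function.update_eq_self]; rfl
  · intro l _ hl
    rw [AlternatingMap.map_update_smul, he,
      AlternatingMap.map_eq_zero_of_eq (i := i) (j := l) _ _ _ hl.symm]
    · simp
    · simp [Function.update_of_ne hl]
  · simp

/-- A nonzero volume form is nondegenerate in its first argument. -/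
theorem curryLeft_injective (hB : Module.finrank ℝ B = k + 1) {η : B [⋀^Fin (k + 1)]→L[ℝ] ℝ}
    (hη : η ≠ 0) {x : B} (hx : η.curryLeft x = 0) : x = 0 := by
  by_contra hne
  apply hη
  ext v
  by_cases hv : LinearIndependent ℝ v
  · let e := basisOfLinearIndependentOfCardEqFinrank hv (by simp [hB])
    have he : ∀ i, e i = v i := fun i => by simp [e]
    obtain ⟨i, hi⟩ : ∃ i, e.repr x i ≠ 0 := by
      by_contra! h
      exact hne (e.repr.map_eq_zero_iff.1 (Finsupp.ext h))
    have h1 : η (Function.update v i x) = e.repr x i * η v := map_update_basis η he x i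
    have h2 : η (Matrix.vecCons x (i.removeNth v)) = 0 := by
      have := congrArg (fun f => f (i.removeNth v)) hx
      simpa using this
    rw [map_cons_removeNth, h1] at h2
    have h3 : ((-1 : ℝ)) ^ (i : ℕ) ≠ 0 := by simp
    simpa [h3, hi] using h2
  · exact η.toAlternatingMap.map_linearDependent v hv

theorem wedge_curryLeft (hB : Module.finrank ℝ B = k + 1) (η : B [⋀^Fin (k + 1)]→L[ℝ] ℝ)
    (l : B →L[ℝ] ℝ) (x : B) : wedge l (η.curryLeft x) = l x • η := by
  ext v
  by_cases hv : LinearIndependent ℝ v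
  · let e := basisOfLinearIndependentOfCardEqFinrank hv (by simp [hB])
    have he : ∀ i, e i = v i := fun i => by simp [e]
    have h1 : ∀ i, η (Function.update v i x) = e.repr x i * η v := map_update_basis η he x
    rw [wedge_apply]
    simp only [ContinuousAlternatingMap.curryLeft_apply_apply, map_cons_removeNth, h1]
    conv_rhs => rw [← e.sum_repr x]
    simp only [map_sum, map_smul, he, ContinuousAlternatingMap.smul_apply, smul_eq_mul,
      Finset.sum_mul]
    refine Finset.sum_congr rfl fun i _ => ?_
    have : ((-1 : ℝ)) ^ (i : ℕ) * (-1) ^ (i : ℕ) = 1 := by rw [← mul_pow]; simp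
    linear_combination (l (v i) * (e.repr x i * η v)) * this
  · rw [(wedge l (η.curryLeft x)).toAlternatingMap.map_linearDependent v hv |> fun h =>
      (show wedge l (η.curryLeft x) v = 0 from h)]
    have h : η v = 0 := η.toAlternatingMap.map_linearDependent v hv
    simp [h]

theorem eq_zero_of_wedge (hB : Module.finrank ℝ B = k + 1) (δ : B [⋀^Fin k]→L[ℝ] ℝ)
    (h : ∀ l : B →L[ℝ] ℝ, wedge l δ = 0) : δ = 0 := by
  have : FiniteDimensional ℝ B := Module.finite_of_finrank_pos (by omega)
  ext v
  have hne : Submodule.span ℝ (Set.range v) ≠ ⊤ := by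
    intro htop
    have h1 := finrank_range_le_card (R := ℝ) v
    rw [Set.finrank, htop, finrank_top, hB] at h1
    simp at h1
  obtain ⟨f, hf0, hf⟩ := Submodule.exists_le_ker_of_lt_top _ (lt_top_iff_ne_top.2 hne)
  obtain ⟨x, hx⟩ : ∃ x, f x ≠ 0 := by
    by_contra! hh
    exact hf0 (LinearMap.ext hh)
  have h2 := congrArg (fun g => g (Matrix.vecCons x v)) (h (LinearMap.toContinuousLinearMap f))
  replace h2 : wedge (LinearMap.toContinuousLinearMap f) δ (Matrix.vecCons x v) = 0 := h2
  rw [wedge_apply] at h2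
  rw [Fin.sum_univ_succ, Finset.sum_eq_zero] at h2
  · have h3 : (Fin.removeNth 0 (Matrix.vecCons x v) : Fin k → B) = v := by
      ext i; simp [Fin.removeNth]
    rw [h3] at h2
    simpa [hx] using h2
  · intro i _
    have : f (v i) = 0 := hf (Submodule.subset_span ⟨i, rfl⟩)
    simp [this]

/-- Every form of degree `k` on a space of dimension `k + 1` is a contraction of a given volume
form. -/
theorem exists_curryLeft (hB : Module.finrank ℝ B = k + 1) {η : B [⋀^Fin (k + 1)]→L[ℝ] ℝ}
    (hη : η ≠ 0) (γ : B [⋀^Fin k]→L[ℝ] ℝ) : ∃ x, η.curryLeft x = γ := by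
  have : FiniteDimensional ℝ B := Module.finite_of_finrank_pos (by omega)
  obtain ⟨v, hv⟩ : ∃ v, η v ≠ 0 := by
    by_contra! hh
    exact hη (ContinuousAlternatingMap.ext hh)
  have hli : LinearIndependent ℝ v := by
    by_contra hh
    exact hv (η.toAlternatingMap.map_linearDependent v hh)
  let e := basisOfLinearIndependentOfCardEqFinrank hli (by simp [hB])
  have he : ∀ i, e i = v i := fun i => by simp [e]
  have hrat : ∀ f : B [⋀^Fin (k + 1)]→L[ℝ] ℝ, f = (f v / η v) • η := by
    intro f
    apply ContinuousAlternatingMap.toAlternatingMap_injective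
    refine Module.Basis.ext_alternating e fun σ hσ => ?_
    obtain ⟨τ, hτ⟩ : ∃ τ : Equiv.Perm (Fin (k + 1)), ∀ i, τ i = σ i :=
      ⟨Equiv.ofBijective σ (Finite.injective_iff_bijective.1 hσ), fun i => rfl⟩
    have h1 : (fun i => e (σ i)) = v ∘ τ := by ext i; simp [he, hτ]
    rw [h1, AlternatingMap.map_perm, AlternatingMap.map_perm]
    congr 1
    change f v = (f v / η v) * η v
    field_simp
  let x : B := ∑ i, (wedge (LinearMap.toContinuousLinearMap (e.coord i)) γ v / η v) • v i
  refine ⟨x, ?_⟩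
  rw [← sub_eq_zero]
  apply eq_zero_of_wedge hB
  intro l
  have hl : l = ∑ i, l (v i) • LinearMap.toContinuousLinearMap (e.coord i) := by
    ext y
    conv_lhs => rw [← e.sum_repr y]
    simp [he, mul_comm]
  have hlin : ∀ (l : B →L[ℝ] ℝ) (a c : B [⋀^Fin k]→L[ℝ] ℝ),
      wedge l (a - c) = wedge l a - wedge l c := by
    intro l a c
    ext w
    simp [wedge_apply, mul_sub, Finset.sum_sub_distrib]
  rw [hlin, wedge_curryLeft hB, hrat (wedge l γ)]
  refine (sub_smul (l x) (wedge l γ v / η v) η).symm.trans ?_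
  have : l x - wedge l γ v / η v = 0 := by
    have h2 : wedge l γ v =
        ∑ i, l (v i) * wedge (LinearMap.toContinuousLinearMap (e.coord i)) γ v := by
      conv_lhs => rw [hl]
      simp only [wedge_apply, sum_apply, smul_apply,
        smul_eq_mul, Finset.mul_sum, Finset.sum_mul]
      rw [Finset.sum_comm]
      refine Finset.sum_congr rfl fun i _ => Finset.sum_congr rfl fun j _ => ?_
      ring
    rw [h2]
    simp only [x, map_sum, map_smul, smul_eq_mul, Finset.sum_div]
    rw [← Finset.sum_sub_distrib]
    refine Finset.sum_eq_zero fun i _ => ?_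
    ring
  rw [this, zero_smul]

theorem idealForms_apply_eq_zero {θ : T →L[ℝ] G} {ρ : T [⋀^Fin (k + 1)]→L[ℝ] ℝ}
    (hρ : ρ ∈ idealForms θ k) {v : Fin (k + 1) → T} (hv : ∀ i, θ (v i) = 0) : ρ v = 0 := by
  induction hρ using Submodule.span_induction with
  | mem x h =>
    obtain ⟨α, β, rfl⟩ := h
    simp [wedge_apply, hv]
  | zero => rfl
  | add x y _ _ hx hy => simp [hx, hy]
  | smul c x _ hx => simp [hx]

theorem multiplierForm_congr (η : B [⋀^Fin (k + 1)]→L[ℝ] ℝ) (b : T →L[ℝ] B) (θ : T →L[ℝ] G)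
    {Φ Φ' : G →L[ℝ] B} (h : ∀ v, Φ (θ v) = Φ' (θ v)) :
    multiplierForm η b θ Φ = multiplierForm η b θ Φ' := by
  ext v
  simp [multiplierForm_apply, h]

theorem multiplierForm_mem_ideal [FiniteDimensional ℝ B] (η : B [⋀^Fin (k + 1)]→L[ℝ] ℝ)
    (b : T →L[ℝ] B) (θ : T →L[ℝ] G) (Φ : G →L[ℝ] B) :
    multiplierForm η b θ Φ ∈ idealForms θ k := by
  let e := Module.finBasis ℝ B
  have : multiplierForm η b θ Φ = ∑ l, wedge
      (((LinearMap.toContinuousLinearMap (e.coord l)).comp Φ).comp θ)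
      ((η.curryLeft (e l)).compContinuousLinearMap b) := by
    ext v
    rw [multiplierForm_apply, ContinuousAlternatingMap.sum_apply]
    simp only [wedge_apply]
    rw [Finset.sum_comm]
    refine Finset.sum_congr rfl fun i _ => ?_
    rw [← Finset.mul_sum]
    congr 1
    change η.curryLeft (Φ (θ (v i))) _ = _
    conv_lhs => rw [← e.sum_repr (Φ (θ (v i)))]
    rw [map_sum, ContinuousAlternatingMap.sum_apply]
    refine Finset.sum_congr rfl fun l _ => ?_
    rw [map_smul, ContinuousAlternatingMap.smul_apply]
    rfl
  rw [this]
  exact Submodule.sum_mem _ fun l _ => Submodule.subset_span ⟨_, _, rfl⟩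

theorem multiplierForm_mem_horizontal (η : B [⋀^Fin (k + 1)]→L[ℝ] ℝ)
    (b : T →L[ℝ] B) (θ : T →L[ℝ] G) (Φ : G →L[ℝ] B) :
    multiplierForm η b θ Φ ∈ horizontalForms b 2 (k + 1) := by
  intro v S hS hv
  rw [multiplierForm_apply]
  refine Finset.sum_eq_zero fun i _ => ?_
  obtain ⟨l, hl, hli⟩ := Finset.exists_mem_ne (by omega : 1 < S.card) i
  obtain ⟨l', rfl⟩ := Fin.exists_succAbove_eq hli
  have : η (Matrix.vecCons (Φ (θ (v i))) (fun l => b (i.removeNth v l))) = 0 := by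
    apply η.map_coord_zero l'.succ
    exact hv _ hl
  rw [this, mul_zero]

/-- A multilinear form vanishes if it vanishes on tuples with two vertical entries, on tuples of
horizontal entries, and on tuples of horizontal entries except for one. -/
theorem alternating_eq_zero (D : T [⋀^Fin (k + 1)]→L[ℝ] ℝ) (v h w : Fin (k + 1) → T)
    (hvw : ∀ i, v i = h i + w i)
    (h0 : D h = 0) (h1 : ∀ i, D (Function.update h i (w i)) = 0)
    (h2 : ∀ S : Finset (Fin (k + 1)), 1 < Sᶜ.card → D (S.piecewise h w) = 0) : D v = 0 := by
  have hv : v = h + w := funext hvw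
  have := D.toContinuousMultilinearMap.map_add_univ h w
  rw [hv]
  refine this.trans (Finset.sum_eq_zero fun S _ => ?_)
  rcases Nat.lt_or_ge 1 Sᶜ.card with hS | hS
  · exact h2 S hS
  · rcases Finset.card_le_one_iff_subset_singleton.1 hS with ⟨i, hi⟩
    rcases Finset.subset_singleton_iff.1 hi with hi | hi
    · have : S = Finset.univ := by simpa using hi
      rw [this, Finset.piecewise_univ]; exact h0
    · have : S.piecewise h w = Function.update h i (w i) := by
        ext l
        by_cases hl : l = i
        · subst hl
          have : l ∉ S := by
            rw [← Finset.mem_compl, hi]; simp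
          simp [this]
        · have : l ∈ S := by
            by_contra hc
            rw [← Finset.mem_compl, hi] at hc
            simp at hc; exact hl hc
          simp [this, hl]
      rw [this]; exact h1 i

variable {a : T →L[ℝ] G} {q' : G →L[ℝ] B} {A : B →L[ℝ] G}

/-- The multiplier form determines its multipliers on vertical vectors. -/
theorem multiplierForm_inj (hB : Module.finrank ℝ B = k + 1) {η : B [⋀^Fin (k + 1)]→L[ℝ] ℝ}
    (hη : η ≠ 0) (ha : Function.Surjective a) {b : T →L[ℝ] B} (hb : b = q'.comp a)
    (hA : q'.comp A = ContinuousLinearMap.id ℝ B) {Φ Φ' : G →L[ℝ] B}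
    (h : multiplierForm η b (a - A.comp b) Φ = multiplierForm η b (a - A.comp b) Φ')
    {f : G} (hf : q' f = 0) : Φ f = Φ' f := by
  have hA' : ∀ x, q' (A x) = x := fun x => congrArg (fun g => g x) hA
  obtain ⟨w, rfl⟩ := ha f
  have hbw : b w = 0 := by rw [hb]; exact hf
  choose s hs using ha
  have hbs : ∀ x, b (s (A x)) = x := fun x => by rw [hb]; simp [hs, hA']
  have key : ∀ (Ψ : G →L[ℝ] B) (x : Fin k → B),
      multiplierForm η b (a - A.comp b) Ψ (Matrix.vecCons w fun i => s (A (x i))) =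
        η.curryLeft (Ψ (a w)) x := by
    intro Ψ x
    rw [multiplierForm_apply, Fin.sum_univ_succ, Finset.sum_eq_zero]
    · have : (fun l => b (Fin.removeNth 0 (Matrix.vecCons w fun i => s (A (x i)) :
          Fin (k + 1) → T) l)) = x := by
        ext l; simp [Fin.removeNth, hbs]
      rw [this]
      simp [hbw]
    · intro i _
      have : η (Matrix.vecCons (0 : B) (fun l => b (i.succ.removeNth
          (Matrix.vecCons w fun i => s (A (x i)) : Fin (k + 1) → T) l))) = 0 :=
        η.map_coord_zero 0 rfl
      simp [hbs, hs, this]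
  have h3 : η.curryLeft (Φ (a w) - Φ' (a w)) = 0 := by
    ext x
    rw [map_sub, ContinuousAlternatingMap.sub_apply, ← key, ← key, h, sub_self]; rfl
  exact sub_eq_zero.1 (curryLeft_injective hB hη h3)

/-- Every `2`-horizontal form of the contact ideal is a multiplier form. -/
theorem exists_multiplierForm [FiniteDimensional ℝ T] [FiniteDimensional ℝ G]
    (hB : Module.finrank ℝ B = k + 1) {η : B [⋀^Fin (k + 1)]→L[ℝ] ℝ}
    (hη : η ≠ 0) (ha : Function.Surjective a) {b : T →L[ℝ] B} (hb : b = q'.comp a)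
    (hA : q'.comp A = ContinuousLinearMap.id ℝ B) {ρ : T [⋀^Fin (k + 1)]→L[ℝ] ℝ}
    (hρ : ρ ∈ idealForms (a - A.comp b) k) (hρ' : ρ ∈ horizontalForms b 2 (k + 1)) :
    ∃ Φ : G →L[ℝ] B, ρ = multiplierForm η b (a - A.comp b) Φ := by
  have : FiniteDimensional ℝ B := Module.finite_of_finrank_pos (by omega)
  have hA' : ∀ x, q' (A x) = x := fun x => congrArg (fun g => g x) hA
  obtain ⟨s', hs'⟩ := (a : T →ₗ[ℝ] G).exists_rightInverse_of_surjective
    (LinearMap.range_eq_top.2 ha)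
  let s : G →L[ℝ] T := LinearMap.toContinuousLinearMap s'
  have hs : ∀ x, a (s x) = x := fun x => congrArg (fun g => g x) hs'
  let c : B ≃ₗ[ℝ] (B [⋀^Fin k]→L[ℝ] ℝ) := LinearEquiv.ofBijective
    (η.curryLeft : B →ₗ[ℝ] (B [⋀^Fin k]→L[ℝ] ℝ))
    ⟨(injective_iff_map_eq_zero _).2 fun x hx => curryLeft_injective hB hη hx,
      exists_curryLeft hB hη⟩
  let g : G →L[ℝ] (B [⋀^Fin k]→L[ℝ] ℝ) :=
    (ContinuousAlternatingMap.compContinuousLinearMapCLM (s.comp A)).comp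
      (ρ.curryLeft.comp (s.comp (ContinuousLinearMap.id ℝ G - A.comp q')))
  let Φ : G →L[ℝ] B := LinearMap.toContinuousLinearMap
    ((c.symm : _ →ₗ[ℝ] B).comp (g : G →ₗ[ℝ] (B [⋀^Fin k]→L[ℝ] ℝ)))
  have hΦ : ∀ x, η.curryLeft (Φ x) = g x := fun x => c.apply_symm_apply (g x)
  refine ⟨Φ, ?_⟩
  set θ : T →L[ℝ] G := a - A.comp b with hθ
  have hθa : ∀ x, θ x = a x - A (b x) := fun x => rfl
  have hba : ∀ x, b x = q' (a x) := fun x => by rw [hb]; rfl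
  have hqθ : ∀ x, q' (θ x) = 0 := fun x => by rw [hθa, map_sub, hA', hba, sub_self]
  have hθs : ∀ x, θ (s (θ x)) = θ x := fun x => by
    rw [hθa (s (θ x)), hs, hba, hs, hqθ, map_zero, sub_zero]
  have hθh : ∀ x, θ (s (A (b x))) = 0 := fun x => by
    rw [hθa, hs, hba (s _), hs, hA', sub_self]
  have hbh : ∀ x, b (s (A (b x))) = b x := fun x => by rw [hba (s _), hs, hA']
  rw [← sub_eq_zero]
  have hDi : ρ - multiplierForm η b θ Φ ∈ idealForms θ k :=
    Submodule.sub_mem _ hρ (multiplierForm_mem_ideal η b θ Φ)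
  have hDh : ρ - multiplierForm η b θ Φ ∈ horizontalForms b 2 (k + 1) :=
    Submodule.sub_mem _ hρ' (multiplierForm_mem_horizontal η b θ Φ)
  set D := ρ - multiplierForm η b θ Φ with hD
  ext v
  refine alternating_eq_zero D v (fun i => s (A (b (v i)))) (fun i => v i - s (A (b (v i))))
    (fun i => by simp) (idealForms_apply_eq_zero hDi fun i => hθh _) ?_ ?_
  · intro i
    -- replace the vertical entry by the lift of its contact part
    have e1 : D (Function.update (fun i => s (A (b (v i)))) i (v i - s (A (b (v i))))) =
        D (Function.update (fun i => s (A (b (v i)))) i (s (θ (v i)))) := by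
      rw [← sub_eq_zero, ← D.map_update_sub]
      refine idealForms_apply_eq_zero hDi fun l => ?_
      by_cases hl : l = i
      · subst hl
        simp only [Function.update_self]
        rw [map_sub, map_sub, hθh, hθs]; simp
      · simp [Function.update_of_ne hl, hθh]
    rw [e1]
    have e2 := map_cons_removeNth D (fun i => s (A (b (v i)))) i (s (θ (v i)))
    have e3 : D (Matrix.vecCons (s (θ (v i))) (i.removeNth fun i => s (A (b (v i))))) = 0 := by
      rw [hD, ContinuousAlternatingMap.sub_apply, sub_eq_zero, multiplierForm_apply,
        Fin.sum_univ_succ, Finset.sum_eq_zero]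
      · have e4 : η (Matrix.vecCons (Φ (θ (v i))) (fun l => b (s (A (b (i.removeNth v l)))))) =
            g (θ (v i)) (fun l => b (s (A (b (i.removeNth v l))))) := by
          rw [← hΦ]; rfl
        have e5 : g (θ (v i)) (fun l => b (s (A (b (i.removeNth v l))))) =
            ρ (Matrix.vecCons (s (θ (v i))) (i.removeNth fun i => s (A (b (v i))))) := by
          have e6 : g (θ (v i)) (fun l => b (s (A (b (i.removeNth v l))))) =
            ρ (Matrix.vecCons (s (θ (v i) - A (q' (θ (v i)))))
              (fun l => s (A (b (s (A (b (i.removeNth v l)))))))) := rfl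
          rw [e6, hqθ, map_zero, sub_zero]
          simp only [hbh]
          rfl
        rw [← e5, ← e4]
        have e7 : (fun l => b (Fin.removeNth 0 (Matrix.vecCons (s (θ (v i)))
            (i.removeNth fun i => s (A (b (v i)))) : Fin (k + 1) → T) l)) =
            (fun l => b (s (A (b (i.removeNth v l))))) := by
          ext l; simp [Fin.removeNth]
        rw [e7]
        simp [hθs]
      · intro l _
        have : θ ((Matrix.vecCons (s (θ (v i))) (i.removeNth fun i => s (A (b (v i)))) :
            Fin (k + 1) → T) l.succ) = 0 := by
          simp [Fin.removeNth, hθh]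
        rw [this, map_zero]
        rw [η.map_coord_zero 0 rfl, mul_zero]
    rw [e3] at e2
    have e8 : ((-1 : ℝ)) ^ (i : ℕ) ≠ 0 := by simp
    simpa [e8] using e2.symm
  · intro S hS
    obtain ⟨S', hS', hc⟩ := Finset.exists_subset_card_eq (s := Sᶜ) (n := 2) hS
    refine hDh _ S' hc fun i hi => ?_
    have : i ∉ S := Finset.mem_compl.1 (hS' hi)
    simp [this, hbh]

end LinearAlgebra
/-! ### Tangent maps: calculus -/

section TMap

variable {V V' V'' : Type*} [NormedAddCommGroup V] [NormedSpace ℝ V] [NormedAddCommGroup V']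
  [NormedSpace ℝ V'] [NormedAddCommGroup V''] [NormedSpace ℝ V'']
  {N N' N'' : Type*} [TopologicalSpace N] [ChartedSpace V N]
  [TopologicalSpace N'] [ChartedSpace V' N'] [TopologicalSpace N''] [ChartedSpace V'' N'']

theorem tmap_comp {g : N' → N''} {f : N → N'} {p : N}
    (hg : MDifferentiableAt 𝓘(ℝ, V') 𝓘(ℝ, V'') g (f p))
    (hf : MDifferentiableAt 𝓘(ℝ, V) 𝓘(ℝ, V') f p) :
    (tmap (fun x => g (f x)) p : V →L[ℝ] V'') = (tmap g (f p) : V' →L[ℝ] V'').comp (tmap f p) :=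
  mfderiv_comp p hg hf

theorem tmap_congr {f g : N → N'} {p : N} (h : f =ᶠ[nhds p] g) :
    (tmap f p : V →L[ℝ] V') = tmap g p :=
  Filter.EventuallyEq.mfderiv_eq h

theorem tmap_id (p : N) : (tmap (fun x : N => x) p : V →L[ℝ] V) = ContinuousLinearMap.id ℝ V :=
  mfderiv_id

theorem tmap_eq_fderiv (f : V → V') (p : V) : (tmap f p : V →L[ℝ] V') = fderiv ℝ f p :=
  mfderiv_eq_fderiv

end TMap

/-! ### Fibre bundles, jets and the contact structure -/

/-- The model `ℝ^m` of the base, where `m = k + 1`. -/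
abbrev BModel (k : ℕ) : Type := EuclideanSpace ℝ (Fin (k + 1))

/-- The model `ℝ^n` of the fibre. -/
abbrev FModel (n : ℕ) : Type := EuclideanSpace ℝ (Fin n)

/-- A smooth fibre bundle `π : E → M` with typical fibre `Q`, where `dim M = k + 1`, `dim Q = n`. -/
structure SmoothFibreBundle (k n : ℕ) (M E Q : Type*) [TopologicalSpace M]
    [ChartedSpace (BModel k) M] [TopologicalSpace E] [ChartedSpace (BModel k × FModel n) E]
    [TopologicalSpace Q] [ChartedSpace (FModel n) Q] where
  /-- The projection `π`. -/
  proj : E → M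
  /-- Around each point of the base there is a smooth local trivialization. -/
  locallyTrivial : ∀ x : M, ∃ t : Bundle.Trivialization Q proj, x ∈ t.baseSet ∧
    ContMDiffOn 𝓘(ℝ, BModel k × FModel n) (𝓘(ℝ, BModel k).prod 𝓘(ℝ, FModel n)) ∞ t t.source ∧
    ContMDiffOn (𝓘(ℝ, BModel k).prod 𝓘(ℝ, FModel n)) 𝓘(ℝ, BModel k × FModel n) ∞
      t.toOpenPartialHomeomorph.symm t.target

section Bundle

variable {k n : ℕ} {M E Q : Type*} [TopologicalSpace M]
  [ChartedSpace (BModel k) M] [TopologicalSpace E] [ChartedSpace (BModel k × FModel n) E]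
  [TopologicalSpace Q] [ChartedSpace (FModel n) Q] (P : SmoothFibreBundle k n M E Q)

/-- A pair of charts of `M` and of `E` in which `π` is the projection `(x, u) ↦ x`. -/
structure FibredChart where
  base : OpenPartialHomeomorph M (BModel k)
  total : OpenPartialHomeomorph E (BModel k × FModel n)
  base_smooth : ContMDiffOn 𝓘(ℝ, BModel k) 𝓘(ℝ, BModel k) ∞ base base.source
  base_symm_smooth : ContMDiffOn 𝓘(ℝ, BModel k) 𝓘(ℝ, BModel k) ∞ base.symm base.target
  total_smooth : ContMDiffOn 𝓘(ℝ, BModel k × FModel n) 𝓘(ℝ, BModel k × FModel n) ∞ total total.source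
  total_symm_smooth :
    ContMDiffOn 𝓘(ℝ, BModel k × FModel n) 𝓘(ℝ, BModel k × FModel n) ∞ total.symm total.target
  proj_mem : ∀ e ∈ total.source, P.proj e ∈ base.source
  fst_total : ∀ e ∈ total.source, (total e).1 = base (P.proj e)

theorem exists_fibredChart [IsManifold 𝓘(ℝ, BModel k) ∞ M] [IsManifold 𝓘(ℝ, FModel n) ∞ Q]
    (e : E) : ∃ c : FibredChart P, e ∈ c.total.source := by
  obtain ⟨t, ht, hs, hs'⟩ := P.locallyTrivial (P.proj e)
  have het : e ∈ t.source := t.mem_source.2 ht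
  let φ := chartAt (BModel k) (P.proj e)
  let χ := chartAt (FModel n) (t e).2
  have hφ : ContMDiffOn 𝓘(ℝ, BModel k) 𝓘(ℝ, BModel k) ∞ φ φ.source := contMDiffOn_chart
  have hφ' : ContMDiffOn 𝓘(ℝ, BModel k) 𝓘(ℝ, BModel k) ∞ φ.symm φ.target := contMDiffOn_chart_symm
  have hχ : ContMDiffOn 𝓘(ℝ, FModel n) 𝓘(ℝ, FModel n) ∞ χ χ.source := contMDiffOn_chart
  have hχ' : ContMDiffOn 𝓘(ℝ, FModel n) 𝓘(ℝ, FModel n) ∞ χ.symm χ.target := contMDiffOn_chart_symm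
  let ψ : OpenPartialHomeomorph E (BModel k × FModel n) := t.toOpenPartialHomeomorph.trans (φ.prod χ)
  have hsrc : ∀ e' ∈ ψ.source, e' ∈ t.source ∧ (t e').1 ∈ φ.source ∧ (t e').2 ∈ χ.source := by
    intro e' he'
    have := he'
    rw [OpenPartialHomeomorph.trans_source] at this
    exact ⟨this.1, this.2.1, this.2.2⟩
  have htgt : ∀ z ∈ ψ.target, z.1 ∈ φ.target ∧ z.2 ∈ χ.target ∧
      (φ.symm z.1, χ.symm z.2) ∈ t.target := by
    intro z hz
    have := hz
    rw [OpenPartialHomeomorph.trans_target] at this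
    exact ⟨this.1.1, this.1.2, this.2⟩
  refine ⟨⟨φ, ψ, hφ, hφ', ?_, ?_, ?_, ?_⟩, ?_⟩
  · have h1 : ContMDiffOn 𝓘(ℝ, BModel k × FModel n) (𝓘(ℝ, BModel k).prod 𝓘(ℝ, FModel n)) ∞ t
      ψ.source := hs.mono fun e' he' => (hsrc e' he').1
    exact ContMDiffOn.prodMk_space
      (hφ.comp (contMDiff_fst.comp_contMDiffOn h1) fun e' he' => (hsrc e' he').2.1)
      (hχ.comp (contMDiff_snd.comp_contMDiffOn h1) fun e' he' => (hsrc e' he').2.2)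
  · have h1 : ContMDiffOn 𝓘(ℝ, BModel k × FModel n) 𝓘(ℝ, BModel k) ∞
        (Prod.fst : BModel k × FModel n → BModel k) ψ.target :=
      (contMDiff_iff_contDiff.2 contDiff_fst).contMDiffOn
    have h2 : ContMDiffOn 𝓘(ℝ, BModel k × FModel n) 𝓘(ℝ, FModel n) ∞
        (Prod.snd : BModel k × FModel n → FModel n) ψ.target :=
      (contMDiff_iff_contDiff.2 contDiff_snd).contMDiffOn
    exact hs'.comp ((hφ'.comp h1 fun z hz => (htgt z hz).1).prodMk
      (hχ'.comp h2 fun z hz => (htgt z hz).2.1)) fun z hz => (htgt z hz).2.2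
  · intro e' he'
    rw [← t.coe_fst (hsrc e' he').1]
    exact (hsrc e' he').2.1
  · intro e' he'
    change φ (t e').1 = φ (P.proj e')
    rw [t.coe_fst (hsrc e' he').1]
  · change e ∈ ψ.source
    rw [OpenPartialHomeomorph.trans_source]
    refine ⟨het, ?_, mem_chart_source _ _⟩
    change (t e).1 ∈ φ.source
    rw [t.coe_fst het]
    exact mem_chart_source _ _

namespace FibredChart

variable {P} (c c' : FibredChart P) {e : E}

theorem mdiff_total (h : e ∈ c.total.source) :
    MDifferentiableAt 𝓘(ℝ, BModel k × FModel n) 𝓘(ℝ, BModel k × FModel n) c.total e :=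
  (c.total_smooth.contMDiffAt (c.total.open_source.mem_nhds h)).mdifferentiableAt (by simp)

theorem mdiff_total_symm {z : BModel k × FModel n} (h : z ∈ c.total.target) :
    MDifferentiableAt 𝓘(ℝ, BModel k × FModel n) 𝓘(ℝ, BModel k × FModel n) c.total.symm z :=
  (c.total_symm_smooth.contMDiffAt (c.total.open_target.mem_nhds h)).mdifferentiableAt (by simp)

theorem mdiff_base {x : M} (h : x ∈ c.base.source) :
    MDifferentiableAt 𝓘(ℝ, BModel k) 𝓘(ℝ, BModel k) c.base x :=
  (c.base_smooth.contMDiffAt (c.base.open_source.mem_nhds h)).mdifferentiableAt (by simp)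

theorem mdiff_base_symm {x : BModel k} (h : x ∈ c.base.target) :
    MDifferentiableAt 𝓘(ℝ, BModel k) 𝓘(ℝ, BModel k) c.base.symm x :=
  (c.base_symm_smooth.contMDiffAt (c.base.open_target.mem_nhds h)).mdifferentiableAt (by simp)

/-- The tangent map of the chart of `E`, at a point of `E`. -/
def T (e : E) : (BModel k × FModel n) →L[ℝ] (BModel k × FModel n) := tmap c.total e

/-- The tangent map of the inverse of the chart of `E`, at the image of a point of `E`. -/
def Ti (e : E) : (BModel k × FModel n) →L[ℝ] (BModel k × FModel n) :=
  tmap c.total.symm (c.total e)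

/-- The tangent map of the chart of `M`, at a point of `M`. -/
def S (x : M) : BModel k →L[ℝ] BModel k := tmap c.base x

/-- The tangent map of the inverse of the chart of `M`, at the image of a point of `M`. -/
def Si (x : M) : BModel k →L[ℝ] BModel k := tmap c.base.symm (c.base x)

theorem T_Ti (h : e ∈ c.total.source) (v) : c.T e (c.Ti e v) = v := by
  have h' := c.total.map_source h
  have h1 := tmap_comp (g := c.total) (f := c.total.symm) (p := c.total e)
    (by rw [c.total.left_inv h]; exact c.mdiff_total h) (c.mdiff_total_symm h')
  rw [c.total.left_inv h] at h1
  have h2 : (tmap (fun x => c.total (c.total.symm x)) (c.total e) :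
      (BModel k × FModel n) →L[ℝ] (BModel k × FModel n)) = ContinuousLinearMap.id ℝ _ := by
    rw [← tmap_id (V := BModel k × FModel n) (c.total e)]
    exact tmap_congr (by
      filter_upwards [c.total.open_target.mem_nhds h'] with x hx using c.total.right_inv hx)
  exact congrArg (fun f => f v) (h1.symm.trans h2)

theorem Ti_T (h : e ∈ c.total.source) (v) : c.Ti e (c.T e v) = v := by
  have h' := c.total.map_source h
  have h1 := tmap_comp (g := c.total.symm) (f := c.total) (p := e)
    (c.mdiff_total_symm h') (c.mdiff_total h)
  have h2 : (tmap (fun x => c.total.symm (c.total x)) e :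
      (BModel k × FModel n) →L[ℝ] (BModel k × FModel n)) = ContinuousLinearMap.id ℝ _ := by
    rw [← tmap_id (V := BModel k × FModel n) e]
    exact tmap_congr (by
      filter_upwards [c.total.open_source.mem_nhds h] with x hx using c.total.left_inv hx)
  exact congrArg (fun f => f v) (h1.symm.trans h2)

theorem S_Si {x : M} (h : x ∈ c.base.source) (v) : c.S x (c.Si x v) = v := by
  have h' := c.base.map_source h
  have h1 := tmap_comp (g := c.base) (f := c.base.symm) (p := c.base x)
    (by rw [c.base.left_inv h]; exact c.mdiff_base h) (c.mdiff_base_symm h')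
  rw [c.base.left_inv h] at h1
  have h2 : (tmap (fun x => c.base (c.base.symm x)) (c.base x) :
      BModel k →L[ℝ] BModel k) = ContinuousLinearMap.id ℝ _ := by
    rw [← tmap_id (V := BModel k) (c.base x)]
    exact tmap_congr (by
      filter_upwards [c.base.open_target.mem_nhds h'] with x hx using c.base.right_inv hx)
  exact congrArg (fun f => f v) (h1.symm.trans h2)

theorem Si_S {x : M} (h : x ∈ c.base.source) (v) : c.Si x (c.S x v) = v := by
  have h' := c.base.map_source h
  have h1 := tmap_comp (g := c.base.symm) (f := c.base) (p := x)
    (c.mdiff_base_symm h') (c.mdiff_base h)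
  have h2 : (tmap (fun x => c.base.symm (c.base x)) x :
      BModel k →L[ℝ] BModel k) = ContinuousLinearMap.id ℝ _ := by
    rw [← tmap_id (V := BModel k) x]
    exact tmap_congr (by
      filter_upwards [c.base.open_source.mem_nhds h] with x hx using c.base.left_inv hx)
  exact congrArg (fun f => f v) (h1.symm.trans h2)

theorem mdiff_proj (h : e ∈ c.total.source) :
    MDifferentiableAt 𝓘(ℝ, BModel k × FModel n) 𝓘(ℝ, BModel k) P.proj e := by
  have h1 : MDifferentiableAt 𝓘(ℝ, BModel k × FModel n) 𝓘(ℝ, BModel k)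
      (fun x => (c.total x).1) e := by
    have h2 : MDifferentiableAt 𝓘(ℝ, BModel k × FModel n) 𝓘(ℝ, BModel k)
        (Prod.fst : BModel k × FModel n → BModel k) (c.total e) :=
      mdifferentiableAt_iff_differentiableAt.2 differentiableAt_fst
    exact h2.comp e (c.mdiff_total h)
  have h3 : MDifferentiableAt 𝓘(ℝ, BModel k × FModel n) 𝓘(ℝ, BModel k)
      (fun x => c.base.symm (c.total x).1) e := by
    refine MDifferentiableAt.comp e (c.mdiff_base_symm ?_) h1
    rw [c.fst_total e h]; exact c.base.map_source (c.proj_mem e h)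
  refine h3.congr_of_eventuallyEq ?_
  filter_upwards [c.total.open_source.mem_nhds h] with x hx
  rw [c.fst_total x hx, c.base.left_inv (c.proj_mem x hx)]

theorem fst_T (h : e ∈ c.total.source) (v) :
    (c.T e v).1 = c.S (P.proj e) ((tmap P.proj e : (BModel k × FModel n) →L[ℝ] BModel k) v) := by
  have h1 := tmap_comp (g := c.base) (f := P.proj) (p := e)
    (c.mdiff_base (c.proj_mem e h)) (c.mdiff_proj h)
  have h2 := tmap_comp (V'' := BModel k) (g := (Prod.fst : BModel k × FModel n → BModel k))
    (f := c.total) (p := e)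
    (mdifferentiableAt_iff_differentiableAt.2 differentiableAt_fst) (c.mdiff_total h)
  have h3 : (tmap (fun x => (c.total x).1) e : (BModel k × FModel n) →L[ℝ] BModel k) =
      tmap (fun x => c.base (P.proj x)) e := tmap_congr (by
    filter_upwards [c.total.open_source.mem_nhds h] with x hx using c.fst_total x hx)
  rw [h1, h2, tmap_eq_fderiv, fderiv_fst] at h3
  exact congrArg (fun f => f v) h3

/-- Change of charts on the total space. -/
def Ψ (z : BModel k × FModel n) : BModel k × FModel n := c'.total (c.total.symm z)

/-- Change of charts on the base. -/
def Φ (x : BModel k) : BModel k := c'.base (c.base.symm x)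

theorem T_comp_Ti (h : e ∈ c.total.source) (h' : e ∈ c'.total.source) :
    (c'.T e).comp (c.Ti e) = fderiv ℝ (c.Ψ c') (c.total e) := by
  rw [← tmap_eq_fderiv]
  have h1 := tmap_comp (g := c'.total) (f := c.total.symm) (p := c.total e)
    (by rw [c.total.left_inv h]; exact c'.mdiff_total h') (c.mdiff_total_symm (c.total.map_source h))
  rw [c.total.left_inv h] at h1
  exact h1.symm

theorem S_comp_Si {x : M} (h : x ∈ c.base.source) (h' : x ∈ c'.base.source) :
    (c'.S x).comp (c.Si x) = fderiv ℝ (c.Φ c') (c.base x) := by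
  rw [← tmap_eq_fderiv]
  have h1 := tmap_comp (g := c'.base) (f := c.base.symm) (p := c.base x)
    (by rw [c.base.left_inv h]; exact c'.mdiff_base h') (c.mdiff_base_symm (c.base.map_source h))
  rw [c.base.left_inv h] at h1
  exact h1.symm

/-- The domain of the change of charts on the total space. -/
def dom : Set (BModel k × FModel n) := (c.total.symm.trans c'.total).source

theorem isOpen_dom : IsOpen (c.dom c') := (c.total.symm.trans c'.total).open_source

theorem mem_dom {z : BModel k × FModel n} :
    z ∈ c.dom c' ↔ z ∈ c.total.target ∧ c.total.symm z ∈ c'.total.source := by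
  rw [dom, OpenPartialHomeomorph.trans_source]; rfl

theorem contDiffOn_Ψ : ContDiffOn ℝ ∞ (c.Ψ c') (c.dom c') := by
  rw [← contMDiffOn_iff_contDiffOn]
  exact c'.total_smooth.comp (c.total_symm_smooth.mono fun z hz => ((c.mem_dom c').1 hz).1)
    fun z hz => ((c.mem_dom c').1 hz).2

theorem contDiffOn_Φ : ContDiffOn ℝ ∞ (c.Φ c') (c.base.symm.trans c'.base).source := by
  rw [← contMDiffOn_iff_contDiffOn]
  rw [OpenPartialHomeomorph.trans_source]
  exact c'.base_smooth.comp (c.base_symm_smooth.mono fun z hz => hz.1) fun z hz => hz.2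

end FibredChart

/-- The first jet bundle `J¹π`. A jet `j¹_x s` is given by the point `e = s x` and the linear map
`T_x s : T_x M → T_e E`, which is an arbitrary linear section of `T_e π`. -/
@[ext]
structure Jet1 where
  /-- The point `π₁₀ (j¹_x s) = s x`. -/
  pt : E
  /-- The tangent map `T_x s`. -/
  lin : BModel k →L[ℝ] BModel k × FModel n
  isSection : (tmap P.proj pt : (BModel k × FModel n) →L[ℝ] BModel k).comp lin =
    ContinuousLinearMap.id ℝ (BModel k)

/-- The model of `J¹π`, with coordinates `((x, u), u_x)`. -/
abbrev JModel (k n : ℕ) : Type := (BModel k × FModel n) × (BModel k →L[ℝ] FModel n)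

variable {P}

/-- The source projection `π₁ : J¹π → M`. -/
def Jet1.base (j : Jet1 P) : M := P.proj j.pt

/-- The coordinates `(x, u, u_x)` of a jet. -/
def jetCoord (c : FibredChart P) (j : Jet1 P) : JModel k n :=
  (c.total j.pt, (ContinuousLinearMap.snd ℝ _ _).comp
    ((c.T j.pt).comp (j.lin.comp (c.Si (P.proj j.pt)))))

/-- The linear map with coordinates `v = u_x` at a point `e`. -/
def linOfCoord (c : FibredChart P) (e : E) (v : BModel k →L[ℝ] FModel n) :
    BModel k →L[ℝ] BModel k × FModel n :=
  (c.Ti e).comp (((ContinuousLinearMap.id ℝ (BModel k)).prod v).comp (c.S (P.proj e)))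

theorem linOfCoord_isSection (c : FibredChart P) {e : E} (h : e ∈ c.total.source)
    (v : BModel k →L[ℝ] FModel n) :
    (tmap P.proj e : (BModel k × FModel n) →L[ℝ] BModel k).comp (linOfCoord c e v) =
      ContinuousLinearMap.id ℝ (BModel k) := by
  ext1 b
  have hx := c.proj_mem e h
  have h1 := c.fst_T h (linOfCoord c e v b)
  have h2 : c.T e (linOfCoord c e v b) = (c.S (P.proj e) b, v (c.S (P.proj e) b)) := c.T_Ti h _
  rw [h2] at h1
  have h3 := congrArg (c.Si (P.proj e)) h1
  rw [c.Si_S hx, c.Si_S hx] at h3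
  exact h3.symm

theorem linOfCoord_jetCoord (c : FibredChart P) (j : Jet1 P) (h : j.pt ∈ c.total.source) :
    linOfCoord c j.pt (jetCoord c j).2 = j.lin := by
  ext1 b
  have hx := c.proj_mem _ h
  have h1 : c.T j.pt (j.lin b) =
      (c.S (P.proj j.pt) b, (jetCoord c j).2 (c.S (P.proj j.pt) b)) := by
    refine Prod.ext ?_ ?_
    · rw [c.fst_T h]
      congr 1
      exact congrArg (fun f => f b) j.isSection
    · simp [jetCoord, c.Si_S hx]
  have h2 := congrArg (c.Ti j.pt) h1
  rw [c.Ti_T h] at h2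
  exact h2.symm

theorem T_linOfCoord (c : FibredChart P) {e : E} (h : e ∈ c.total.source)
    (v : BModel k →L[ℝ] FModel n) (b) :
    c.T e (linOfCoord c e v (c.Si (P.proj e) b)) = (b, v b) := by
  simp [linOfCoord, c.T_Ti h, c.S_Si (c.proj_mem e h)]

open Classical in
/-- The chart `(x, u, u_x)` of `J¹π` defined by a fibred chart; `j₀` is the value of its inverse
outside of the target. -/
def jetChart (c : FibredChart P) (j₀ : Jet1 P) : PartialEquiv (Jet1 P) (JModel k n) where
  toFun := jetCoord c
  invFun z := if h : z.1 ∈ c.total.target then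
    ⟨c.total.symm z.1, linOfCoord c (c.total.symm z.1) z.2,
      linOfCoord_isSection c (c.total.map_target h) z.2⟩ else j₀
  source := {j | j.pt ∈ c.total.source}
  target := {z | z.1 ∈ c.total.target}
  map_source' := fun j hj => c.total.map_source hj
  map_target' := fun z hz => by
    have hz' : z.1 ∈ c.total.target := hz
    rw [dif_pos hz']
    exact c.total.map_target hz'
  left_inv' := fun j hj => by
    have hj' : j.pt ∈ c.total.source := hj
    have h : (jetCoord c j).1 ∈ c.total.target := c.total.map_source hj'
    rw [dif_pos h]
    have h1 : c.total.symm (jetCoord c j).1 = j.pt := c.total.left_inv hj'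
    refine Jet1.ext h1 ?_
    change linOfCoord c (c.total.symm (jetCoord c j).1) (jetCoord c j).2 = j.lin
    rw [h1]
    exact linOfCoord_jetCoord c j hj'
  right_inv' := fun z hz => by
    have hz' : z.1 ∈ c.total.target := hz
    rw [dif_pos hz']
    refine Prod.ext (c.total.right_inv hz') ?_
    ext1 b
    change (c.T (c.total.symm z.1) (linOfCoord c (c.total.symm z.1) z.2
      (c.Si (P.proj (c.total.symm z.1)) b))).2 = z.2 b
    rw [T_linOfCoord c (c.total.map_target hz')]

/-- Change of coordinates on `J¹π`. -/
def jetChange (c c' : FibredChart P) (z : JModel k n) : JModel k n :=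
  (c.Ψ c' z.1, (ContinuousLinearMap.snd ℝ _ _).comp ((fderiv ℝ (c.Ψ c') z.1).comp
    (((ContinuousLinearMap.id ℝ (BModel k)).prod z.2).comp
      (fderiv ℝ (c'.Φ c) (c.Ψ c' z.1).1))))

theorem jetCoord_change (c c' : FibredChart P) (j : Jet1 P) (h : j.pt ∈ c.total.source)
    (h' : j.pt ∈ c'.total.source) : jetCoord c' j = jetChange c c' (jetCoord c j) := by
  have hx := c.proj_mem _ h
  have hx' := c'.proj_mem _ h'
  have h1 : c.Ψ c' (jetCoord c j).1 = c'.total j.pt :=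
    congrArg c'.total (c.total.left_inv h)
  refine Prod.ext h1.symm ?_
  ext1 b
  have h2 : fderiv ℝ (c.Ψ c') (jetCoord c j).1 = (c'.T j.pt).comp (c.Ti j.pt) :=
    (c.T_comp_Ti c' h h').symm
  have h3 : fderiv ℝ (c'.Φ c) (c.Ψ c' (jetCoord c j).1).1 =
      (c.S (P.proj j.pt)).comp (c'.Si (P.proj j.pt)) := by
    rw [h1, c'.fst_total _ h']
    exact (c'.S_comp_Si c hx' hx).symm
  simp only [jetChange]
  rw [h2, h3]
  have h4 := congrArg (fun f => f (c'.Si (P.proj j.pt) b)) (linOfCoord_jetCoord c j h)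
  simp only [linOfCoord, ContinuousLinearMap.comp_apply] at h4
  simp only [ContinuousLinearMap.comp_apply]
  rw [h4]
  rfl

theorem contDiffOn_jetChange (c c' : FibredChart P) :
    ContDiffOn ℝ ∞ (jetChange c c') {z | z.1 ∈ c.dom c'} := by
  have hfst : ContDiffOn ℝ ∞ (Prod.fst : JModel k n → BModel k × FModel n)
      {z | z.1 ∈ c.dom c'} := contDiff_fst.contDiffOn
  have h1 : ContDiffOn ℝ ∞ (fun z : JModel k n => c.Ψ c' z.1) {z | z.1 ∈ c.dom c'} :=
    (c.contDiffOn_Ψ c').comp hfst fun z hz => hz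
  have h2 : ContDiffOn ℝ ∞ (fun z : JModel k n => fderiv ℝ (c.Ψ c') z.1) {z | z.1 ∈ c.dom c'} :=
    ((c.contDiffOn_Ψ c').fderiv_of_isOpen (c.isOpen_dom c') (by simp)).comp hfst fun z hz => hz
  have h3 : ContDiffOn ℝ ∞ (fun z : JModel k n => fderiv ℝ (c'.Φ c) (c.Ψ c' z.1).1)
      {z | z.1 ∈ c.dom c'} := by
    refine ((c'.contDiffOn_Φ c).fderiv_of_isOpen (c'.base.symm.trans c.base).open_source
      (by simp)).comp (contDiff_fst.comp_contDiffOn h1) fun z hz => ?_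
    obtain ⟨hz1, hz2⟩ := (c.mem_dom c').1 hz
    rw [OpenPartialHomeomorph.trans_source]
    have h4 : (c.Ψ c' z.1).1 = c'.base (P.proj (c.total.symm z.1)) := c'.fst_total _ hz2
    have hb := c'.proj_mem _ hz2
    refine ⟨?_, ?_⟩
    · rw [h4]; exact c'.base.map_source hb
    · change c'.base.symm (c.Ψ c' z.1).1 ∈ c.base.source
      rw [h4, c'.base.left_inv hb]
      exact c.proj_mem _ (c.total.map_target hz1)
  have h4 : ContDiffOn ℝ ∞ (fun z : JModel k n =>
      (ContinuousLinearMap.id ℝ (BModel k)).prod z.2) {z | z.1 ∈ c.dom c'} := by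
    have h5 : (fun z : JModel k n => (ContinuousLinearMap.id ℝ (BModel k)).prod z.2) =
        fun z => ContinuousLinearMap.inl ℝ (BModel k) (FModel n) +
          (ContinuousLinearMap.inr ℝ (BModel k) (FModel n)).comp z.2 := by
      ext1 z; ext1 b; simp
    rw [h5]
    exact (contDiff_const.add (contDiff_const.clm_comp contDiff_snd)).contDiffOn
  exact h1.prodMk (contDiffOn_const.clm_comp (h2.clm_comp (h4.clm_comp h3)))

theorem jetChart_trans_source (c c' : FibredChart P) (j₀ j₀' : Jet1 P) :
    ((jetChart c j₀).symm.trans (jetChart c' j₀')).source = {z | z.1 ∈ c.dom c'} := by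
  ext z
  rw [PartialEquiv.trans_source]
  change (z.1 ∈ c.total.target ∧ (jetChart c j₀).symm z ∈ (jetChart c' j₀').source) ↔ z.1 ∈ c.dom c'
  rw [c.mem_dom c']
  refine and_congr_right fun hz => ?_
  have : ((jetChart c j₀).symm z).pt = c.total.symm z.1 := by
    classical
    change (dite _ _ _ : Jet1 P).pt = _
    rw [dif_pos hz]
  change ((jetChart c j₀).symm z).pt ∈ c'.total.source ↔ _
  rw [this]

theorem jetChart_trans_eqOn (c c' : FibredChart P) (j₀ j₀' : Jet1 P) :
    Set.EqOn ((jetChart c j₀).symm.trans (jetChart c' j₀')) (jetChange c c')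
      ((jetChart c j₀).symm.trans (jetChart c' j₀')).source := by
  intro z hz
  rw [PartialEquiv.trans_source] at hz
  have hz1 : z ∈ (jetChart c j₀).target := hz.1
  have h1 := (jetChart c j₀).map_target hz1
  have h2 := jetCoord_change c c' ((jetChart c j₀).symm z) h1 hz.2
  have h3 : jetCoord c ((jetChart c j₀).symm z) = z := (jetChart c j₀).right_inv hz1
  rw [h3] at h2
  exact h2

variable (P) in
/-- The atlas of `J¹π` consisting of the charts defined by the fibred charts of `π`. -/
def jetAtlas [IsManifold 𝓘(ℝ, BModel k) ∞ M] [IsManifold 𝓘(ℝ, FModel n) ∞ Q] :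
    SmoothAtlas (JModel k n) (Jet1 P) where
  charts := {f | ∃ c j₀, f = jetChart c j₀}
  chartAt j := jetChart (exists_fibredChart P j.pt).choose j
  mem_source j := (exists_fibredChart P j.pt).choose_spec
  mem_charts j := ⟨_, _, rfl⟩
  open_source := by
    rintro _ _ ⟨c, j₀, rfl⟩ ⟨c', j₀', rfl⟩
    rw [jetChart_trans_source]
    exact (c.isOpen_dom c').preimage continuous_fst
  contDiffOn := by
    rintro _ _ ⟨c, j₀, rfl⟩ ⟨c', j₀', rfl⟩
    refine ContDiffOn.congr ?_ (jetChart_trans_eqOn c c' j₀ j₀')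
    rw [jetChart_trans_source]
    exact contDiffOn_jetChange c c'

variable [IsManifold 𝓘(ℝ, BModel k) ∞ M] [IsManifold 𝓘(ℝ, FModel n) ∞ Q]

instance : TopologicalSpace (Jet1 P) := (jetAtlas P).toCore.toTopologicalSpace
instance : ChartedSpace (JModel k n) (Jet1 P) := (jetAtlas P).toCore.toChartedSpace
instance : IsManifold 𝓘(ℝ, JModel k n) ∞ (Jet1 P) := (jetAtlas P).isManifold

theorem contMDiffOn_jetChart (c : FibredChart P) (j₀ : Jet1 P) :
    ContMDiffOn 𝓘(ℝ, JModel k n) 𝓘(ℝ, JModel k n) ∞ (jetChart c j₀) (jetChart c j₀).source ∧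
    ContMDiffOn 𝓘(ℝ, JModel k n) 𝓘(ℝ, JModel k n) ∞ (jetChart c j₀).symm (jetChart c j₀).target ∧
    IsOpen (jetChart c j₀).source ∧ IsOpen (jetChart c j₀).target := by
  have hf : jetChart c j₀ ∈ (jetAtlas P).toCore.atlas := ⟨c, j₀, rfl⟩
  let f := (jetAtlas P).toCore.openPartialHomeomorph _ hf
  have h : f ∈ atlas (JModel k n) (Jet1 P) :=
    Set.mem_iUnion₂.2 ⟨jetChart c j₀, hf, rfl⟩
  have h' := IsManifold.subset_maximalAtlas (I := 𝓘(ℝ, JModel k n)) (n := ∞) h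
  exact ⟨contMDiffOn_of_mem_maximalAtlas h', contMDiffOn_symm_of_mem_maximalAtlas h',
    f.open_source, f.open_target⟩

theorem contMDiff_pt : ContMDiff 𝓘(ℝ, JModel k n) 𝓘(ℝ, BModel k × FModel n) ∞
    (Jet1.pt : Jet1 P → E) := by
  intro j
  obtain ⟨c, hc⟩ := exists_fibredChart P j.pt
  obtain ⟨h1, -, h3, -⟩ := contMDiffOn_jetChart c j
  have h4 : ContMDiffOn 𝓘(ℝ, JModel k n) 𝓘(ℝ, BModel k × FModel n) ∞
      (Prod.fst : JModel k n → BModel k × FModel n) (jetChart c j).target :=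
    (contMDiff_iff_contDiff.2 contDiff_fst).contMDiffOn
  have h5 := c.total_symm_smooth.comp (h4.comp h1 fun x hx => (jetChart c j).map_source hx)
    fun x hx => c.total.map_source hx
  refine (h5.contMDiffAt (h3.mem_nhds hc)).congr_of_eventuallyEq ?_
  filter_upwards [h3.mem_nhds hc] with x hx
  exact (c.total.left_inv hx).symm

theorem mdiff_proj (e : E) :
    MDifferentiableAt 𝓘(ℝ, BModel k × FModel n) 𝓘(ℝ, BModel k) P.proj e := by
  obtain ⟨c, hc⟩ := exists_fibredChart P e
  exact c.mdiff_proj hc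

theorem tmap_base (j : Jet1 P) : (tmap Jet1.base j : JModel k n →L[ℝ] BModel k) =
    (tmap P.proj j.pt : (BModel k × FModel n) →L[ℝ] BModel k).comp (tmap Jet1.pt j) :=
  tmap_comp (mdiff_proj j.pt) ((contMDiff_pt j).mdifferentiableAt (by simp))

theorem tmap_pt_surjective (j : Jet1 P) : Function.Surjective
    (tmap Jet1.pt j : JModel k n →L[ℝ] BModel k × FModel n) := by
  obtain ⟨c, hc⟩ := exists_fibredChart P j.pt
  obtain ⟨-, h2, -, h4⟩ := contMDiffOn_jetChart c j
  have hj : jetCoord c j ∈ (jetChart c j).target := (jetChart c j).map_source hc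
  have hinv : (jetChart c j).symm (jetCoord c j) = j := (jetChart c j).left_inv hc
  have h5 : MDifferentiableAt 𝓘(ℝ, JModel k n) 𝓘(ℝ, JModel k n) (jetChart c j).symm
    (jetCoord c j) := (h2.contMDiffAt (h4.mem_nhds hj)).mdifferentiableAt (by simp)
  have h6 := tmap_comp (g := (Jet1.pt : Jet1 P → E)) (f := (jetChart c j).symm)
    (p := jetCoord c j) ((contMDiff_pt _).mdifferentiableAt (by simp)) h5
  rw [hinv] at h6
  have h7 := tmap_comp (V := JModel k n) (V' := BModel k × FModel n) (g := c.total.symm)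
    (f := (Prod.fst : JModel k n → BModel k × FModel n)) (p := jetCoord c j)
    (c.mdiff_total_symm (c.total.map_source hc))
    (mdifferentiableAt_iff_differentiableAt.2 differentiableAt_fst)
  have h8 : (tmap (fun z : JModel k n => c.total.symm z.1) (jetCoord c j) :
      JModel k n →L[ℝ] BModel k × FModel n) =
      tmap (fun z => Jet1.pt ((jetChart c j).symm z)) (jetCoord c j) := tmap_congr (by
    filter_upwards [h4.mem_nhds hj] with z hz
    classical
    have hz' : z.1 ∈ c.total.target := hz
    change _ = (dite _ _ _ : Jet1 P).pt
    rw [dif_pos hz'])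
  rw [h7, h6, tmap_eq_fderiv, fderiv_fst] at h8
  intro v
  refine ⟨(tmap (jetChart c j).symm (jetCoord c j) : JModel k n →L[ℝ] JModel k n)
    (c.T j.pt v, 0), ?_⟩
  have h9 := congrArg (fun f => f (c.T j.pt v, 0)) h8
  exact h9.symm.trans (c.Ti_T hc v)

/-- The canonical form `θ = T π₁₀ - T_x s ∘ T π₁` at the jet `j¹_x s`. -/
def theta (j : Jet1 P) : JModel k n →L[ℝ] BModel k × FModel n :=
  tmap Jet1.pt j - j.lin.comp (tmap Jet1.base j)

/-- The fibre at `j` of the contact subbundle of `m`-forms: the forms of degree `m = k + 1` in the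
ideal generated by the contact forms `α ∘ θ` which vanish on any two `π₁`-vertical vectors. -/
def contactSpace (j : Jet1 P) : Submodule ℝ (JModel k n [⋀^Fin (k + 1)]→L[ℝ] ℝ) :=
  idealForms (theta j) k ⊓ horizontalForms (tmap Jet1.base j : JModel k n →L[ℝ] BModel k) 2 (k + 1)

end Bundle

/-- A volume form on the base: a smooth nowhere vanishing form of top degree. -/
structure VolumeForm (k : ℕ) (M : Type*) [TopologicalSpace M] [ChartedSpace (BModel k) M] where
  form : DForm (BModel k) M (k + 1)
  smooth : IsSmoothForm form
  ne_zero : ∀ x, form x ≠ 0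

section Cartan

variable {k n : ℕ} {M E Q : Type*} [TopologicalSpace M]
  [ChartedSpace (BModel k) M] [TopologicalSpace E] [ChartedSpace (BModel k × FModel n) E]
  [TopologicalSpace Q] [ChartedSpace (FModel n) Q]
  [IsManifold 𝓘(ℝ, BModel k) ∞ M] [IsManifold 𝓘(ℝ, FModel n) ∞ Q]

/-- The affine subbundle `W = L η + I` of the bundle of `m`-forms on `J¹π`, where `I` is the contact
subbundle: its points are the pairs of a jet `j` and an `m`-covector `α` at `j` such that
`α - (L η)_j` is in the contact subbundle. -/
@[ext]
structure CartanBundle (P : SmoothFibreBundle k n M E Q) (η : VolumeForm k M) (L : Jet1 P → ℝ) where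
  jet : Jet1 P
  form : JModel k n [⋀^Fin (k + 1)]→L[ℝ] ℝ
  mem : form - L jet • pullback Jet1.base η.form jet ∈ contactSpace jet

/-- The model of `W`, with coordinates `((x, u, u_x), p)`. -/
abbrev WModel (k n : ℕ) : Type := JModel k n × (FModel n →L[ℝ] BModel k)

variable {P : SmoothFibreBundle k n M E Q} {η : VolumeForm k M} {L : Jet1 P → ℝ}

theorem alt_add_sub {T : Type*} [NormedAddCommGroup T] [NormedSpace ℝ T] {q : ℕ}
    (a b : T [⋀^Fin q]→L[ℝ] ℝ) : a + b - a = b := by ext v; simp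

theorem alt_add_sub' {T : Type*} [NormedAddCommGroup T] [NormedSpace ℝ T] {q : ℕ}
    (a b : T [⋀^Fin q]→L[ℝ] ℝ) : a + (b - a) = b := by ext v; simp

/-- The element of the contact subbundle with multipliers `p` in a fibred chart. -/
def multForm (η : VolumeForm k M) (c : FibredChart P) (j : Jet1 P) (p : FModel n →L[ℝ] BModel k) :
    JModel k n [⋀^Fin (k + 1)]→L[ℝ] ℝ :=
  multiplierForm (η.form j.base) (tmap Jet1.base j) (theta j)
    ((c.Si (P.proj j.pt)).comp (p.comp ((ContinuousLinearMap.snd ℝ _ _).comp (c.T j.pt))))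

theorem multForm_mem (η : VolumeForm k M) (c : FibredChart P) (j : Jet1 P)
    (p : FModel n →L[ℝ] BModel k) : multForm η c j p ∈ contactSpace j :=
  Submodule.mem_inf.2
    ⟨multiplierForm_mem_ideal _ _ _ _, multiplierForm_mem_horizontal _ _ _ _⟩

theorem tmap_proj_theta (j : Jet1 P) (v : JModel k n) :
    (tmap P.proj j.pt : (BModel k × FModel n) →L[ℝ] BModel k) (theta j v) = 0 := by
  have h := fun b => congrArg (fun f => f b) j.isSection
  have h1 : theta j v = (tmap Jet1.pt j : JModel k n →L[ℝ] BModel k × FModel n) v -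
    j.lin ((tmap Jet1.base j : JModel k n →L[ℝ] BModel k) v) := rfl
  rw [h1, map_sub, tmap_base]
  have h2 := h ((tmap P.proj j.pt : (BModel k × FModel n) →L[ℝ] BModel k)
    ((tmap Jet1.pt j : JModel k n →L[ℝ] BModel k × FModel n) v))
  exact sub_eq_zero.2 h2.symm

theorem exists_multForm (η : VolumeForm k M) (c : FibredChart P) (j : Jet1 P)
    (hj : j.pt ∈ c.total.source) {ρ : JModel k n [⋀^Fin (k + 1)]→L[ℝ] ℝ}
    (hρ : ρ ∈ contactSpace j) : ∃ p, ρ = multForm η c j p := by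
  obtain ⟨Φ, hΦ⟩ := exists_multiplierForm (by simp) (η.ne_zero j.base) (tmap_pt_surjective j)
    (tmap_base j) j.isSection (Submodule.mem_inf.1 hρ).1
    (Submodule.mem_inf.1 hρ).2
  refine ⟨(c.S (P.proj j.pt)).comp (Φ.comp ((c.Ti j.pt).comp
    (ContinuousLinearMap.inr ℝ (BModel k) (FModel n)))), hΦ.trans ?_⟩
  refine multiplierForm_congr _ _ _ fun v => ?_
  have h1 : ((0 : BModel k), (c.T j.pt (theta j v)).2) = c.T j.pt (theta j v) := by
    refine Prod.ext ?_ rfl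
    rw [c.fst_T hj, tmap_proj_theta, map_zero]
  simp only [ContinuousLinearMap.comp_apply, ContinuousLinearMap.coe_snd',
    ContinuousLinearMap.inr_apply]
  change Φ (theta j v) = c.Si (P.proj j.pt) (c.S (P.proj j.pt)
    (Φ (c.Ti j.pt (0, (c.T j.pt (theta j v)).2))))
  rw [c.Si_S (c.proj_mem _ hj), h1, c.Ti_T hj]

theorem multForm_injective (η : VolumeForm k M) (c : FibredChart P) (j : Jet1 P)
    (hj : j.pt ∈ c.total.source) {p p' : FModel n →L[ℝ] BModel k}
    (h : multForm η c j p = multForm η c j p') : p = p' := by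
  ext1 f
  have h1 := multiplierForm_inj (by simp) (η.ne_zero j.base) (tmap_pt_surjective j)
    (tmap_base j) j.isSection h (f := c.Ti j.pt (0, f)) (by
      have h2 := c.fst_T hj (c.Ti j.pt (0, f))
      rw [c.T_Ti hj] at h2
      have h3 := congrArg (c.Si (P.proj j.pt)) h2
      rw [c.Si_S (c.proj_mem _ hj)] at h3
      simpa using h3.symm)
  simp only [ContinuousLinearMap.comp_apply, ContinuousLinearMap.coe_snd', c.T_Ti hj] at h1
  have h2 := congrArg (c.S (P.proj j.pt)) h1
  rwa [c.S_Si (c.proj_mem _ hj), c.S_Si (c.proj_mem _ hj)] at h2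

open Classical in
/-- The multipliers `p` of a point of `W` in a fibred chart. -/
def multCoord (c : FibredChart P) (w : CartanBundle P η L) : FModel n →L[ℝ] BModel k :=
  if h : ∃ p, w.form - L w.jet • pullback Jet1.base η.form w.jet = multForm η c w.jet p
  then h.choose else 0

theorem multForm_multCoord (c : FibredChart P) (w : CartanBundle P η L)
    (h : w.jet.pt ∈ c.total.source) :
    multForm η c w.jet (multCoord c w) =
      w.form - L w.jet • pullback Jet1.base η.form w.jet := by
  have h' := exists_multForm η c w.jet h w.mem
  rw [multCoord, dif_pos h']
  exact h'.choose_spec.symm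

theorem multCoord_eq (c : FibredChart P) (w : CartanBundle P η L)
    (h : w.jet.pt ∈ c.total.source) {p : FModel n →L[ℝ] BModel k}
    (hp : w.form - L w.jet • pullback Jet1.base η.form w.jet = multForm η c w.jet p) :
    multCoord c w = p :=
  multForm_injective η c w.jet h ((multForm_multCoord c w h).trans hp)

/-- The coordinates `((x, u, u_x), p)` of a point of `W` in a fibred chart. -/
def cartanCoord (c : FibredChart P) (w : CartanBundle P η L) : WModel k n :=
  (jetCoord c w.jet, multCoord c w)

open Classical in
/-- The chart `((x, u, u_x), p)` of `W` defined by a fibred chart; `w₀` is the value of its inverse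
outside of the target. -/
def cartanChart (c : FibredChart P) (w₀ : CartanBundle P η L) :
    PartialEquiv (CartanBundle P η L) (WModel k n) where
  toFun := cartanCoord c
  invFun z := if z.1.1 ∈ c.total.target then
    ⟨(jetChart c w₀.jet).symm z.1,
      L ((jetChart c w₀.jet).symm z.1) •
          pullback Jet1.base η.form ((jetChart c w₀.jet).symm z.1) +
        multForm η c ((jetChart c w₀.jet).symm z.1) z.2,
      by rw [alt_add_sub]; exact multForm_mem η c _ _⟩ else w₀
  source := {w | w.jet.pt ∈ c.total.source}
  target := {z | z.1.1 ∈ c.total.target}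
  map_source' := fun w hw => c.total.map_source hw
  map_target' := fun z hz => by
    have hz' : z.1.1 ∈ c.total.target := hz
    rw [if_pos hz']
    exact (jetChart c w₀.jet).map_target hz'
  left_inv' := fun w hw => by
    have hw' : w.jet.pt ∈ c.total.source := hw
    have h : (cartanCoord c w).1.1 ∈ c.total.target := c.total.map_source hw'
    rw [if_pos h]
    have h1 : (jetChart c w₀.jet).symm (cartanCoord c w).1 = w.jet :=
      (jetChart c w₀.jet).left_inv hw'
    refine CartanBundle.ext h1 ?_
    change L ((jetChart c w₀.jet).symm (cartanCoord c w).1) •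
          pullback Jet1.base η.form ((jetChart c w₀.jet).symm (cartanCoord c w).1) +
        multForm η c ((jetChart c w₀.jet).symm (cartanCoord c w).1) (multCoord c w) = w.form
    rw [h1, multForm_multCoord c w hw']
    exact alt_add_sub' _ _
  right_inv' := fun z hz => by
    have hz' : z.1.1 ∈ c.total.target := hz
    rw [if_pos hz']
    refine Prod.ext ((jetChart c w₀.jet).right_inv hz') ?_
    exact multCoord_eq c (⟨_, _, _⟩ : CartanBundle P η L)
      ((jetChart c w₀.jet).map_target hz') (alt_add_sub _ _)

/-- Change of coordinates on `W`. -/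
def cartanChange (c c' : FibredChart P) (z : WModel k n) : WModel k n :=
  (jetChange c c' z.1, (fderiv ℝ (c.Φ c') z.1.1.1).comp (z.2.comp
    ((ContinuousLinearMap.snd ℝ _ _).comp ((fderiv ℝ (c'.Ψ c) (c.Ψ c' z.1.1)).comp
      (ContinuousLinearMap.inr ℝ (BModel k) (FModel n))))))

theorem cartanCoord_change (c c' : FibredChart P) (w : CartanBundle P η L)
    (h : w.jet.pt ∈ c.total.source) (h' : w.jet.pt ∈ c'.total.source) :
    cartanCoord c' w = cartanChange c c' (cartanCoord c w) := by
  have hx := c.proj_mem _ h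
  have hx' := c'.proj_mem _ h'
  refine Prod.ext (jetCoord_change c c' w.jet h h') ?_
  have h1 : c.Ψ c' (cartanCoord c w).1.1 = c'.total w.jet.pt :=
    congrArg c'.total (c.total.left_inv h)
  have h2 : fderiv ℝ (c'.Ψ c) (c'.total w.jet.pt) = (c.T w.jet.pt).comp (c'.Ti w.jet.pt) :=
    (c'.T_comp_Ti c h' h).symm
  have h3 : fderiv ℝ (c.Φ c') (cartanCoord c w).1.1.1 =
      (c'.S (P.proj w.jet.pt)).comp (c.Si (P.proj w.jet.pt)) := by
    have h4 : (cartanCoord c w).1.1.1 = c.base (P.proj w.jet.pt) := c.fst_total _ h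
    rw [h4]
    exact (c.S_comp_Si c' hx hx').symm
  refine multCoord_eq c' w h' ?_
  rw [← multForm_multCoord c w h]
  refine multiplierForm_congr _ _ _ fun v => ?_
  have h5 : ((0 : BModel k), (c'.T w.jet.pt (theta w.jet v)).2) = c'.T w.jet.pt (theta w.jet v) := by
    refine Prod.ext ?_ rfl
    rw [c'.fst_T h', tmap_proj_theta, map_zero]
  simp only [cartanChange]
  rw [h1, h2, h3]
  simp only [ContinuousLinearMap.comp_apply, ContinuousLinearMap.coe_snd',
    ContinuousLinearMap.inr_apply]
  rw [c'.Si_S hx', h5, c'.Ti_T h']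
  rfl

theorem contDiffOn_cartanChange (c c' : FibredChart P) :
    ContDiffOn ℝ ∞ (cartanChange c c') {z | z.1.1 ∈ c.dom c'} := by
  have hfst : ContDiffOn ℝ ∞ (Prod.fst : WModel k n → JModel k n)
      {z | z.1.1 ∈ c.dom c'} := contDiff_fst.contDiffOn
  have h0 : ContDiffOn ℝ ∞ (fun z : WModel k n => z.1.1) {z | z.1.1 ∈ c.dom c'} :=
    contDiff_fst.comp_contDiffOn hfst
  have h1 : ContDiffOn ℝ ∞ (fun z : WModel k n => c.Ψ c' z.1.1) {z | z.1.1 ∈ c.dom c'} :=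
    (c.contDiffOn_Ψ c').comp h0 fun z hz => hz
  have h2 : ContDiffOn ℝ ∞ (fun z : WModel k n => fderiv ℝ (c'.Ψ c) (c.Ψ c' z.1.1))
      {z | z.1.1 ∈ c.dom c'} := by
    refine ((c'.contDiffOn_Ψ c).fderiv_of_isOpen (c'.isOpen_dom c) (by simp)).comp h1 fun z hz => ?_
    obtain ⟨hz1, hz2⟩ := (c.mem_dom c').1 hz
    refine (c'.mem_dom c).2 ⟨c'.total.map_source hz2, ?_⟩
    change c'.total.symm (c'.total (c.total.symm z.1.1)) ∈ _
    rw [c'.total.left_inv hz2]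
    exact c.total.map_target hz1
  have h3 : ContDiffOn ℝ ∞ (fun z : WModel k n => fderiv ℝ (c.Φ c') z.1.1.1)
      {z | z.1.1 ∈ c.dom c'} := by
    refine ((c.contDiffOn_Φ c').fderiv_of_isOpen (c.base.symm.trans c'.base).open_source
      (by simp)).comp (contDiff_fst.comp_contDiffOn h0) fun z hz => ?_
    obtain ⟨hz1, hz2⟩ := (c.mem_dom c').1 hz
    rw [OpenPartialHomeomorph.trans_source]
    have h4 : z.1.1.1 = c.base (P.proj (c.total.symm z.1.1)) := by
      rw [← c.fst_total _ (c.total.map_target hz1), c.total.right_inv hz1]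
    have hb := c.proj_mem _ (c.total.map_target hz1)
    refine ⟨?_, ?_⟩
    · change z.1.1.1 ∈ c.base.target
      rw [h4]; exact c.base.map_source hb
    · change c.base.symm z.1.1.1 ∈ c'.base.source
      rw [h4, c.base.left_inv hb]
      exact c'.proj_mem _ hz2
  exact ((contDiffOn_jetChange c c').comp hfst fun z hz => hz).prodMk
    (h3.clm_comp (contDiff_snd.contDiffOn.clm_comp
      (contDiffOn_const.clm_comp (h2.clm_comp contDiffOn_const))))

theorem cartanChart_symm_jet (c : FibredChart P) (w₀ : CartanBundle P η L) {z : WModel k n}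
    (hz : z.1.1 ∈ c.total.target) :
    ((cartanChart c w₀).symm z).jet = (jetChart c w₀.jet).symm z.1 := by
  classical
  change (ite _ _ _ : CartanBundle P η L).jet = _
  rw [if_pos hz]

theorem cartanChart_trans_source (c c' : FibredChart P) (w₀ w₀' : CartanBundle P η L) :
    ((cartanChart c w₀).symm.trans (cartanChart c' w₀')).source = {z | z.1.1 ∈ c.dom c'} := by
  ext z
  have h := congrArg (fun s => z.1 ∈ s) (jetChart_trans_source c c' w₀.jet w₀'.jet)
  rw [PartialEquiv.trans_source] at h ⊢
  change (z.1.1 ∈ c.total.target ∧ ((cartanChart c w₀).symm z).jet.pt ∈ c'.total.source) ↔ _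
  change (z.1.1 ∈ c.total.target ∧ ((jetChart c w₀.jet).symm z.1).pt ∈ c'.total.source) =
    (z.1.1 ∈ c.dom c') at h
  refine Iff.trans (and_congr_right fun hz => ?_) (iff_of_eq h)
  rw [cartanChart_symm_jet c w₀ hz]

theorem cartanChart_trans_eqOn (c c' : FibredChart P) (w₀ w₀' : CartanBundle P η L) :
    Set.EqOn ((cartanChart c w₀).symm.trans (cartanChart c' w₀')) (cartanChange c c')
      ((cartanChart c w₀).symm.trans (cartanChart c' w₀')).source := by
  intro z hz
  rw [PartialEquiv.trans_source] at hz
  have hz1 : z ∈ (cartanChart c w₀).target := hz.1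
  have h1 := (cartanChart c w₀).map_target hz1
  have h2 := cartanCoord_change c c' ((cartanChart c w₀).symm z) h1 hz.2
  have h3 : cartanCoord c ((cartanChart c w₀).symm z) = z := (cartanChart c w₀).right_inv hz1
  rw [h3] at h2
  exact h2

variable (P η L) in
/-- The atlas of `W` consisting of the charts defined by the fibred charts of `π`. -/
def cartanAtlas : SmoothAtlas (WModel k n) (CartanBundle P η L) where
  charts := {f | ∃ c w₀, f = cartanChart c w₀}
  chartAt w := cartanChart (exists_fibredChart P w.jet.pt).choose w
  mem_source w := (exists_fibredChart P w.jet.pt).choose_spec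
  mem_charts w := ⟨_, _, rfl⟩
  open_source := by
    rintro _ _ ⟨c, w₀, rfl⟩ ⟨c', w₀', rfl⟩
    rw [cartanChart_trans_source]
    exact (c.isOpen_dom c').preimage (continuous_fst.comp continuous_fst)
  contDiffOn := by
    rintro _ _ ⟨c, w₀, rfl⟩ ⟨c', w₀', rfl⟩
    refine ContDiffOn.congr ?_ (cartanChart_trans_eqOn c c' w₀ w₀')
    rw [cartanChart_trans_source]
    exact contDiffOn_cartanChange c c'

instance : TopologicalSpace (CartanBundle P η L) := (cartanAtlas P η L).toCore.toTopologicalSpace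
instance : ChartedSpace (WModel k n) (CartanBundle P η L) :=
  (cartanAtlas P η L).toCore.toChartedSpace
instance : IsManifold 𝓘(ℝ, WModel k n) ∞ (CartanBundle P η L) := (cartanAtlas P η L).isManifold

/-- The projection `W → M`. -/
def CartanBundle.base (w : CartanBundle P η L) : M := w.jet.base

variable (P η L) in
/-- The Cartan form `λ` on `W`: the value at `w = (j, α)` is the pullback of `α` under the tangent
map of the projection `W → J¹π`. -/
def cartanForm : DForm (WModel k n) (CartanBundle P η L) (k + 1) := fun w =>
  w.form.compContinuousLinearMap (tmap CartanBundle.jet w)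

/-- A vector field on `W` is vertical over `M` if it is annihilated by the tangent map of the
projection `W → M`. -/
def IsVertical (X : ∀ w : CartanBundle P η L, TangentSpace 𝓘(ℝ, WModel k n) w) : Prop :=
  ∀ w, (tmap CartanBundle.base w : WModel k n →L[ℝ] BModel k) (X w) = 0

end Cartan

/-! ### The action and its critical sections -/

section Action

open MeasureTheory Set

variable {k n : ℕ} {M E Q : Type*} [TopologicalSpace M]
  [ChartedSpace (BModel k) M] [TopologicalSpace E] [ChartedSpace (BModel k × FModel n) E]
  [TopologicalSpace Q] [ChartedSpace (FModel n) Q]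

variable (k M) in
/-- The base can be partitioned into measurable sets, countably many of them nonempty, each of them
in the domain of a chart. -/
theorem exists_chart_partition [SecondCountableTopology M] [MeasurableSpace M] [BorelSpace M] :
    ∃ A : M → Set M, {p | (A p).Nonempty}.Countable ∧ (∀ p, MeasurableSet (A p)) ∧
      Pairwise (fun p q => Disjoint (A p) (A q)) ∧ ⋃ p, A p = univ ∧
      ∀ p, A p ⊆ (chartAt (BModel k) p).source := by
  classical
  obtain ⟨s, hs, hu⟩ := TopologicalSpace.countable_cover_nhds
    (f := fun p : M => (chartAt (BModel k) p).source)
    (fun p => (chartAt (BModel k) p).open_source.mem_nhds (mem_chart_source _ p))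
  obtain ⟨f, hf⟩ := Set.countable_iff_exists_injOn.1 hs
  refine ⟨fun p => if p ∈ s then (chartAt (BModel k) p).source \
    ⋃ q ∈ {q ∈ s | f q < f p}, (chartAt (BModel k) q).source else ∅, ?_, ?_, ?_, ?_, ?_⟩
  · refine hs.mono fun p hp => ?_
    by_contra h
    simp [h] at hp
  · intro p
    dsimp only
    split_ifs with h
    · exact (chartAt (BModel k) p).open_source.measurableSet.diff
        (isOpen_biUnion fun q _ => (chartAt (BModel k) q).open_source).measurableSet
    · exact MeasurableSet.empty
  · intro p q hpq
    rw [Set.disjoint_left]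
    intro x hx hx'
    dsimp only at hx hx'
    by_cases hp : p ∈ s
    · by_cases hq : q ∈ s
      · rw [if_pos hp] at hx
        rw [if_pos hq] at hx'
        rcases lt_trichotomy (f p) (f q) with h | h | h
        · exact hx'.2 (mem_biUnion (x := p) ⟨hp, h⟩ hx.1)
        · exact hpq (hf hp hq h)
        · exact hx.2 (mem_biUnion (x := q) ⟨hq, h⟩ hx'.1)
      · simp [hq] at hx'
    · simp [hp] at hx
  · refine eq_univ_of_forall fun x => ?_
    have hx : ∃ N, ∃ p ∈ s, f p = N ∧ x ∈ (chartAt (BModel k) p).source := by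
      have : x ∈ ⋃ p ∈ s, (chartAt (BModel k) p).source := by rw [hu]; trivial
      obtain ⟨p, hp, hxp⟩ := mem_iUnion₂.1 this
      exact ⟨f p, p, hp, rfl, hxp⟩
    obtain ⟨p, hp, hpN, hxp⟩ := Nat.find_spec hx
    refine mem_iUnion.2 ⟨p, ?_⟩
    rw [if_pos hp]
    refine ⟨hxp, fun h => ?_⟩
    obtain ⟨q, ⟨hq, hlt⟩, hxq⟩ := mem_iUnion₂.1 h
    exact Nat.find_min hx (by rw [← hpN]; exact hlt) ⟨q, hq, rfl, hxq⟩
  · intro p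
    dsimp only
    split_ifs with h
    · exact sdiff_subset
    · exact empty_subset _

/-- The density of a volume form with respect to Lebesgue measure in the preferred chart at `p`. -/
def chartDensity (η : VolumeForm k M) (p : M) (y : BModel k) : ENNReal :=
  ENNReal.ofReal |chartRep η.form p y fun i => EuclideanSpace.single i 1|

/-- The measure defined by a volume form `η`. If `M` is oriented by `η`, then the integral of the
`m`-form `f η` over `M` is the integral of the function `f` with respect to this measure. In charts,
it is the measure with density `|η(∂₁, …, ∂_m)|` with respect to Lebesgue measure. -/
def volumeMeasure [SecondCountableTopology M] [MeasurableSpace M] [BorelSpace M]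
    (η : VolumeForm k M) : Measure M :=
  Measure.sum fun p : M =>
    ((volume.restrict ((chartAt (BModel k) p).target ∩
      (chartAt (BModel k) p).symm ⁻¹' (exists_chart_partition k M).choose p)).withDensity
        (chartDensity η p)).map (chartAt (BModel k) p).symm

variable {P : SmoothFibreBundle k n M E Q}

open Classical in
/-- The function `L ∘ j¹s`. The second case does not occur where `s` is a smooth section. -/
def lagrangianAlong (L : Jet1 P → ℝ) (s : M → E) (x : M) : ℝ :=
  if h : (tmap P.proj (s x) : (BModel k × FModel n) →L[ℝ] BModel k).comp (tmap s x) =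
    ContinuousLinearMap.id ℝ (BModel k) then L ⟨s x, tmap s x, h⟩ else 0

/-- A map `s` is a smooth section of the bundle over the set `U`. -/
def IsSectionOn (P : SmoothFibreBundle k n M E Q) (s : M → E) (U : Set M) : Prop :=
  ContMDiffOn 𝓘(ℝ, BModel k) 𝓘(ℝ, BModel k × FModel n) ∞ s U ∧ ∀ x ∈ U, P.proj (s x) = x

/-- A smooth variation of `s` over `U`, through sections that agree with `s` outside of `K`. -/
structure IsVariation (P : SmoothFibreBundle k n M E Q) (s : M → E) (U K : Set M) (δ : ℝ)
    (σ : ℝ → M → E) : Prop where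
  smooth : ContMDiffOn (𝓘(ℝ, ℝ).prod 𝓘(ℝ, BModel k)) 𝓘(ℝ, BModel k × FModel n) ∞
    (fun z : ℝ × M => σ z.1 z.2) (Ioo (-δ) δ ×ˢ U)
  proj_eq : ∀ ε ∈ Ioo (-δ) δ, ∀ x ∈ U, P.proj (σ ε x) = x
  zero_eq : ∀ x ∈ U, σ 0 x = s x
  eq_off : ∀ ε ∈ Ioo (-δ) δ, ∀ x ∈ U \ K, σ ε x = s x

/-- A section `s` over the open set `U` is critical for the Lagrangian density `L η` if the first
variation of the action `∫ (j¹s)^* L η` vanishes for every variation of `s` with compact support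
in `U`. -/
def IsCritical [SecondCountableTopology M] [MeasurableSpace M] [BorelSpace M]
    (η : VolumeForm k M) (L : Jet1 P → ℝ) (U : Set M) (s : M → E) : Prop :=
  ∀ K ⊆ U, IsCompact K → ∀ δ > 0, ∀ σ : ℝ → M → E, IsVariation P s U K δ σ →
    HasDerivAt (fun ε => ∫ x in K, lagrangianAlong L (σ ε) x ∂(volumeMeasure η)) 0 0

end Action

end LFT

end

/-!
Both conditions on the section `s` are equivalent to the Euler–Lagrange equations
`r ∂L/∂u - ∂ᵢ (r ∂L/∂uᵢ) = 0`, `r = |η(∂₁, …, ∂_m)|`, in every fibred chart; the left-hand side is `eulerLagrange`.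

*Critical sections.* For a variation with variational field `V`, the derivative of the Lagrangian
is `∂L/∂u · V + ∂L/∂u_x · ∂V`, and after multiplication with `r` it differs from the Euler–Lagrange
expression applied to `V` by a divergence (`first_variation_eq`). The action may be differentiated
under the integral sign (`IsVariation.hasDerivAt_action`), and the divergence integrates to zero,
so that the first variation of a variation supported in one chart is the integral of the
Euler–Lagrange expression against `V` (`IsVariation.integral_deriv_eq`). A general variation `σ` is
localised by a partition of unity `f`: the maps `(ε, x) ↦ σ(f_i(x) ε, x)` are variations again, and
their variational fields add up to that of `σ` (`isCritical_of_eulerLagrange`). Conversely, every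
test function in a chart is a component of the field of some variation, and the fundamental lemma
of the calculus of variations applies (`IsCritical.eulerLagrange_eq_zero`).

*Sections of `W`.* A fibred chart gives coordinates `((x, u, u_x), p)` on `W` in which the Cartan
form is `λ = L η + p (du - u_x dx) ⌟ η` (`formRep_cartanForm`). The exterior derivative is natural
and may be computed there. For a section of `W` over `s`, the contraction of `dλ` with a vertical
vector `X` is, on the tangent vectors of the section and with `ρ = η(∂₁, …, ∂_m)`,
`ρ (∂L/∂(u, u_x) · X + tr (X_p (∂u - u_x)) - tr (p X_{u_x})) - ∂ⱼ (ρ p X_u)ʲ`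
(`extDeriv_localCartan`). Vertical
vectors extend to global smooth vertical fields (`exists_vertical_field`), so the equations can be
tested one direction at a time. The directions `p` give `u_x = ∂u`, that is, the section projects
to `j¹s`; the directions `u_x` give `p = ∂L/∂u_x`, that is, the section is the Legendre transform
of `j¹s` (`cartanSec_eq`); the directions `u` then give the Euler–Lagrange equations
(`eulerLagrange_eq_zero_of_section`). Conversely, the Legendre transform of `j¹s` does not depend
on the chart (`momentum_change`), hence is a smooth global section (`exists_legendre_section`), and
on it the contraction is the Euler–Lagrange expression up to sign
(`pullback_interior_eq_zero_of_eulerLagrange`).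
-/

noncomputable section

namespace LFT

open MeasureTheory Set Filter Topology

/-! ### The volume measure in charts -/

section Volume

variable {k : ℕ} {M : Type*} [TopologicalSpace M] [ChartedSpace (BModel k) M]

/-- The density `η(∂₁, …, ∂_m)` of a volume form in a chart `e`, as a function on the model. -/
def formDensity (η : VolumeForm k M) (e : OpenPartialHomeomorph M (BModel k)) (y : BModel k) : ℝ :=
  (η.form (e.symm y)).compContinuousLinearMap (tmap e.symm y)
    fun i => EuclideanSpace.single i (1 : ℝ)

/-- A form of top degree is multiplied by the determinant under a linear map. -/
theorem map_comp_single (f : BModel k [⋀^Fin (k + 1)]→L[ℝ] ℝ) (A : BModel k →L[ℝ] BModel k) :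
    (f fun i => A (EuclideanSpace.single i (1 : ℝ))) =
      A.det * f fun i => EuclideanSpace.single i (1 : ℝ) := by
  let b := (EuclideanSpace.basisFun (Fin (k + 1)) ℝ).toBasis
  have hb : ∀ i, b i = EuclideanSpace.single i (1 : ℝ) := fun i => by simp [b]
  have h := f.toAlternatingMap.eq_smul_basis_det b
  have h1 : ∀ v : Fin (k + 1) → BModel k, f v = f b * b.det v := fun v => by
    have := congrArg (fun g : BModel k [⋀^Fin (k + 1)]→ₗ[ℝ] ℝ => g v) h
    simpa using this
  have h2 : (fun i => EuclideanSpace.single i (1 : ℝ) : Fin (k + 1) → BModel k) = b :=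
    funext fun i => (hb i).symm
  have h3 : (fun i => A (EuclideanSpace.single i (1 : ℝ))) = (A : BModel k →ₗ[ℝ] BModel k) ∘ b :=
    funext fun i => by simp [hb]
  rw [h3, h2, h1, b.det_comp, b.det_self]
  change _ = LinearMap.det (A : BModel k →ₗ[ℝ] BModel k) * f b
  ring

/-- A nonzero form of top degree does not vanish on the standard basis. -/
theorem apply_single_ne_zero {f : BModel k [⋀^Fin (k + 1)]→L[ℝ] ℝ} (hf : f ≠ 0) :
    (f fun i => EuclideanSpace.single i (1 : ℝ)) ≠ 0 := by
  intro h
  apply hf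
  let b := (EuclideanSpace.basisFun (Fin (k + 1)) ℝ).toBasis
  have hb : (b : Fin (k + 1) → BModel k) = fun i => EuclideanSpace.single i (1 : ℝ) :=
    funext fun i => by simp [b]
  have h1 := f.toAlternatingMap.eq_smul_basis_det b
  have h2 : f.toAlternatingMap b = 0 := by rw [hb]; exact h
  rw [h2, zero_smul] at h1
  exact ContinuousAlternatingMap.toAlternatingMap_injective h1

variable {e e' : OpenPartialHomeomorph M (BModel k)}

/-- A chart of the underlying topological manifold that is compatible with the smooth structure:
both directions are smooth. -/
structure IsSmoothChart (e : OpenPartialHomeomorph M (BModel k)) : Prop where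
  smooth : ContMDiffOn 𝓘(ℝ, BModel k) 𝓘(ℝ, BModel k) ∞ e e.source
  symm_smooth : ContMDiffOn 𝓘(ℝ, BModel k) 𝓘(ℝ, BModel k) ∞ e.symm e.target

theorem isSmoothChart_chartAt [IsManifold 𝓘(ℝ, BModel k) ∞ M] (p : M) :
    IsSmoothChart (chartAt (BModel k) p) :=
  ⟨contMDiffOn_chart, contMDiffOn_chart_symm⟩

namespace IsSmoothChart

theorem mdiff (h : IsSmoothChart e) {x : M} (hx : x ∈ e.source) :
    MDifferentiableAt 𝓘(ℝ, BModel k) 𝓘(ℝ, BModel k) e x :=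
  (h.smooth.contMDiffAt (e.open_source.mem_nhds hx)).mdifferentiableAt (by simp)

theorem mdiff_symm (h : IsSmoothChart e) {y : BModel k} (hy : y ∈ e.target) :
    MDifferentiableAt 𝓘(ℝ, BModel k) 𝓘(ℝ, BModel k) e.symm y :=
  (h.symm_smooth.contMDiffAt (e.open_target.mem_nhds hy)).mdifferentiableAt (by simp)

theorem contDiffOn_trans (h : IsSmoothChart e) (h' : IsSmoothChart e') :
    ContDiffOn ℝ ∞ (fun y => e' (e.symm y)) (e.symm.trans e').source := by
  rw [← contMDiffOn_iff_contDiffOn, OpenPartialHomeomorph.trans_source]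
  exact h'.smooth.comp (h.symm_smooth.mono fun z hz => hz.1) fun z hz => hz.2

/-- The tangent maps of the inverses of two charts differ by the derivative of the change of
coordinates. -/
theorem tmap_symm (h : IsSmoothChart e) (h' : IsSmoothChart e') {y : BModel k} (hy : y ∈ e.target)
    (hy' : e.symm y ∈ e'.source) : (tmap e.symm y : BModel k →L[ℝ] BModel k) =
      (tmap e'.symm (e' (e.symm y)) : BModel k →L[ℝ] BModel k).comp
        (fderiv ℝ (fun y => e' (e.symm y)) y) := by
  have hm : (e.symm.trans e').source ∈ 𝓝 y := by
    refine (e.symm.trans e').open_source.mem_nhds ?_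
    rw [OpenPartialHomeomorph.trans_source]; exact ⟨hy, hy'⟩
  have hd : DifferentiableAt ℝ (fun y => e' (e.symm y)) y :=
    ((h.contDiffOn_trans h').contDiffAt hm).differentiableAt (by simp)
  have h1 := tmap_comp (g := e'.symm) (f := fun y => e' (e.symm y)) (p := y)
    (h'.mdiff_symm (e'.map_source hy')) hd.mdifferentiableAt
  rw [tmap_eq_fderiv] at h1
  refine Eq.trans (tmap_congr ?_) h1
  filter_upwards [hm] with z hz
  rw [OpenPartialHomeomorph.trans_source] at hz
  exact (e'.left_inv hz.2).symm

theorem tmap_symm_bijective (h : IsSmoothChart e) {y : BModel k} (hy : y ∈ e.target) :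
    (tmap e (e.symm y) : BModel k →L[ℝ] BModel k).comp (tmap e.symm y) =
      ContinuousLinearMap.id ℝ _ := by
  rw [← tmap_comp (h.mdiff (e.map_target hy)) (h.mdiff_symm hy), ← tmap_id (V := BModel k) y]
  exact tmap_congr (by
    filter_upwards [e.open_target.mem_nhds hy] with z hz using e.right_inv hz)

/-- The density changes by the Jacobian determinant of the change of coordinates. -/
theorem formDensity_trans (h : IsSmoothChart e) (h' : IsSmoothChart e') (η : VolumeForm k M)
    {y : BModel k} (hy : y ∈ e.target) (hy' : e.symm y ∈ e'.source) :
    formDensity η e y = (fderiv ℝ (fun y => e' (e.symm y)) y).det *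
      formDensity η e' (e' (e.symm y)) := by
  rw [formDensity, h.tmap_symm h' hy hy']
  have h1 := map_comp_single ((η.form (e.symm y)).compContinuousLinearMap
    (tmap e'.symm (e' (e.symm y)) : BModel k →L[ℝ] BModel k)) (fderiv ℝ (fun y => e' (e.symm y)) y)
  refine h1.trans ?_
  rw [formDensity, e'.left_inv hy']

theorem formDensity_ne_zero (h : IsSmoothChart e) (η : VolumeForm k M)
    {y : BModel k} (hy : y ∈ e.target) : formDensity η e y ≠ 0 := by
  apply apply_single_ne_zero
  intro h0
  apply η.ne_zero (e.symm y)
  have hid := h.tmap_symm_bijective hy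
  have hid' : ((tmap e.symm y : BModel k →L[ℝ] BModel k) : BModel k →ₗ[ℝ] BModel k) ∘ₗ
      ((tmap e (e.symm y) : BModel k →L[ℝ] BModel k) : BModel k →ₗ[ℝ] BModel k) = LinearMap.id := by
    refine mul_eq_one_comm.1 ?_
    exact congrArg (fun f : BModel k →L[ℝ] BModel k => (f : BModel k →ₗ[ℝ] BModel k)) hid
  ext v
  have h2 := congrArg (fun f => f fun i => (tmap e (e.symm y) : BModel k →L[ℝ] BModel k) (v i)) h0
  have h3 : ∀ v, (tmap e.symm y : BModel k →L[ℝ] BModel k)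
      ((tmap e (e.symm y) : BModel k →L[ℝ] BModel k) v) = v := fun v => congrArg (fun f => f v) hid'
  simpa [Function.comp_def, h3] using h2

theorem contDiffOn_formDensity [IsManifold 𝓘(ℝ, BModel k) ∞ M] (h : IsSmoothChart e)
    (η : VolumeForm k M) : ContDiffOn ℝ ∞ (formDensity η e) e.target := by
  intro y hy
  set p := e.symm y
  have h' := isSmoothChart_chartAt (k := k) p
  set f := chartAt (BModel k) p
  have hy' : e.symm y ∈ f.source := mem_chart_source _ _
  have hm : (e.symm.trans f).source ∈ 𝓝 y := by
    refine (e.symm.trans f).open_source.mem_nhds ?_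
    rw [OpenPartialHomeomorph.trans_source]; exact ⟨hy, hy'⟩
  have hτ := (h.contDiffOn_trans h').contDiffAt hm
  have h1 : ContDiffAt ℝ ∞ (fun z => fderiv ℝ (fun y => f (e.symm y)) z) y :=
    hτ.fderiv_right (by simp)
  have h2 : ContDiffAt ℝ ∞ (fun z => chartRep η.form p (f (e.symm z))) y :=
    ContDiffAt.comp y ((η.smooth p).contDiffAt (f.open_target.mem_nhds (f.map_source hy'))) hτ
  have h3 : ContDiffAt ℝ ∞ (fun z => chartRep η.form p (f (e.symm z))
      fun i => EuclideanSpace.single i (1 : ℝ)) y := by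
    let ev : (BModel k [⋀^Fin (k + 1)]→L[ℝ] ℝ) →L[ℝ] ℝ :=
      ContinuousAlternatingMap.apply ℝ (BModel k) ℝ fun i => EuclideanSpace.single i (1 : ℝ)
    exact ev.contDiff.contDiffAt.comp y h2
  have h4 : ContDiffAt ℝ ∞ (fun z => (fderiv ℝ (fun y => f (e.symm y)) z).det) y := by
    have h5 : (fun z => (fderiv ℝ (fun y => f (e.symm y)) z).det) = fun z =>
        Matrix.det (Matrix.of fun i j => (fderiv ℝ (fun y => f (e.symm y)) z
          (EuclideanSpace.single j (1 : ℝ))) i) := by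
      ext z
      rw [ContinuousLinearMap.det, ← LinearMap.det_toMatrix
        (EuclideanSpace.basisFun (Fin (k + 1)) ℝ).toBasis]
      congr 1
    rw [h5]
    simp only [Matrix.det_apply, Matrix.of_apply]
    refine ContDiffAt.sum fun σ _ => ContDiffAt.const_smul _ (contDiffAt_prod fun i _ => ?_)
    have h6 : ContDiffAt ℝ ∞ (fun z => fderiv ℝ (fun y => f (e.symm y)) z
      (EuclideanSpace.single i (1 : ℝ))) y := h1.clm_apply contDiffAt_const
    exact (contDiffAt_euclidean.1 h6) _
  refine ((h4.mul h3).congr_of_eventuallyEq ?_).contDiffWithinAt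
  filter_upwards [hm] with z hz
  rw [OpenPartialHomeomorph.trans_source] at hz
  refine (h.formDensity_trans h' η hz.1 hz.2).trans ?_
  rfl

end IsSmoothChart

theorem measurableSet_preimage_symm [MeasurableSpace M] [BorelSpace M]
    (e : OpenPartialHomeomorph M (BModel k)) {A : Set M} (hA : MeasurableSet A) :
    MeasurableSet (e.target ∩ e.symm ⁻¹' A) := by
  have h := (continuousOn_iff_continuous_domRestrict.1 e.continuousOn_symm).measurable hA
  have h1 := e.open_target.measurableSet.subtype_image h
  convert h1 using 1
  ext y
  simp [and_comm]

variable [IsManifold 𝓘(ℝ, BModel k) ∞ M] [SecondCountableTopology M] [MeasurableSpace M]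
  [BorelSpace M]

/-- The volume of a set in the domain of a chart: Lebesgue measure with density
`|η(∂₁, …, ∂_m)|`. -/
theorem IsSmoothChart.volumeMeasure_apply (h : IsSmoothChart e) (η : VolumeForm k M) {A : Set M}
    (hA : MeasurableSet A) (hAe : A ⊆ e.source) :
    volumeMeasure η A = ∫⁻ y in e.target ∩ e.symm ⁻¹' A, ENNReal.ofReal |formDensity η e y| := by
  classical
  set Q := (exists_chart_partition k M).choose with hQ
  obtain ⟨hc, hm, hd, hu, hs⟩ := (exists_chart_partition k M).choose_spec
  set ν : Measure (BModel k) := volume.withDensity fun y => ENNReal.ofReal |formDensity η e y|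
  let T : M → Set (BModel k) := fun p => e.target ∩ e.symm ⁻¹' (A ∩ Q p)
  have hT : ∀ p, MeasurableSet (T p) := fun p => measurableSet_preimage_symm e (hA.inter (hm p))
  -- the piece of the measure on the set `Q p` is defined in the preferred chart at `p`; the change
  -- of variables formula transfers it to the chart `e`
  have key : ∀ p : M, (((volume.restrict ((chartAt (BModel k) p).target ∩
      (chartAt (BModel k) p).symm ⁻¹' Q p)).withDensity
        (chartDensity η p)).map (chartAt (BModel k) p).symm) A = ν (T p) := by
    intro p
    set f := chartAt (BModel k) p
    have hf : IsSmoothChart f := isSmoothChart_chartAt p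
    have hae : AEMeasurable f.symm ((volume.restrict (f.target ∩ f.symm ⁻¹' Q p)).withDensity
        (chartDensity η p)) := by
      refine AEMeasurable.mono_ac ?_ (withDensity_absolutelyContinuous _ _)
      exact (f.continuousOn_symm.aemeasurable f.open_target.measurableSet).mono_measure
        (Measure.restrict_mono inter_subset_left le_rfl)
    rw [Measure.map_apply_of_aemeasurable hae hA, withDensity_apply',
      Measure.restrict_restrict' (measurableSet_preimage_symm f (hm p)), withDensity_apply']
    have hS : f.symm ⁻¹' A ∩ (f.target ∩ f.symm ⁻¹' Q p) = f.target ∩ f.symm ⁻¹' (A ∩ Q p) := by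
      ext y; simp only [mem_inter_iff, mem_preimage]; tauto
    rw [hS]
    set S := f.target ∩ f.symm ⁻¹' (A ∩ Q p)
    have hSm : MeasurableSet S := measurableSet_preimage_symm f (hA.inter (hm p))
    have hTS : T p = (fun y => e (f.symm y)) '' S := by
      ext z
      constructor
      · rintro ⟨hz, hz''⟩
        have hz' : e.symm z ∈ A ∩ Q p := hz''
        refine ⟨f (e.symm z), ⟨f.map_source (hs p hz'.2), ?_⟩, ?_⟩
        · change f.symm (f (e.symm z)) ∈ A ∩ Q p
          rw [f.left_inv (hs p hz'.2)]; exact hz'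
        · change e (f.symm (f (e.symm z))) = z
          rw [f.left_inv (hs p hz'.2), e.right_inv hz]
      · rintro ⟨y, ⟨hy, hy''⟩, rfl⟩
        have hy' : f.symm y ∈ A ∩ Q p := hy''
        refine ⟨e.map_source (hAe hy'.1), ?_⟩
        change e.symm (e (f.symm y)) ∈ A ∩ Q p
        rw [e.left_inv (hAe hy'.1)]; exact hy'
    rw [hTS, lintegral_image_eq_lintegral_abs_det_fderiv_mul volume hSm
      (f' := fun y => fderiv ℝ (fun y => e (f.symm y)) y)]
    · refine setLIntegral_congr_fun hSm fun y hy => ?_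
      have h1 := hf.formDensity_trans h η hy.1 (hAe hy.2.1)
      have h2 : chartDensity η p y = ENNReal.ofReal |formDensity η f y| := rfl
      simp only [h2]
      rw [h1, abs_mul, ENNReal.ofReal_mul (abs_nonneg _)]
    · intro y hy
      have hmem : y ∈ (f.symm.trans e).source := by
        rw [OpenPartialHomeomorph.trans_source]; exact ⟨hy.1, hAe hy.2.1⟩
      exact (((hf.contDiffOn_trans h).contDiffAt
        ((f.symm.trans e).open_source.mem_nhds hmem)).differentiableAt
          (by simp)).hasFDerivAt.hasFDerivWithinAt
    · intro y hy y' hy' hyy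
      have h1 : f.symm y = f.symm y' := e.injOn (hAe hy.2.1) (hAe hy'.2.1) hyy
      exact f.symm.injOn hy.1 hy'.1 h1
  rw [volumeMeasure, Measure.sum_apply _ hA]
  change ∑' p : M, (((volume.restrict ((chartAt (BModel k) p).target ∩
      (chartAt (BModel k) p).symm ⁻¹' Q p)).withDensity
        (chartDensity η p)).map (chartAt (BModel k) p).symm) A = _
  simp only [key]
  rw [← withDensity_apply']
  change _ = ν _
  have hU : e.target ∩ e.symm ⁻¹' A = ⋃ p ∈ {p | (Q p).Nonempty}, T p := by
    ext z
    simp only [mem_iUnion, T, mem_inter_iff, mem_preimage, mem_ofPred_eq]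
    constructor
    · rintro ⟨hz, hz'⟩
      obtain ⟨p, hp⟩ := mem_iUnion.1 ((hu ▸ mem_univ (e.symm z) : e.symm z ∈ ⋃ p, Q p))
      exact ⟨p, ⟨_, hp⟩, hz, hz', hp⟩
    · rintro ⟨p, -, hz, hz', -⟩
      exact ⟨hz, hz'⟩
  rw [hU, measure_biUnion hc]
  · -- only countably many of the sets `Q p` are nonempty, the others do not contribute to the sum
    refine (tsum_subtype_eq_of_support_subset (f := fun p => ν (T p)) ?_).symm
    intro p hp
    by_contra hne
    apply hp
    have : T p = ∅ := by
      have : Q p = ∅ := not_nonempty_iff_eq_empty.1 hne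
      simp [T, this]
    simp [this]
  · intro p _ q _ hpq
    refine Set.disjoint_left.2 fun z hz hz' => ?_
    exact Set.disjoint_left.1 (hd hpq) hz.2.2 hz'.2.2
  · intro p _; exact hT p

theorem IsSmoothChart.restrict_volumeMeasure (h : IsSmoothChart e) (η : VolumeForm k M) {A : Set M}
    (hA : MeasurableSet A) (hAe : A ⊆ e.source) :
    (volumeMeasure η).restrict A = ((volume.restrict (e.target ∩ e.symm ⁻¹' A)).withDensity
      fun y => ENNReal.ofReal |formDensity η e y|).map e.symm ∧
    AEMeasurable e.symm ((volume.restrict (e.target ∩ e.symm ⁻¹' A)).withDensity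
      fun y => ENNReal.ofReal |formDensity η e y|) := by
  have hae : AEMeasurable e.symm ((volume.restrict (e.target ∩ e.symm ⁻¹' A)).withDensity
      fun y => ENNReal.ofReal |formDensity η e y|) := by
    refine AEMeasurable.mono_ac ?_ (withDensity_absolutelyContinuous _ _)
    exact (e.continuousOn_symm.aemeasurable e.open_target.measurableSet).mono_measure
      (Measure.restrict_mono inter_subset_left le_rfl)
  refine ⟨Measure.ext fun C hC => ?_, hae⟩
  rw [Measure.restrict_apply hC, Measure.map_apply_of_aemeasurable hae hC, withDensity_apply',
    Measure.restrict_restrict' (measurableSet_preimage_symm e hA),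
    h.volumeMeasure_apply η (hC.inter hA) (inter_subset_right.trans hAe)]
  congr 2
  ext y; simp only [mem_inter_iff, mem_preimage]; tauto

/-- Integration in a chart. -/
theorem IsSmoothChart.setIntegral_volumeMeasure (h : IsSmoothChart e) (η : VolumeForm k M)
    {A : Set M} (hA : MeasurableSet A) (hAe : A ⊆ e.source) {f : M → ℝ}
    (hf : AEStronglyMeasurable f ((volumeMeasure η).restrict A)) :
    ∫ x in A, f x ∂(volumeMeasure η) =
      ∫ y in e.target ∩ e.symm ⁻¹' A, |formDensity η e y| * f (e.symm y) := by
  obtain ⟨h1, h2⟩ := h.restrict_volumeMeasure η hA hAe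
  rw [h1] at hf ⊢
  rw [integral_map h2 hf]
  have hS := measurableSet_preimage_symm e hA
  have hm : AEMeasurable (fun y => Real.toNNReal |formDensity η e y|)
      (volume.restrict (e.target ∩ e.symm ⁻¹' A)) := by
    have : ContinuousOn (fun y => Real.toNNReal |formDensity η e y|) e.target :=
      continuous_real_toNNReal.comp_continuousOn (h.contDiffOn_formDensity η).continuousOn.abs
    exact (this.mono inter_subset_left).aemeasurable hS
  rw [show (fun y => ENNReal.ofReal |formDensity η e y|) =
    fun y => ((Real.toNNReal |formDensity η e y| : NNReal) : ENNReal) from rfl,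
    integral_withDensity_eq_integral_smul₀ hm]
  refine integral_congr_ae (Eventually.of_forall fun y => ?_)
  simp [NNReal.smul_def]

theorem isFiniteMeasureOnCompacts_volumeMeasure (η : VolumeForm k M) :
    IsFiniteMeasureOnCompacts (volumeMeasure η) := by
  have : IsLocallyFiniteMeasure (volumeMeasure η) := by
    refine ⟨fun x => ?_⟩
    set e := chartAt (BModel k) x
    have h : IsSmoothChart e := isSmoothChart_chartAt x
    have hx : x ∈ e.source := mem_chart_source _ _
    obtain ⟨r, hr, hre⟩ := Metric.nhds_basis_closedBall.mem_iff.1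
      (e.open_target.mem_nhds (e.map_source hx))
    refine ⟨e.source ∩ e ⁻¹' Metric.ball (e x) r, ?_, ?_⟩
    · exact e.isOpen_inter_preimage Metric.isOpen_ball |>.mem_nhds ⟨hx, Metric.mem_ball_self hr⟩
    rw [h.volumeMeasure_apply η (e.isOpen_inter_preimage Metric.isOpen_ball).measurableSet
      inter_subset_left]
    have hc : IsCompact (Metric.closedBall (e x) r) := isCompact_closedBall _ _
    have hcont : ContinuousOn (fun y => |formDensity η e y|) (Metric.closedBall (e x) r) :=
      ((h.contDiffOn_formDensity η).continuousOn.mono hre).abs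
    obtain ⟨C, hC⟩ := hc.exists_bound_of_continuousOn hcont
    calc _ ≤ ∫⁻ y in Metric.closedBall (e x) r, ENNReal.ofReal |formDensity η e y| := by
          refine lintegral_mono_set fun y hy => ?_
          obtain ⟨h1, h2, h3⟩ := hy
          rw [mem_preimage, e.right_inv h1] at h3
          exact Metric.ball_subset_closedBall h3
      _ ≤ ∫⁻ y in Metric.closedBall (e x) r, ENNReal.ofReal C := by
          refine setLIntegral_mono measurable_const fun y hy => ENNReal.ofReal_le_ofReal ?_
          have := hC y hy
          rwa [Real.norm_eq_abs, abs_abs] at this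
      _ < ⊤ := by
          rw [setLIntegral_const]
          exact ENNReal.mul_lt_top ENNReal.ofReal_lt_top hc.measure_lt_top
  infer_instance

end Volume

/-! ### The divergence theorem -/

/-- A partial derivative of a compactly supported function has integral zero. -/
theorem integral_fderiv_eq_zero {V : Type*} [NormedAddCommGroup V] [NormedSpace ℝ V]
    [FiniteDimensional ℝ V] [MeasurableSpace V] [BorelSpace V] {μ : Measure V}
    [μ.IsAddHaarMeasure] {f : V → ℝ} (hf : ContDiff ℝ 1 f)
    (hc : HasCompactSupport f) (v : V) : ∫ x, fderiv ℝ f x v ∂μ = 0 := by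
  -- integration by parts against the constant function `1`
  have h := integral_mul_fderiv_eq_neg_fderiv_mul_of_integrable (μ := μ) (f := fun _ => (1 : ℝ))
    (g := f) (v := v) (by simp) ?_ ?_ (by simp) (fun x _ => hf.differentiable (by simp) x)
  · simpa using h
  · simp only [one_mul]
    refine Continuous.integrable_of_hasCompactSupport
      ((hf.continuous_fderiv (by simp)).clm_apply continuous_const) ?_
    exact (hc.fderiv (𝕜 := ℝ)).mono' fun x hx => subset_tsupport _ fun h => hx (by simp [h])
  · simpa using hf.continuous.integrable_of_hasCompactSupport hc

/-- The divergence theorem for a compactly supported vector field on an open set. -/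
theorem integral_div_eq_zero {k : ℕ} {D C : Set (BModel k)} {Z : BModel k → BModel k}
    (hD : IsOpen D) (hC : IsCompact C) (hCD : C ⊆ D) (hZ : ContDiffOn ℝ 1 Z D)
    (h0 : ∀ y, y ∉ C → Z y = 0) :
    ∫ y, ∑ j, (fderiv ℝ Z y (EuclideanSpace.single j (1 : ℝ))) j = 0 := by
  -- `Z` vanishes on the open complement of `C`, hence is smooth on the whole space
  have hZ' : ContDiff ℝ 1 Z := by
    rw [contDiff_iff_contDiffAt]
    intro y
    by_cases hy : y ∈ C
    · exact hZ.contDiffAt (hD.mem_nhds (hCD hy))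
    · refine (contDiffAt_const (c := (0 : BModel k))).congr_of_eventuallyEq ?_
      filter_upwards [hC.isClosed.isOpen_compl.mem_nhds hy] with z hz using h0 z hz
  have hc : HasCompactSupport Z := HasCompactSupport.intro hC fun y hy => h0 y hy
  have hcj : ∀ j, HasCompactSupport fun y => Z y j := fun j =>
    HasCompactSupport.intro hC fun y hy => by simp [h0 y hy]
  have hZj : ∀ j, ContDiff ℝ 1 fun y => Z y j := fun j => contDiff_euclidean.1 hZ' j
  have h1 : ∀ j y, (fderiv ℝ Z y (EuclideanSpace.single j (1 : ℝ))) j =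
      fderiv ℝ (fun y => Z y j) y (EuclideanSpace.single j (1 : ℝ)) := by
    intro j y
    have h2 := ((EuclideanSpace.proj (𝕜 := ℝ) j).hasFDerivAt (x := Z y)).comp y
      (hZ'.differentiable (by simp) y).hasFDerivAt
    have h3 : fderiv ℝ (fun y => Z y j) y = _ := h2.fderiv
    rw [h3]; rfl
  simp only [h1]
  rw [integral_finsetSum]
  · exact Finset.sum_eq_zero fun j _ => integral_fderiv_eq_zero (hZj j) (hcj j) _
  · intro j _
    refine Continuous.integrable_of_hasCompactSupport
      (((hZj j).continuous_fderiv (by simp)).clm_apply continuous_const) ?_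
    exact ((hcj j).fderiv (𝕜 := ℝ)).mono' fun x hx => subset_tsupport _ fun h => hx (by simp [h])

/-! ### Sections and their jets in coordinates -/

section Coordinates

variable {k n : ℕ} {M E Q : Type*} [TopologicalSpace M] [ChartedSpace (BModel k) M]
  [TopologicalSpace E] [ChartedSpace (BModel k × FModel n) E]
  [TopologicalSpace Q] [ChartedSpace (FModel n) Q] {P : SmoothFibreBundle k n M E Q}

theorem FibredChart.isSmoothChart (c : FibredChart P) : IsSmoothChart c.base :=
  ⟨c.base_smooth, c.base_symm_smooth⟩

open Classical in
/-- The Lagrangian in the coordinates `((x, u), u_x)` of a fibred chart, extended by zero outside of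
the range of the chart. -/
def lagCoord (L : Jet1 P → ℝ) (c : FibredChart P) (z : JModel k n) : ℝ :=
  if h : z.1 ∈ c.total.target then
    L ⟨c.total.symm z.1, linOfCoord c (c.total.symm z.1) z.2,
      linOfCoord_isSection c (c.total.map_target h) z.2⟩ else 0

theorem lagCoord_eq (L : Jet1 P → ℝ) (c : FibredChart P) (j₀ : Jet1 P) {z : JModel k n}
    (hz : z.1 ∈ c.total.target) : lagCoord L c z = L ((jetChart c j₀).symm z) := by
  classical
  rw [lagCoord, dif_pos hz]
  change _ = L (dite _ _ _)
  rw [dif_pos hz]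

theorem lagCoord_jetCoord (L : Jet1 P → ℝ) (c : FibredChart P) {j : Jet1 P}
    (hj : j.pt ∈ c.total.source) : lagCoord L c (jetCoord c j) = L j := by
  rw [lagCoord_eq L c j (c.total.map_source hj)]
  exact congrArg L ((jetChart c j).left_inv hj)

theorem isOpen_jetTarget (c : FibredChart P) : IsOpen {z : JModel k n | z.1 ∈ c.total.target} :=
  c.total.open_target.preimage continuous_fst

theorem contDiffOn_lagCoord [IsManifold 𝓘(ℝ, BModel k) ∞ M] [IsManifold 𝓘(ℝ, FModel n) ∞ Q]
    {L : Jet1 P → ℝ} (hL : ContMDiff 𝓘(ℝ, JModel k n) 𝓘(ℝ, ℝ) ∞ L) (c : FibredChart P) :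
    ContDiffOn ℝ ∞ (lagCoord L c) {z | z.1 ∈ c.total.target} := by
  intro z₀ hz₀
  let j₀ : Jet1 P := ⟨_, _, linOfCoord_isSection c (c.total.map_target hz₀) z₀.2⟩
  have h := contMDiffOn_jetChart c j₀
  have h1 := hL.comp_contMDiffOn h.2.1
  rw [contMDiffOn_iff_contDiffOn] at h1
  exact h1.congr (fun z hz => lagCoord_eq L c j₀ hz) z₀ hz₀

/-- The fibre coordinates of a section in a fibred chart. -/
def secCoord (c : FibredChart P) (s : M → E) (y : BModel k) : FModel n :=
  (c.total (s (c.base.symm y))).2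

/-- The points of the model at which a section over `U` has coordinates in a fibred chart. -/
def secDom (c : FibredChart P) (s : M → E) (U : Set M) : Set (BModel k) :=
  {y | y ∈ c.base.target ∧ c.base.symm y ∈ U ∧ s (c.base.symm y) ∈ c.total.source}

/-- The coordinates `((x, u(x)), ∂u(x))` of the jet of a section. -/
def jetSec (c : FibredChart P) (s : M → E) (y : BModel k) : JModel k n :=
  ((y, secCoord c s y), fderiv ℝ (secCoord c s) y)

section Sections

variable {U : Set M} {s : M → E} {c : FibredChart P}

theorem IsSectionOn.base_mem (hs : IsSectionOn P s U) {x : M} (hx : x ∈ U)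
    (hc : s x ∈ c.total.source) : x ∈ c.base.source := by
  have := c.proj_mem _ hc
  rwa [hs.2 x hx] at this

theorem IsSectionOn.mem_secDom (hs : IsSectionOn P s U) {x : M} (hx : x ∈ U)
    (hc : s x ∈ c.total.source) : c.base x ∈ secDom c s U := by
  have h := hs.base_mem hx hc
  exact ⟨c.base.map_source h, by rwa [c.base.left_inv h], by rwa [c.base.left_inv h]⟩

theorem isOpen_secDom (hU : IsOpen U) (hs : IsSectionOn P s U) : IsOpen (secDom c s U) := by
  have h1 : IsOpen (c.base.target ∩ c.base.symm ⁻¹' (U ∩ s ⁻¹' c.total.source)) :=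
    c.base.isOpen_inter_preimage_symm
      (hs.1.continuousOn.isOpen_inter_preimage hU c.total.open_source)
  exact h1

/-- In fibred coordinates, a section is the graph of `secCoord`. -/
theorem IsSectionOn.total_eq (hs : IsSectionOn P s U) {y : BModel k} (hy : y ∈ secDom c s U) :
    c.total (s (c.base.symm y)) = (y, secCoord c s y) := by
  refine Prod.ext ?_ rfl
  rw [c.fst_total _ hy.2.2, hs.2 _ hy.2.1, c.base.right_inv hy.1]

theorem IsSectionOn.contDiffOn_secCoord (hs : IsSectionOn P s U) :
    ContDiffOn ℝ ∞ (secCoord c s) (secDom c s U) := by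
  have h1 : ContMDiffOn 𝓘(ℝ, BModel k) 𝓘(ℝ, BModel k × FModel n) ∞
      (fun y => c.total (s (c.base.symm y))) (secDom c s U) :=
    c.total_smooth.comp (hs.1.comp (c.base_symm_smooth.mono fun y hy => hy.1) fun y hy => hy.2.1)
      fun y hy => hy.2.2
  rw [contMDiffOn_iff_contDiffOn] at h1
  exact contDiff_snd.comp_contDiffOn h1

theorem IsSectionOn.contDiffOn_jetSec (hU : IsOpen U) (hs : IsSectionOn P s U) :
    ContDiffOn ℝ ∞ (jetSec c s) (secDom c s U) :=
  (contDiffOn_id.prodMk hs.contDiffOn_secCoord).prodMk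
    (hs.contDiffOn_secCoord.fderiv_of_isOpen (isOpen_secDom hU hs) (by simp))

theorem IsSectionOn.jetSec_mem (hs : IsSectionOn P s U) {y : BModel k} (hy : y ∈ secDom c s U) :
    (jetSec c s y).1 ∈ c.total.target := by
  have := c.total.map_source hy.2.2
  rwa [hs.total_eq hy] at this

theorem IsSectionOn.mdiff (hU : IsOpen U) (hs : IsSectionOn P s U) {x : M} (hx : x ∈ U) :
    MDifferentiableAt 𝓘(ℝ, BModel k) 𝓘(ℝ, BModel k × FModel n) s x :=
  (hs.1.contMDiffAt (hU.mem_nhds hx)).mdifferentiableAt (by simp)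

variable [IsManifold 𝓘(ℝ, BModel k) ∞ M] [IsManifold 𝓘(ℝ, FModel n) ∞ Q]

theorem IsSectionOn.tmap_isSection (hU : IsOpen U) (hs : IsSectionOn P s U) {x : M} (hx : x ∈ U) :
    (tmap P.proj (s x) : (BModel k × FModel n) →L[ℝ] BModel k).comp (tmap s x) =
      ContinuousLinearMap.id ℝ (BModel k) := by
  have h1 := tmap_comp (g := P.proj) (f := s) (p := x) (LFT.mdiff_proj (s x)) (hs.mdiff hU hx)
  rw [← h1, ← tmap_id (V := BModel k) x]
  exact tmap_congr (by filter_upwards [hU.mem_nhds hx] with z hz using hs.2 z hz)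

/-- The jet of a section over an open set. -/
def IsSectionOn.jet (hU : IsOpen U) (hs : IsSectionOn P s U) {x : M} (hx : x ∈ U) : Jet1 P :=
  ⟨s x, tmap s x, hs.tmap_isSection hU hx⟩

theorem IsSectionOn.jetCoord_jet (hU : IsOpen U) (hs : IsSectionOn P s U) {x : M} (hx : x ∈ U)
    (hc : s x ∈ c.total.source) : jetCoord c (hs.jet hU hx) = jetSec c s (c.base x) := by
  have hb := hs.base_mem hx hc
  have hy := hs.mem_secDom hx hc
  refine Prod.ext ?_ ?_
  · have := hs.total_eq hy
    rw [c.base.left_inv hb] at this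
    exact this
  · have e1 : c.base.symm (c.base x) = x := c.base.left_inv hb
    have hsm : MDifferentiableAt 𝓘(ℝ, BModel k) 𝓘(ℝ, BModel k × FModel n) s
        (c.base.symm (c.base x)) := by rw [e1]; exact hs.mdiff hU hx
    have h1 := tmap_comp (g := s) (f := c.base.symm) (p := c.base x)
      hsm (c.mdiff_base_symm hy.1)
    have h2 := tmap_comp (g := c.total) (f := fun y => s (c.base.symm y)) (p := c.base x)
      (by rw [e1]; exact c.mdiff_total hc)
      (hsm.comp (c.base x) (c.mdiff_base_symm hy.1))
    have h3 : MDifferentiableAt 𝓘(ℝ, BModel k) 𝓘(ℝ, BModel k × FModel n)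
        (fun y => c.total (s (c.base.symm y))) (c.base x) := by
      refine MDifferentiableAt.comp (c.base x) (g := c.total) (f := fun y => s (c.base.symm y)) ?_
        (hsm.comp (c.base x) (c.mdiff_base_symm hy.1))
      rw [e1]; exact c.mdiff_total hc
    have h4 : fderiv ℝ (secCoord c s) (c.base x) = (ContinuousLinearMap.snd ℝ _ _).comp
        (fderiv ℝ (fun y => c.total (s (c.base.symm y))) (c.base x)) :=
      ((ContinuousLinearMap.snd ℝ (BModel k) (FModel n)).hasFDerivAt.comp (c.base x)
        h3.differentiableAt.hasFDerivAt).fderiv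
    rw [h1] at h2
    simp only [e1] at h2
    rw [tmap_eq_fderiv] at h2
    change (ContinuousLinearMap.snd ℝ _ _).comp ((c.T (s x)).comp
      ((tmap s x : BModel k →L[ℝ] BModel k × FModel n).comp (c.Si (P.proj (s x))))) =
        fderiv ℝ (secCoord c s) (c.base x)
    rw [h4, h2, hs.2 x hx]
    rfl

theorem IsSectionOn.lagrangianAlong_eq_jet (hU : IsOpen U) (hs : IsSectionOn P s U)
    (L : Jet1 P → ℝ) {x : M} (hx : x ∈ U) : lagrangianAlong L s x = L (hs.jet hU hx) := by
  rw [lagrangianAlong, dif_pos (hs.tmap_isSection hU hx)]; rfl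

theorem IsSectionOn.lagrangianAlong_eq (hU : IsOpen U) (hs : IsSectionOn P s U)
    (L : Jet1 P → ℝ) {x : M} (hx : x ∈ U) (hc : s x ∈ c.total.source) :
    lagrangianAlong L s x = lagCoord L c (jetSec c s (c.base x)) := by
  rw [hs.lagrangianAlong_eq_jet hU L hx, ← hs.jetCoord_jet hU hx hc]
  exact (lagCoord_jetCoord L c (j := hs.jet hU hx) hc).symm

end Sections

end Coordinates

/-! ### The first variation of the action -/

section Variation

variable {k n : ℕ} {M E Q : Type*} [TopologicalSpace M] [ChartedSpace (BModel k) M]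
  [TopologicalSpace E] [ChartedSpace (BModel k × FModel n) E]
  [TopologicalSpace Q] [ChartedSpace (FModel n) Q] {P : SmoothFibreBundle k n M E Q}
  {U K : Set M} {s : M → E} {c : FibredChart P} {δ : ℝ} {σ : ℝ → M → E}

theorem IsVariation.isSectionOn (hσ : IsVariation P s U K δ σ) {ε : ℝ} (hε : ε ∈ Ioo (-δ) δ) :
    IsSectionOn P (σ ε) U := by
  refine ⟨?_, hσ.proj_eq ε hε⟩
  have h1 : ContMDiffOn 𝓘(ℝ, BModel k) (𝓘(ℝ, ℝ).prod 𝓘(ℝ, BModel k)) ∞ (fun x : M => (ε, x)) U :=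
    contMDiffOn_const.prodMk contMDiffOn_id
  exact hσ.smooth.comp h1 fun x hx => ⟨hε, hx⟩

variable (c σ) in
/-- The fibre coordinates of a variation. -/
def varCoord (z : ℝ × BModel k) : FModel n := secCoord c (σ z.1) z.2

/-- The parameters and points at which a variation has coordinates in a fibred chart. -/
def varDom (c : FibredChart P) (U : Set M) (δ : ℝ) (σ : ℝ → M → E) : Set (ℝ × BModel k) :=
  {z | z.1 ∈ Ioo (-δ) δ ∧ z.2 ∈ secDom c (σ z.1) U}

variable (c σ) in
/-- The coordinates of the jets of a variation. The jet of `σ ε` only involves the derivative in the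
directions of the base. -/
def varJet (z : ℝ × BModel k) : JModel k n :=
  ((z.2, varCoord c σ z), (fderiv ℝ (varCoord c σ) z).comp (ContinuousLinearMap.inr ℝ ℝ (BModel k)))

variable (c σ) in
/-- The variational vector field, the derivative of a variation with respect to its parameter at
`0`. -/
def varField (y : BModel k) : FModel n := fderiv ℝ (varCoord c σ) (0, y) (1, 0)

namespace IsVariation

theorem contMDiffOn_comp_base_symm (hσ : IsVariation P s U K δ σ) :
    ContMDiffOn 𝓘(ℝ, ℝ × BModel k) 𝓘(ℝ, BModel k × FModel n) ∞
      (fun z : ℝ × BModel k => σ z.1 (c.base.symm z.2))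
      {z | z.1 ∈ Ioo (-δ) δ ∧ z.2 ∈ c.base.target ∧ c.base.symm z.2 ∈ U} := by
  have h1 : ContMDiffOn 𝓘(ℝ, ℝ × BModel k) 𝓘(ℝ, ℝ) ∞ (Prod.fst : ℝ × BModel k → ℝ)
      {z | z.1 ∈ Ioo (-δ) δ ∧ z.2 ∈ c.base.target ∧ c.base.symm z.2 ∈ U} :=
    (contMDiff_iff_contDiff.2 contDiff_fst).contMDiffOn
  have h2 : ContMDiffOn 𝓘(ℝ, ℝ × BModel k) 𝓘(ℝ, BModel k) ∞ (Prod.snd : ℝ × BModel k → BModel k)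
      {z | z.1 ∈ Ioo (-δ) δ ∧ z.2 ∈ c.base.target ∧ c.base.symm z.2 ∈ U} :=
    (contMDiff_iff_contDiff.2 contDiff_snd).contMDiffOn
  exact hσ.smooth.comp (h1.prodMk (c.base_symm_smooth.comp h2 fun z hz => hz.2.1))
    fun z hz => ⟨hz.1, hz.2.2⟩

theorem isOpen_varDom (hU : IsOpen U) (hσ : IsVariation P s U K δ σ) :
    IsOpen (varDom c U δ σ) := by
  have h0 : IsOpen {z : ℝ × BModel k |
      z.1 ∈ Ioo (-δ) δ ∧ z.2 ∈ c.base.target ∧ c.base.symm z.2 ∈ U} :=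
    isOpen_Ioo.prod (c.base.isOpen_inter_preimage_symm hU)
  have h1 := (hσ.contMDiffOn_comp_base_symm (c := c)).continuousOn.isOpen_inter_preimage h0
    c.total.open_source
  convert h1 using 1
  ext z
  simp only [varDom, secDom, mem_ofPred_eq, mem_inter_iff, mem_preimage]
  tauto

theorem contDiffOn_varCoord (hσ : IsVariation P s U K δ σ) :
    ContDiffOn ℝ ∞ (varCoord c σ) (varDom c U δ σ) := by
  have h1 : ContMDiffOn 𝓘(ℝ, ℝ × BModel k) 𝓘(ℝ, BModel k × FModel n) ∞
      (fun z : ℝ × BModel k => c.total (σ z.1 (c.base.symm z.2))) (varDom c U δ σ) :=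
    c.total_smooth.comp (hσ.contMDiffOn_comp_base_symm.mono fun z hz => ⟨hz.1, hz.2.1, hz.2.2.1⟩)
      fun z hz => hz.2.2.2
  rw [contMDiffOn_iff_contDiffOn] at h1
  exact contDiff_snd.comp_contDiffOn h1

theorem contDiffOn_fderiv_varCoord (hU : IsOpen U) (hσ : IsVariation P s U K δ σ) :
    ContDiffOn ℝ ∞ (fderiv ℝ (varCoord c σ)) (varDom c U δ σ) :=
  hσ.contDiffOn_varCoord.fderiv_of_isOpen (hσ.isOpen_varDom hU) (by simp)

theorem contDiffOn_varJet (hU : IsOpen U) (hσ : IsVariation P s U K δ σ) :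
    ContDiffOn ℝ ∞ (varJet c σ) (varDom c U δ σ) :=
  (contDiff_snd.contDiffOn.prodMk hσ.contDiffOn_varCoord).prodMk
    ((hσ.contDiffOn_fderiv_varCoord hU).clm_comp contDiffOn_const)

theorem varJet_eq (hU : IsOpen U) (hσ : IsVariation P s U K δ σ) {z : ℝ × BModel k}
    (hz : z ∈ varDom c U δ σ) : varJet c σ z = jetSec c (σ z.1) z.2 := by
  refine Prod.ext rfl ?_
  have h1 : DifferentiableAt ℝ (varCoord c σ) z :=
    (hσ.contDiffOn_varCoord.contDiffAt ((hσ.isOpen_varDom hU).mem_nhds hz)).differentiableAt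
      (by simp)
  have h2 : HasFDerivAt (fun y => (z.1, y)) (ContinuousLinearMap.inr ℝ ℝ (BModel k)) z.2 :=
    hasFDerivAt_prodMk_right z.1 z.2
  exact (h1.hasFDerivAt.comp z.2 h2).fderiv.symm

theorem varJet_mem (hσ : IsVariation P s U K δ σ) {z : ℝ × BModel k}
    (hz : z ∈ varDom c U δ σ) : (varJet c σ z).1 ∈ c.total.target :=
  (hσ.isSectionOn hz.1).jetSec_mem hz.2

theorem secDom_zero (hσ : IsVariation P s U K δ σ) : secDom c (σ 0) U = secDom c s U := by
  ext y
  simp only [secDom, mem_ofPred_eq]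
  refine and_congr_right fun _ => and_congr_right fun hy => ?_
  rw [hσ.zero_eq _ hy]

theorem mem_varDom_zero (hδ : 0 < δ) (hσ : IsVariation P s U K δ σ) {y : BModel k}
    (hy : y ∈ secDom c s U) : ((0 : ℝ), y) ∈ varDom c U δ σ :=
  ⟨⟨by simpa using hδ, hδ⟩, by rw [hσ.secDom_zero]; exact hy⟩

theorem jetSec_zero (hU : IsOpen U) (hs : IsSectionOn P s U) (hσ : IsVariation P s U K δ σ)
    {y : BModel k} (hy : y ∈ secDom c s U) : jetSec c (σ 0) y = jetSec c s y := by
  have h : secCoord c (σ 0) =ᶠ[𝓝 y] secCoord c s := by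
    filter_upwards [(isOpen_secDom hU hs).mem_nhds hy] with z hz
    rw [secCoord, secCoord, hσ.zero_eq _ hz.2.1]
  rw [jetSec, jetSec, h.eq_of_nhds, h.fderiv_eq]

theorem contDiffOn_varField (hU : IsOpen U) (hδ : 0 < δ) (hσ : IsVariation P s U K δ σ) :
    ContDiffOn ℝ ∞ (varField c σ) (secDom c s U) := by
  have h1 : ContDiffOn ℝ ∞ (fun y : BModel k => fderiv ℝ (varCoord c σ) (0, y)) (secDom c s U) :=
    (hσ.contDiffOn_fderiv_varCoord hU).comp (contDiff_prodMk_right (0 : ℝ)).contDiffOn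
      fun y hy => hσ.mem_varDom_zero hδ hy
  exact h1.clm_apply contDiffOn_const

/-- The variational vector field vanishes outside of the support of the variation. -/
theorem varField_eq_zero (hU : IsOpen U) (hδ : 0 < δ) (hσ : IsVariation P s U K δ σ)
    {y : BModel k} (hy : y ∈ secDom c s U) (hK : c.base.symm y ∉ K) : varField c σ y = 0 := by
  have h1 : DifferentiableAt ℝ (varCoord c σ) (0, y) :=
    (hσ.contDiffOn_varCoord.contDiffAt ((hσ.isOpen_varDom hU).mem_nhds
      (hσ.mem_varDom_zero hδ hy))).differentiableAt (by simp)
  have h2 : HasFDerivAt (fun ε : ℝ => (ε, y)) (ContinuousLinearMap.inl ℝ ℝ (BModel k)) 0 :=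
    hasFDerivAt_prodMk_left 0 y
  have h3 := h1.hasFDerivAt.comp (0 : ℝ) h2
  have h4 : (varCoord c σ ∘ fun ε : ℝ => (ε, y)) =ᶠ[𝓝 0] fun _ => secCoord c s y := by
    filter_upwards [Ioo_mem_nhds (by simpa using hδ : -δ < 0) hδ] with ε hε
    change (c.total (σ ε (c.base.symm y))).2 = (c.total (s (c.base.symm y))).2
    rw [hσ.eq_off ε hε _ ⟨hy.2.1, hK⟩]
  have h5 := h3.unique ((hasFDerivAt_const (secCoord c s y) (0 : ℝ)).congr_of_eventuallyEq h4)
  have h6 := congrArg (fun f : ℝ →L[ℝ] FModel n => f 1) h5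
  simpa [varField] using h6

/-- The variation of the jet coordinates is given by the variational vector field and its
derivative. -/
theorem fderiv_varJet (hU : IsOpen U) (hδ : 0 < δ)
    (hσ : IsVariation P s U K δ σ) {y : BModel k} (hy : y ∈ secDom c s U) :
    fderiv ℝ (varJet c σ) (0, y) (1, 0) = ((0, varField c σ y), fderiv ℝ (varField c σ) y) := by
  have hz := hσ.mem_varDom_zero hδ hy
  have hm := (hσ.isOpen_varDom hU).mem_nhds hz
  have h1 : DifferentiableAt ℝ (varCoord c σ) (0, y) :=
    (hσ.contDiffOn_varCoord.contDiffAt hm).differentiableAt (by simp)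
  have h2 : DifferentiableAt ℝ (fderiv ℝ (varCoord c σ)) (0, y) :=
    ((hσ.contDiffOn_fderiv_varCoord hU).contDiffAt hm).differentiableAt (by simp)
  have h3 : HasFDerivAt (varJet c σ) (((ContinuousLinearMap.snd ℝ ℝ (BModel k)).prod
      (fderiv ℝ (varCoord c σ) (0, y))).prod
      (((ContinuousLinearMap.compL ℝ (BModel k) (ℝ × BModel k) (FModel n)).flip
        (ContinuousLinearMap.inr ℝ ℝ (BModel k))).comp
        (fderiv ℝ (fderiv ℝ (varCoord c σ)) (0, y)))) (0, y) := by
    refine (hasFDerivAt_snd.prodMk h1.hasFDerivAt).prodMk ?_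
    exact (((ContinuousLinearMap.compL ℝ (BModel k) (ℝ × BModel k) (FModel n)).flip
        (ContinuousLinearMap.inr ℝ ℝ (BModel k))).hasFDerivAt).comp ((0 : ℝ), y) h2.hasFDerivAt
  rw [h3.fderiv]
  refine Prod.ext rfl ?_
  have h4 : HasFDerivAt (fun y => (0, y)) (ContinuousLinearMap.inr ℝ ℝ (BModel k)) y :=
    hasFDerivAt_prodMk_right 0 y
  have h5 : HasFDerivAt (varField c σ) ((ContinuousLinearMap.apply ℝ (FModel n)
      ((1 : ℝ), (0 : BModel k))).comp ((fderiv ℝ (fderiv ℝ (varCoord c σ)) (0, y)).comp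
        (ContinuousLinearMap.inr ℝ ℝ (BModel k)))) y :=
    (ContinuousLinearMap.apply ℝ (FModel n) ((1 : ℝ), (0 : BModel k))).hasFDerivAt.comp y
      (h2.hasFDerivAt.comp y h4)
  rw [h5.fderiv]
  -- the derivatives with respect to the parameter and to the base commute
  have hsymm : IsSymmSndFDerivAt ℝ (varCoord c σ) (0, y) :=
    (hσ.contDiffOn_varCoord.contDiffAt hm).isSymmSndFDerivAt
      (by rw [minSmoothness_of_isRCLikeNormedField]; exact WithTop.coe_le_coe.2 le_top)
  ext1 b
  exact hsymm _ _

variable [IsManifold 𝓘(ℝ, BModel k) ∞ M] [IsManifold 𝓘(ℝ, FModel n) ∞ Q] {L : Jet1 P → ℝ}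

theorem lagrangianAlong_eq (hU : IsOpen U) (hσ : IsVariation P s U K δ σ) (L : Jet1 P → ℝ)
    {ε : ℝ} (hε : ε ∈ Ioo (-δ) δ) {x : M} (hx : x ∈ U) (hc : σ ε x ∈ c.total.source) :
    (ε, c.base x) ∈ varDom c U δ σ ∧
      lagrangianAlong L (σ ε) x = lagCoord L c (varJet c σ (ε, c.base x)) := by
  have h1 : (ε, c.base x) ∈ varDom c U δ σ := ⟨hε, (hσ.isSectionOn hε).mem_secDom hx hc⟩
  exact ⟨h1, by rw [hσ.varJet_eq hU h1, (hσ.isSectionOn hε).lagrangianAlong_eq hU L hx hc]⟩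

theorem contDiffOn_lagCoord_varJet (hL : ContMDiff 𝓘(ℝ, JModel k n) 𝓘(ℝ, ℝ) ∞ L) (hU : IsOpen U)
    (hσ : IsVariation P s U K δ σ) :
    ContDiffOn ℝ ∞ (fun z => lagCoord L c (varJet c σ z)) (varDom c U δ σ) :=
  (contDiffOn_lagCoord hL c).comp (hσ.contDiffOn_varJet hU) fun _ hz => hσ.varJet_mem hz

theorem hasDerivAt_lagrangianAlong (hL : ContMDiff 𝓘(ℝ, JModel k n) 𝓘(ℝ, ℝ) ∞ L) (hU : IsOpen U)
    (hσ : IsVariation P s U K δ σ) {ε : ℝ} {x : M} (hx : x ∈ U) (hxb : x ∈ c.base.source)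
    (hz : (ε, c.base x) ∈ varDom c U δ σ) :
    HasDerivAt (fun ε => lagrangianAlong L (σ ε) x)
      (fderiv ℝ (fun z => lagCoord L c (varJet c σ z)) (ε, c.base x) (1, 0)) ε := by
  have hm := (hσ.isOpen_varDom hU).mem_nhds hz
  have h1 : DifferentiableAt ℝ (fun z => lagCoord L c (varJet c σ z)) (ε, c.base x) :=
    ((hσ.contDiffOn_lagCoord_varJet hL hU).contDiffAt hm).differentiableAt (by simp)
  have h2 : HasFDerivAt (fun ε : ℝ => (ε, c.base x)) (ContinuousLinearMap.inl ℝ ℝ (BModel k)) ε :=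
    hasFDerivAt_prodMk_left ε _
  have h3 := (h1.hasFDerivAt.comp ε h2).hasDerivAt
  refine h3.congr_of_eventuallyEq ?_
  have h4 : Tendsto (fun ε : ℝ => (ε, c.base x)) (𝓝 ε) (𝓝 (ε, c.base x)) :=
    h2.continuousAt
  filter_upwards [h4 hm] with ε' hε'
  have hc : σ ε' x ∈ c.total.source := by
    have := hε'.2.2.2
    rwa [c.base.left_inv hxb] at this
  exact (hσ.lagrangianAlong_eq hU L hε'.1 hx hc).2

/-- The pointwise first variation of the Lagrangian, in a fibred chart. -/
theorem hasDerivAt_lagrangianAlong_zero (hL : ContMDiff 𝓘(ℝ, JModel k n) 𝓘(ℝ, ℝ) ∞ L)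
    (hU : IsOpen U) (hδ : 0 < δ)
    (hs : IsSectionOn P s U) (hσ : IsVariation P s U K δ σ) {x : M} (hx : x ∈ U)
    (hc : s x ∈ c.total.source) :
    HasDerivAt (fun ε => lagrangianAlong L (σ ε) x) (fderiv ℝ (lagCoord L c)
      (jetSec c s (c.base x)) ((0, varField c σ (c.base x)), fderiv ℝ (varField c σ) (c.base x)))
      0 := by
  have hy := hs.mem_secDom hx hc
  have hz := hσ.mem_varDom_zero hδ hy
  have h := hσ.hasDerivAt_lagrangianAlong hL hU hx (hs.base_mem hx hc) hz
  have hm := (hσ.isOpen_varDom hU).mem_nhds hz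
  have h1 : DifferentiableAt ℝ (varJet c σ) (0, c.base x) :=
    ((hσ.contDiffOn_varJet hU).contDiffAt hm).differentiableAt (by simp)
  have h2 : varJet c σ (0, c.base x) = jetSec c s (c.base x) :=
    (hσ.varJet_eq hU hz).trans (hσ.jetSec_zero hU hs hy)
  have h3 : DifferentiableAt ℝ (lagCoord L c) (varJet c σ (0, c.base x)) :=
    ((contDiffOn_lagCoord hL c).contDiffAt ((isOpen_jetTarget c).mem_nhds
      (hσ.varJet_mem hz))).differentiableAt (by simp)
  have h4 : fderiv ℝ (fun z => lagCoord L c (varJet c σ z)) (0, c.base x) =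
      (fderiv ℝ (lagCoord L c) (varJet c σ (0, c.base x))).comp
        (fderiv ℝ (varJet c σ) (0, c.base x)) := fderiv_comp _ h3 h1
  rw [h4, ContinuousLinearMap.comp_apply, hσ.fderiv_varJet hU hδ hy, h2] at h
  exact h

/-- The derivative of the Lagrangian along a variation is bounded on a compact set, uniformly for
small parameters. This dominates the integrand of the action. -/
theorem exists_bound (hL : ContMDiff 𝓘(ℝ, JModel k n) 𝓘(ℝ, ℝ) ∞ L) (hU : IsOpen U) (hδ : 0 < δ)
    (hs : IsSectionOn P s U) (hσ : IsVariation P s U K δ σ) {A : Set M} (hA : IsCompact A)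
    (hAU : A ⊆ U) :
    ∃ t > 0, ∃ C : ℝ, ∀ ε ∈ Ioo (-t) t, ∀ x ∈ A, ∃ d : ℝ, |d| ≤ C ∧
      HasDerivAt (fun ε => lagrangianAlong L (σ ε) x) d ε := by
  refine hA.induction_on (p := fun A => ∃ t > 0, ∃ C : ℝ, ∀ ε ∈ Ioo (-t) t, ∀ x ∈ A, ∃ d : ℝ,
    |d| ≤ C ∧ HasDerivAt (fun ε => lagrangianAlong L (σ ε) x) d ε) ?_ ?_ ?_ ?_
  · exact ⟨1, one_pos, 0, fun ε _ x hx => absurd hx (notMem_empty x)⟩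
  · rintro A B hAB ⟨t, ht, C, h⟩
    exact ⟨t, ht, C, fun ε hε x hx => h ε hε x (hAB hx)⟩
  · rintro A B ⟨t, ht, C, h⟩ ⟨t', ht', C', h'⟩
    refine ⟨min t t', lt_min ht ht', max C C', fun ε hε x hx => ?_⟩
    have h1 := min_le_left t t'
    have h2 := min_le_right t t'
    rcases hx with hx | hx
    · obtain ⟨d, hd, hd'⟩ := h ε ⟨by linarith [hε.1], by linarith [hε.2]⟩ x hx
      exact ⟨d, hd.trans (le_max_left _ _), hd'⟩
    · obtain ⟨d, hd, hd'⟩ := h' ε ⟨by linarith [hε.1], by linarith [hε.2]⟩ x hx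
      exact ⟨d, hd.trans (le_max_right _ _), hd'⟩
  -- local bounds exist in a fibred chart, by continuity at `(0, x)`
  · intro x hxA
    have hx := hAU hxA
    obtain ⟨c, hc⟩ := exists_fibredChart P (s x)
    have hxb := hs.base_mem hx hc
    have hz := hσ.mem_varDom_zero hδ (hs.mem_secDom hx hc)
    have hm := (hσ.isOpen_varDom hU).mem_nhds hz
    have h1 : ContinuousAt (fun z => fderiv ℝ (fun z => lagCoord L c (varJet c σ z)) z (1, 0))
        (0, c.base x) :=
      ((((hσ.contDiffOn_lagCoord_varJet hL hU).contDiffAt hm).fderiv_right (m := 0)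
        (by simp)).continuousAt).clm_apply continuousAt_const
    have h2 : ∀ᶠ z in 𝓝 ((0 : ℝ), c.base x), z ∈ varDom c U δ σ ∧
        |fderiv ℝ (fun z => lagCoord L c (varJet c σ z)) z (1, 0)| <
        |fderiv ℝ (fun z => lagCoord L c (varJet c σ z)) (0, c.base x) (1, 0)| + 1 :=
      (eventually_mem_set.2 hm).and (h1.abs.eventually_lt_const (by simp))
    have h3 : ContinuousAt (fun z : ℝ × M => (z.1, c.base z.2)) (0, x) :=
      continuousAt_fst.prodMk
        (((c.base.continuousAt hxb).comp (f := Prod.snd) (x := ((0 : ℝ), x)) continuousAt_snd))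
    have h4 := h3.eventually h2
    rw [nhds_prod_eq] at h4
    obtain ⟨p, hp, q, hq, hpq⟩ := eventually_prod_iff.1 h4
    obtain ⟨t, ht, htp⟩ := Metric.eventually_nhds_iff.1 hp
    refine ⟨{x' | q x'} ∩ (c.base.source ∩ U), mem_nhdsWithin_of_mem_nhds (inter_mem hq
      (inter_mem (c.base.open_source.mem_nhds hxb) (hU.mem_nhds hx))), t, ht,
      |fderiv ℝ (fun z => lagCoord L c (varJet c σ z)) (0, c.base x) (1, 0)| + 1,
      fun ε hε x' hx' => ?_⟩
    have h5 := hpq (x := ε) (htp (by rw [Real.dist_eq, sub_zero, abs_lt]; exact hε)) hx'.1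
    exact ⟨_, h5.2.le, hσ.hasDerivAt_lagrangianAlong hL hU hx'.2.2 hx'.2.1 h5.1⟩

theorem continuousOn_lagrangianAlong (hL : ContMDiff 𝓘(ℝ, JModel k n) 𝓘(ℝ, ℝ) ∞ L) (hU : IsOpen U)
    (hs : IsSectionOn P s U) : ContinuousOn (lagrangianAlong L s) U := by
  intro x hx
  obtain ⟨c, hc⟩ := exists_fibredChart P (s x)
  have hxb := hs.base_mem hx hc
  have hy := hs.mem_secDom hx hc
  have h1 : ContinuousAt (fun y => lagCoord L c (jetSec c s y)) (c.base x) :=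
    (((contDiffOn_lagCoord hL c).comp (hs.contDiffOn_jetSec hU) fun z hz =>
      hs.jetSec_mem hz).contDiffAt ((isOpen_secDom hU hs).mem_nhds hy)).continuousAt
  refine ((h1.comp (c.base.continuousAt hxb)).congr ?_).continuousWithinAt
  have h2 : s ⁻¹' c.total.source ∈ 𝓝 x :=
    (hs.mdiff hU hx).continuousAt (c.total.open_source.mem_nhds hc)
  filter_upwards [hU.mem_nhds hx, h2] with x' hx' hc'
  exact (hs.lagrangianAlong_eq hU L hx' hc').symm

theorem continuousOn_deriv (hL : ContMDiff 𝓘(ℝ, JModel k n) 𝓘(ℝ, ℝ) ∞ L) (hU : IsOpen U)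
    (hδ : 0 < δ) (hs : IsSectionOn P s U) (hσ : IsVariation P s U K δ σ) :
    ContinuousOn (fun x => deriv (fun ε => lagrangianAlong L (σ ε) x) 0) U := by
  intro x hx
  obtain ⟨c, hc⟩ := exists_fibredChart P (s x)
  have hxb := hs.base_mem hx hc
  have hz := hσ.mem_varDom_zero hδ (hs.mem_secDom hx hc)
  have hm := (hσ.isOpen_varDom hU).mem_nhds hz
  have h1 : ContinuousAt (fun z => fderiv ℝ (fun z => lagCoord L c (varJet c σ z)) z (1, 0))
      (0, c.base x) :=
    ((((hσ.contDiffOn_lagCoord_varJet hL hU).contDiffAt hm).fderiv_right (m := 0)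
      (by simp)).continuousAt).clm_apply continuousAt_const
  have h3 : ContinuousAt (fun x : M => ((0 : ℝ), c.base x)) x :=
    continuousAt_const.prodMk (c.base.continuousAt hxb)
  refine
    ((ContinuousAt.comp (f := fun x : M => ((0 : ℝ), c.base x)) h1 h3).congr
      ?_).continuousWithinAt
  filter_upwards [hU.mem_nhds hx, c.base.open_source.mem_nhds hxb, h3 hm] with x' hx' hb' hz'
  exact (hσ.hasDerivAt_lagrangianAlong hL hU hx' hb' hz').deriv.symm

variable [T2Space M] [SecondCountableTopology M] [MeasurableSpace M] [BorelSpace M]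

/-- Differentiation of the action under the integral sign. -/
theorem hasDerivAt_action (hL : ContMDiff 𝓘(ℝ, JModel k n) 𝓘(ℝ, ℝ) ∞ L) (hU : IsOpen U)
    (hδ : 0 < δ) (hs : IsSectionOn P s U) (hσ : IsVariation P s U K δ σ) (η : VolumeForm k M)
    (hK : IsCompact K) (hKU : K ⊆ U) :
    HasDerivAt (fun ε => ∫ x in K, lagrangianAlong L (σ ε) x ∂(volumeMeasure η))
      (∫ x in K, deriv (fun ε => lagrangianAlong L (σ ε) x) 0 ∂(volumeMeasure η)) 0 := by
  have hfin := isFiniteMeasureOnCompacts_volumeMeasure η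
  obtain ⟨t, ht, C, hC⟩ := hσ.exists_bound hL hU hδ hs hK hKU
  have hKm : MeasurableSet K := hK.isClosed.measurableSet
  refine (hasDerivAt_integral_of_dominated_loc_of_deriv_le
    (F' := fun ε x => deriv (fun ε => lagrangianAlong L (σ ε) x) ε) (bound := fun _ => C)
    (Ioo_mem_nhds (by simpa using ht : -t < 0) ht) ?_ ?_ ?_ ?_ ?_ ?_).2
  · filter_upwards [Ioo_mem_nhds (by simpa using hδ : -δ < 0) hδ] with ε hε
    exact ((continuousOn_lagrangianAlong hL hU (hσ.isSectionOn hε)).mono hKU).aestronglyMeasurable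
      hKm
  · exact ((continuousOn_lagrangianAlong hL hU
      (hσ.isSectionOn ⟨by simpa using hδ, hδ⟩)).mono hKU).integrableOn_compact hK
  · exact ((hσ.continuousOn_deriv hL hU hδ hs).mono hKU).aestronglyMeasurable hKm
  · refine (ae_restrict_iff' hKm).2 (Eventually.of_forall fun x hx ε hε => ?_)
    obtain ⟨d, hd, hd'⟩ := hC ε hε x hx
    rw [hd'.deriv]; exact hd
  · exact integrableOn_const hK.measure_lt_top.ne
  · refine (ae_restrict_iff' hKm).2 (Eventually.of_forall fun x hx ε hε => ?_)
    obtain ⟨d, hd, hd'⟩ := hC ε hε x hx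
    rw [hd'.deriv]; exact hd'

end IsVariation

end Variation

/-! ### The Euler–Lagrange expression -/

/-- The transpose of a functional `ℓ` on linear maps `B → F` under the trace pairing: the linear map
`p : F → B` such that `ℓ v = tr (p ∘ v)`. -/
def leg {k n : ℕ} (ℓ : (BModel k →L[ℝ] FModel n) →L[ℝ] ℝ) : FModel n →L[ℝ] BModel k :=
  ∑ i, (ℓ.comp (ContinuousLinearMap.smulRightL ℝ (BModel k) (FModel n)
    (EuclideanSpace.proj i))).smulRight (EuclideanSpace.single i (1 : ℝ))

theorem leg_apply {k n : ℕ} (ℓ : (BModel k →L[ℝ] FModel n) →L[ℝ] ℝ) (a : FModel n)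
    (i : Fin (k + 1)) : leg ℓ a i = ℓ ((EuclideanSpace.proj i).smulRight a) := by
  simp only [leg, sum_apply]
  rw [WithLp.ofLp_sum, Finset.sum_apply, Finset.sum_eq_single i]
  · simp
  · intro j _ hj
    simp [hj.symm]
  · simp

/-- The defining property `tr (leg ℓ ∘ v) = ℓ v`, with the trace written in the standard basis. -/
theorem sum_leg_apply {k n : ℕ} (ℓ : (BModel k →L[ℝ] FModel n) →L[ℝ] ℝ)
    (v : BModel k →L[ℝ] FModel n) :
    ∑ i, leg ℓ (v (EuclideanSpace.single i (1 : ℝ))) i = ℓ v := by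
  simp only [leg_apply]
  rw [← map_sum]
  congr 1
  ext1 b
  have hb : b = ∑ i, b i • EuclideanSpace.single i (1 : ℝ) := by
    have := ((EuclideanSpace.basisFun (Fin (k + 1)) ℝ).sum_repr b).symm
    simpa using this
  conv_rhs => rw [hb]
  simp [sum_apply]

theorem contDiff_leg {k n : ℕ} : ContDiff ℝ ∞ (leg (k := k) (n := n)) := by
  unfold leg
  refine ContDiff.sum fun i _ => ?_
  exact (contDiff_id.clm_comp contDiff_const).smulRight contDiff_const

section EulerLagrange

variable {k n : ℕ} {M E Q : Type*} [TopologicalSpace M] [ChartedSpace (BModel k) M]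
  [TopologicalSpace E] [ChartedSpace (BModel k × FModel n) E]
  [TopologicalSpace Q] [ChartedSpace (FModel n) Q] {P : SmoothFibreBundle k n M E Q}

/-- The coordinates `∂L/∂u_x` of the Legendre transform of the jet of a section. -/
def momentum (L : Jet1 P → ℝ) (c : FibredChart P) (s : M → E) (y : BModel k) :
    FModel n →L[ℝ] BModel k :=
  leg ((fderiv ℝ (lagCoord L c) (jetSec c s y)).comp
    (ContinuousLinearMap.inr ℝ (BModel k × FModel n) (BModel k →L[ℝ] FModel n)))

/-- The momentum, multiplied by the density of the volume form. -/
def momentumDensity (η : VolumeForm k M) (L : Jet1 P → ℝ) (c : FibredChart P) (s : M → E)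
    (y : BModel k) : FModel n →L[ℝ] BModel k :=
  |formDensity η c.base y| • momentum L c s y

/-- The Euler–Lagrange expression `r ∂L/∂u - ∂ᵢ (r ∂L/∂u_i)` of a section in a fibred chart, where
`r = |η(∂₁, …, ∂_m)|`. -/
def eulerLagrange (η : VolumeForm k M) (L : Jet1 P → ℝ) (c : FibredChart P) (s : M → E)
    (y : BModel k) : FModel n →L[ℝ] ℝ :=
  |formDensity η c.base y| • ((fderiv ℝ (lagCoord L c) (jetSec c s y)).comp
    ((ContinuousLinearMap.inl ℝ (BModel k × FModel n) (BModel k →L[ℝ] FModel n)).comp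
      (ContinuousLinearMap.inr ℝ (BModel k) (FModel n)))) -
  ∑ j, (EuclideanSpace.proj j).comp
    (fderiv ℝ (momentumDensity η L c s) y (EuclideanSpace.single j (1 : ℝ)))

variable {U K : Set M} {s : M → E} {c : FibredChart P} {δ : ℝ} {σ : ℝ → M → E}
  [IsManifold 𝓘(ℝ, BModel k) ∞ M] [IsManifold 𝓘(ℝ, FModel n) ∞ Q] {L : Jet1 P → ℝ}

theorem contDiffOn_abs_formDensity {e : OpenPartialHomeomorph M (BModel k)} (h : IsSmoothChart e)
    (η : VolumeForm k M) : ContDiffOn ℝ ∞ (fun y => |formDensity η e y|) e.target :=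
  fun y hy => (contDiffAt_abs (h.formDensity_ne_zero η hy)).comp_contDiffWithinAt y
    (h.contDiffOn_formDensity η y hy)

namespace IsSectionOn

theorem contDiffOn_fderiv_lagCoord (hL : ContMDiff 𝓘(ℝ, JModel k n) 𝓘(ℝ, ℝ) ∞ L) (hU : IsOpen U)
    (hs : IsSectionOn P s U) :
    ContDiffOn ℝ ∞ (fun y => fderiv ℝ (lagCoord L c) (jetSec c s y)) (secDom c s U) :=
  ((contDiffOn_lagCoord hL c).fderiv_of_isOpen (isOpen_jetTarget c) (by simp)).comp
    (hs.contDiffOn_jetSec hU) fun _ hy => hs.jetSec_mem hy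

theorem contDiffOn_momentum (hL : ContMDiff 𝓘(ℝ, JModel k n) 𝓘(ℝ, ℝ) ∞ L) (hU : IsOpen U)
    (hs : IsSectionOn P s U) : ContDiffOn ℝ ∞ (momentum L c s) (secDom c s U) :=
  contDiff_leg.comp_contDiffOn
    ((hs.contDiffOn_fderiv_lagCoord hL hU).clm_comp contDiffOn_const)

theorem contDiffOn_momentumDensity (hL : ContMDiff 𝓘(ℝ, JModel k n) 𝓘(ℝ, ℝ) ∞ L) (hU : IsOpen U)
    (hs : IsSectionOn P s U) (η : VolumeForm k M) :
    ContDiffOn ℝ ∞ (momentumDensity η L c s) (secDom c s U) :=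
  ((contDiffOn_abs_formDensity c.isSmoothChart η).mono fun _ hy => hy.1).smul
    (hs.contDiffOn_momentum hL hU)

theorem continuousOn_eulerLagrange (hL : ContMDiff 𝓘(ℝ, JModel k n) 𝓘(ℝ, ℝ) ∞ L) (hU : IsOpen U)
    (hs : IsSectionOn P s U) (η : VolumeForm k M) :
    ContinuousOn (eulerLagrange η L c s) (secDom c s U) := by
  refine ContinuousOn.sub (ContinuousOn.smul
    ((contDiffOn_abs_formDensity c.isSmoothChart η).continuousOn.mono fun _ hy => hy.1)
    ((hs.contDiffOn_fderiv_lagCoord hL hU).continuousOn.clm_comp continuousOn_const)) ?_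
  refine continuousOn_finsetSum _ fun j _ => continuousOn_const.clm_comp ?_
  exact ((hs.contDiffOn_momentumDensity hL hU η).fderiv_of_isOpen (m := 0) (isOpen_secDom hU hs)
    (by simp)).continuousOn.clm_apply continuousOn_const

/-- Up to a divergence, the first variation of the Lagrangian is the Euler–Lagrange expression: the
product rule for the vector field `r ∂L/∂u_x V`. -/
theorem first_variation_eq (hL : ContMDiff 𝓘(ℝ, JModel k n) 𝓘(ℝ, ℝ) ∞ L) (hU : IsOpen U)
    (hs : IsSectionOn P s U) (η : VolumeForm k M) {V : BModel k → FModel n} {y : BModel k}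
    (hy : y ∈ secDom c s U) (hV : DifferentiableAt ℝ V y) :
    |formDensity η c.base y| *
        fderiv ℝ (lagCoord L c) (jetSec c s y) ((0, V y), fderiv ℝ V y) =
      eulerLagrange η L c s y (V y) +
        ∑ j, (fderiv ℝ (fun y => momentumDensity η L c s y (V y)) y
          (EuclideanSpace.single j (1 : ℝ))) j := by
  have h1 : DifferentiableAt ℝ (momentumDensity η L c s) y :=
    ((hs.contDiffOn_momentumDensity hL hU η).contDiffAt
      ((isOpen_secDom hU hs).mem_nhds hy)).differentiableAt (by simp)
  rw [(h1.hasFDerivAt.clm_apply hV.hasFDerivAt).fderiv]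
  have h2 := sum_leg_apply ((fderiv ℝ (lagCoord L c) (jetSec c s y)).comp
    (ContinuousLinearMap.inr ℝ (BModel k × FModel n) (BModel k →L[ℝ] FModel n))) (fderiv ℝ V y)
  have h3 : fderiv ℝ (lagCoord L c) (jetSec c s y) ((0, V y), fderiv ℝ V y) =
      fderiv ℝ (lagCoord L c) (jetSec c s y) ((0, V y), 0) +
        fderiv ℝ (lagCoord L c) (jetSec c s y) (0, fderiv ℝ V y) := by
    rw [← map_add]; simp
  have h4 : fderiv ℝ (lagCoord L c) (jetSec c s y) (0, fderiv ℝ V y) =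
    ∑ j, momentum L c s y (fderiv ℝ V y (EuclideanSpace.single j (1 : ℝ))) j := h2.symm
  rw [h3, h4]
  simp only [eulerLagrange, momentumDensity, add_apply, sub_apply, smul_apply, sum_apply,
    ContinuousLinearMap.comp_apply, smul_eq_mul, ContinuousLinearMap.flip_apply, PiLp.add_apply,
    PiLp.smul_apply, Finset.sum_add_distrib, Finset.mul_sum, mul_add]
  simp only [ContinuousLinearMap.inl_apply, ContinuousLinearMap.inr_apply, PiLp.proj_apply,
    EuclideanSpace.proj, ← Finset.mul_sum]
  unfold momentumDensity
  ring

end IsSectionOn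

namespace IsVariation

theorem hasDerivAt_varCoord (hU : IsOpen U) (hδ : 0 < δ) (hσ : IsVariation P s U K δ σ)
    {y : BModel k} (hy : y ∈ secDom c s U) :
    HasDerivAt (fun ε => varCoord c σ (ε, y)) (varField c σ y) 0 := by
  have h1 : DifferentiableAt ℝ (varCoord c σ) (0, y) :=
    (hσ.contDiffOn_varCoord.contDiffAt ((hσ.isOpen_varDom hU).mem_nhds
      (hσ.mem_varDom_zero hδ hy))).differentiableAt (by simp)
  have h2 : HasFDerivAt (fun ε : ℝ => (ε, y)) (ContinuousLinearMap.inl ℝ ℝ (BModel k)) 0 :=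
    hasFDerivAt_prodMk_left 0 y
  exact (h1.hasFDerivAt.comp (0 : ℝ) h2).hasDerivAt

/-- The Lagrangian does not vary outside of the support of a variation: near such a point, the
variational vector field vanishes together with its derivative. -/
theorem deriv_eq_zero (hL : ContMDiff 𝓘(ℝ, JModel k n) 𝓘(ℝ, ℝ) ∞ L) (hU : IsOpen U) (hδ : 0 < δ)
    (hs : IsSectionOn P s U) (hσ : IsVariation P s U K δ σ) (hK : IsClosed K) {x : M} (hx : x ∈ U)
    (hxK : x ∉ K) : deriv (fun ε => lagrangianAlong L (σ ε) x) 0 = 0 := by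
  obtain ⟨c, hc⟩ := exists_fibredChart P (s x)
  have hxb := hs.base_mem hx hc
  have hy := hs.mem_secDom hx hc
  rw [(hσ.hasDerivAt_lagrangianAlong_zero hL hU hδ hs hx hc).deriv]
  have h : varField c σ =ᶠ[𝓝 (c.base x)] fun _ => 0 := by
    have h1 := c.base.continuousAt_symm (c.base.map_source hxb)
    have h2 : Kᶜ ∈ 𝓝 (c.base.symm (c.base x)) := by
      rw [c.base.left_inv hxb]; exact hK.isOpen_compl.mem_nhds hxK
    filter_upwards [h1 h2, (isOpen_secDom hU hs).mem_nhds hy] with y hyK hy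
    exact hσ.varField_eq_zero hU hδ hy hyK
  rw [h.fderiv_eq, h.eq_of_nhds, fderiv_fun_const]
  exact map_zero _

variable [T2Space M] [SecondCountableTopology M] [MeasurableSpace M] [BorelSpace M]

/-- The first variation of the action, for a variation supported in the domain of a chart. -/
theorem integral_deriv_eq (hL : ContMDiff 𝓘(ℝ, JModel k n) 𝓘(ℝ, ℝ) ∞ L) (hU : IsOpen U)
    (hδ : 0 < δ) (hs : IsSectionOn P s U) (hσ : IsVariation P s U K δ σ) (η : VolumeForm k M)
    (hK : IsCompact K) (hKU : K ⊆ U) (hKc : ∀ x ∈ K, s x ∈ c.total.source) :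
    ∫ x in K, deriv (fun ε => lagrangianAlong L (σ ε) x) 0 ∂(volumeMeasure η) =
      ∫ y in c.base.target ∩ c.base.symm ⁻¹' K, eulerLagrange η L c s y (varField c σ y) := by
  classical
  have hKb : K ⊆ c.base.source := fun x hx => hs.base_mem (hKU hx) (hKc x hx)
  set K' := c.base.target ∩ c.base.symm ⁻¹' K with hK'
  have hK'eq : K' = c.base '' K := by
    ext y
    constructor
    · rintro ⟨h1, h2⟩; exact ⟨_, h2, c.base.right_inv h1⟩
    · rintro ⟨x, hx, rfl⟩
      refine ⟨c.base.map_source (hKb hx), ?_⟩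
      rw [mem_preimage, c.base.left_inv (hKb hx)]; exact hx
  have hK'c : IsCompact K' := by
    rw [hK'eq]; exact hK.image_of_continuousOn (c.base.continuousOn.mono hKb)
  set D := secDom c s U
  have hDo : IsOpen D := isOpen_secDom hU hs
  have hK'D : K' ⊆ D := fun y hy => ⟨hy.1, hKU hy.2, hKc _ hy.2⟩
  have hm : AEStronglyMeasurable (fun x => deriv (fun ε => lagrangianAlong L (σ ε) x) 0)
      ((volumeMeasure η).restrict K) :=
    ((hσ.continuousOn_deriv hL hU hδ hs).mono hKU).aestronglyMeasurable hK.isClosed.measurableSet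
  rw [c.isSmoothChart.setIntegral_volumeMeasure η hK.isClosed.measurableSet hKb hm]
  have hVd : ContDiffOn ℝ ∞ (varField c σ) D := hσ.contDiffOn_varField hU hδ
  set R : BModel k → BModel k := fun y => momentumDensity η L c s y (varField c σ y) with hR
  have hRd : ContDiffOn ℝ ∞ R D := (hs.contDiffOn_momentumDensity hL hU η).clm_apply hVd
  have e1 : ∀ y ∈ K', |formDensity η c.base y| *
      deriv (fun ε => lagrangianAlong L (σ ε) (c.base.symm y)) 0 =
      eulerLagrange η L c s y (varField c σ y) +
        ∑ j, (fderiv ℝ R y (EuclideanSpace.single j (1 : ℝ))) j := by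
    intro y hy
    rw [(hσ.hasDerivAt_lagrangianAlong_zero hL hU hδ hs (hKU hy.2) (hKc _ hy.2)).deriv,
      c.base.right_inv hy.1]
    exact hs.first_variation_eq hL hU η (hK'D hy)
      ((hVd.contDiffAt (hDo.mem_nhds (hK'D hy))).differentiableAt (by simp))
  rw [setIntegral_congr_fun hK'c.measurableSet e1, integral_add]
  · -- the divergence term integrates to zero: the field `R` vanishes on `D` outside of the compact
    -- set `K'`, and `Z` is its extension by zero to the whole space
    set Z : BModel k → BModel k := fun y => if y ∈ K' then R y else 0 with hZ
    have hZD : ∀ y ∈ D, Z y = R y := by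
      intro y hy
      by_cases hyK : y ∈ K'
      · simp [hZ, hyK]
      · have : varField c σ y = 0 :=
          hσ.varField_eq_zero hU hδ hy fun h => hyK ⟨hy.1, h⟩
        simp [hZ, hyK, hR, this]
    have h0 : ∫ y in K', ∑ j, (fderiv ℝ R y (EuclideanSpace.single j (1 : ℝ))) j = 0 := by
      have hd := integral_div_eq_zero (Z := Z) hDo hK'c hK'D
        ((hRd.congr hZD).of_le (by simp)) fun y hy => by simp [hZ, hy]
      rw [← setIntegral_eq_integral_of_forall_compl_eq_zero (s := K')] at hd
      · refine (setIntegral_congr_fun hK'c.measurableSet fun y hy => ?_).trans hd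
        have : Z =ᶠ[𝓝 y] R := by
          filter_upwards [hDo.mem_nhds (hK'D hy)] with z hz using hZD z hz
        simp only [this.fderiv_eq]
      · intro y hy
        have : Z =ᶠ[𝓝 y] fun _ => 0 := by
          filter_upwards [hK'c.isClosed.isOpen_compl.mem_nhds hy] with z hz
          simp only [hZ, if_neg hz]
        simp [this.fderiv_eq]
    rw [h0, add_zero]
  · exact (((hs.continuousOn_eulerLagrange hL hU η).clm_apply hVd.continuousOn).mono
      hK'D).integrableOn_compact hK'c
  · refine ContinuousOn.integrableOn_compact hK'c ?_
    refine continuousOn_finsetSum _ fun j _ => ?_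
    have h2 : ContinuousOn (fun y => fderiv ℝ R y (EuclideanSpace.single j (1 : ℝ))) K' :=
      ((hRd.fderiv_of_isOpen (m := 0) hDo (by simp)).continuousOn.clm_apply
        continuousOn_const).mono hK'D
    exact (EuclideanSpace.proj (𝕜 := ℝ) j).continuous.comp_continuousOn h2

end IsVariation

end EulerLagrange

/-! ### Critical sections and the Euler–Lagrange equations -/

section Critical

variable {k n : ℕ} {M E Q : Type*} [TopologicalSpace M] [ChartedSpace (BModel k) M]
  [TopologicalSpace E] [ChartedSpace (BModel k × FModel n) E]
  [TopologicalSpace Q] [ChartedSpace (FModel n) Q] {P : SmoothFibreBundle k n M E Q}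
  {U K : Set M} {s : M → E} {c : FibredChart P} {δ : ℝ} {σ : ℝ → M → E} {χ : M → ℝ}

/-- Slowing down a variation by a cut-off function gives a variation. -/
theorem IsVariation.cutoff (hσ : IsVariation P s U K δ σ)
    (hχ : ContMDiff 𝓘(ℝ, BModel k) 𝓘(ℝ, ℝ) ∞ χ) (h0 : ∀ x, 0 ≤ χ x) (h1 : ∀ x, χ x ≤ 1) :
    IsVariation P s U (K ∩ tsupport χ) δ fun ε x => σ (χ x * ε) x := by
  have hm : ∀ ε ∈ Ioo (-δ) δ, ∀ x, χ x * ε ∈ Ioo (-δ) δ := by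
    intro ε hε x
    have hε' : |ε| < δ := abs_lt.2 hε
    refine abs_lt.1 ?_
    rw [abs_mul, abs_of_nonneg (h0 x)]
    exact (mul_le_of_le_one_left (abs_nonneg ε) (h1 x)).trans_lt hε'
  refine ⟨?_, fun ε hε x hx => hσ.proj_eq _ (hm ε hε x) x hx, fun x hx => ?_, fun ε hε x hx => ?_⟩
  · have h2 : ContMDiff (𝓘(ℝ, ℝ).prod 𝓘(ℝ, BModel k)) 𝓘(ℝ, ℝ) ∞
        (fun z : ℝ × M => χ z.2 * z.1) := (hχ.comp contMDiff_snd).mul contMDiff_fst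
    exact hσ.smooth.comp (h2.prodMk contMDiff_snd).contMDiffOn fun z hz => ⟨hm _ hz.1 _, hz.2⟩
  · simp only [mul_zero]; exact hσ.zero_eq x hx
  · by_cases hK : x ∈ K
    · have : χ x = 0 := image_eq_zero_of_notMem_tsupport fun h => hx.2 ⟨hK, h⟩
      simp only [this, zero_mul]; exact hσ.zero_eq x hx.1
    · exact hσ.eq_off _ (hm ε hε x) x ⟨hx.1, hK⟩

theorem IsVariation.varField_cutoff [IsManifold 𝓘(ℝ, BModel k) ∞ M]
    [IsManifold 𝓘(ℝ, FModel n) ∞ Q] (hU : IsOpen U) (hδ : 0 < δ)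
    (hσ : IsVariation P s U K δ σ)
    (hχ : ContMDiff 𝓘(ℝ, BModel k) 𝓘(ℝ, ℝ) ∞ χ) (h0 : ∀ x, 0 ≤ χ x) (h1 : ∀ x, χ x ≤ 1)
    {y : BModel k} (hy : y ∈ secDom c s U) :
    varField c (fun ε x => σ (χ x * ε) x) y = χ (c.base.symm y) • varField c σ y := by
  have h2 := (hσ.cutoff hχ h0 h1).hasDerivAt_varCoord hU hδ hy
  have h3 := hσ.hasDerivAt_varCoord hU hδ hy
  have h4 : HasDerivAt (fun ε : ℝ => χ (c.base.symm y) * ε) (χ (c.base.symm y)) 0 := by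
    simpa using (hasDerivAt_id (0 : ℝ)).const_mul (χ (c.base.symm y))
  have h5 : HasDerivAt (fun ε => varCoord c σ (ε, y)) (varField c σ y)
    (χ (c.base.symm y) * 0) := by rw [mul_zero]; exact h3
  exact h2.unique (h5.scomp (0 : ℝ) h4)

variable [IsManifold 𝓘(ℝ, BModel k) ∞ M] [IsManifold 𝓘(ℝ, FModel n) ∞ Q] {L : Jet1 P → ℝ}
  [T2Space M] [SecondCountableTopology M] [MeasurableSpace M] [BorelSpace M]

/-- A section that satisfies the Euler–Lagrange equations is critical. A partition of unity reduces
this to variations supported in the domain of a chart. -/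
theorem isCritical_of_eulerLagrange (hL : ContMDiff 𝓘(ℝ, JModel k n) 𝓘(ℝ, ℝ) ∞ L) (hU : IsOpen U)
    (hs : IsSectionOn P s U) (η : VolumeForm k M)
    (h : ∀ c : FibredChart P, ∀ y ∈ secDom c s U, eulerLagrange η L c s y = 0) :
    IsCritical η L U s := by
  intro K hKU hK δ hδ σ hσ
  have hder := hσ.hasDerivAt_action hL hU hδ hs η hK hKU
  suffices h0 : ∫ x in K, deriv (fun ε => lagrangianAlong L (σ ε) x) 0 ∂(volumeMeasure η) = 0 by
    rwa [h0] at hder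
  have := Manifold.locallyCompact_of_finiteDimensional (M := M) 𝓘(ℝ, BModel k)
  choose c hc using fun x : M => exists_fibredChart P (s x)
  let O : M → Set M := fun x => U ∩ s ⁻¹' (c x).total.source
  have hO : ∀ x, IsOpen (O x) := fun x =>
    hs.1.continuousOn.isOpen_inter_preimage hU (c x).total.open_source
  obtain ⟨t, -, htK⟩ := hK.elim_nhds_subcover O fun x hx => (hO x).mem_nhds ⟨hKU hx, hc x⟩
  obtain ⟨f, hf⟩ := SmoothPartitionOfUnity.exists_isSubordinate 𝓘(ℝ, BModel k) hK.isClosed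
    (fun i : t => O i) (fun i => hO i) (by
      intro x hx
      obtain ⟨i, hi, hxi⟩ := mem_iUnion₂.1 (htK hx)
      exact mem_iUnion.2 ⟨⟨i, hi⟩, hxi⟩)
  let τ : t → ℝ → M → E := fun i ε x => σ (f i x * ε) x
  have hτ : ∀ i, IsVariation P s U (K ∩ tsupport (f i)) δ (τ i) := fun i =>
    hσ.cutoff (f i).contMDiff (f.nonneg i) (f.le_one i)
  have hsum : ∀ x ∈ K, ∑ i, f i x = 1 := fun x hx => by
    rw [← finsum_eq_sum_of_fintype]; exact f.sum_eq_one hx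
  have hKi : ∀ i, IsCompact (K ∩ tsupport (f i)) := fun i => hK.inter_right (isClosed_tsupport _)
  -- on `K` the functions `f i` add up to `1`, so the fields of the localised variations add up to
  -- that of `σ`; the pointwise first variation is linear in the field and its derivative
  have e1 : ∀ x ∈ K, deriv (fun ε => lagrangianAlong L (σ ε) x) 0 =
      ∑ i, deriv (fun ε => lagrangianAlong L (τ i ε) x) 0 := by
    intro x hxK
    have hx := hKU hxK
    have hcx := hc x
    have hy := hs.mem_secDom hx hcx
    have hm := (isOpen_secDom hU hs).mem_nhds hy
    rw [(hσ.hasDerivAt_lagrangianAlong_zero hL hU hδ hs hx hcx).deriv]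
    have e2 : ∀ i, _ := fun i => ((hτ i).hasDerivAt_lagrangianAlong_zero hL hU hδ hs hx hcx).deriv
    simp only [e2]
    rw [← map_sum]
    congr 1
    have e3 : varField (c x) σ =ᶠ[𝓝 ((c x).base x)] fun y => ∑ i, varField (c x) (τ i) y := by
      filter_upwards [hm] with y hy
      have e4 : ∀ i, varField (c x) (τ i) y = f i ((c x).base.symm y) • varField (c x) σ y :=
        fun i => hσ.varField_cutoff hU hδ (f i).contMDiff (f.nonneg i) (f.le_one i) hy
      simp only [e4]
      rw [← Finset.sum_smul]
      by_cases hyK : (c x).base.symm y ∈ K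
      · rw [hsum _ hyK, one_smul]
      · rw [hσ.varField_eq_zero hU hδ hy hyK, smul_zero]
    rw [e3.fderiv_eq, e3.eq_of_nhds, fderiv_fun_sum fun i _ =>
      (((hτ i).contDiffOn_varField hU hδ).contDiffAt hm).differentiableAt (by simp)]
    refine Prod.ext (Prod.ext ?_ ?_) ?_
    · simp [Prod.fst_sum]
    · simp [Prod.fst_sum, Prod.snd_sum]
    · simp [Prod.snd_sum]
  have hfin := isFiniteMeasureOnCompacts_volumeMeasure η
  rw [setIntegral_congr_fun hK.isClosed.measurableSet e1, integral_finsetSum]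
  · refine Finset.sum_eq_zero fun i _ => ?_
    rw [setIntegral_eq_of_subset_of_forall_sdiff_eq_zero hK.isClosed.measurableSet
      (inter_subset_left : K ∩ tsupport (f i) ⊆ K)
      fun x hx => (hτ i).deriv_eq_zero hL hU hδ hs (hKi i).isClosed (hKU hx.1)
        fun h' => hx.2 h']
    rw [(hτ i).integral_deriv_eq (c := c i) hL hU hδ hs η (hKi i)
      (inter_subset_left.trans hKU) fun x hx => (hf i hx.2).2]
    refine (setIntegral_congr_fun (measurableSet_preimage_symm _ (hKi i).isClosed.measurableSet)
      (g := fun _ => (0 : ℝ)) fun y hy => ?_).trans (by simp)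
    have hyD : y ∈ secDom (c i) s U := ⟨hy.1, hKU hy.2.1, (hf i hy.2.2).2⟩
    simp only [h _ _ hyD]
    rfl
  · intro i _
    exact (((hτ i).continuousOn_deriv hL hU hδ hs).mono hKU).integrableOn_compact hK

/-- A test function on the domain of a chart defines a variation in a direction `a` of the fibre. -/
theorem exists_variation (hU : IsOpen U) (hs : IsSectionOn P s U) (c : FibredChart P)
    {φ : BModel k → ℝ} (hφ : ContDiff ℝ ∞ φ) (hφc : HasCompactSupport φ)
    (hφD : tsupport φ ⊆ secDom c s U) (a : FModel n) :
    ∃ δ > 0, ∃ σ, IsVariation P s U (c.base.symm '' tsupport φ) δ σ ∧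
      ∀ y ∈ secDom c s U, varField c σ y = φ y • a := by
  classical
  set D := secDom c s U with hD
  have hDo : IsOpen D := isOpen_secDom hU hs
  set u := secCoord c s
  -- the variation is `u + ε φ a` in coordinates
  let w : ℝ × BModel k → BModel k × FModel n := fun z => (z.2, u z.2 + (z.1 * φ z.2) • a)
  have hu : ContDiffOn ℝ ∞ (fun z : ℝ × BModel k => u z.2) (univ ×ˢ D) :=
    hs.contDiffOn_secCoord.comp contDiff_snd.contDiffOn fun z hz => hz.2
  have hw : ContDiffOn ℝ ∞ w (univ ×ˢ D) :=
    contDiff_snd.contDiffOn.prodMk (hu.add ((contDiff_fst.mul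
      (hφ.comp contDiff_snd)).smul contDiff_const).contDiffOn)
  have hw0 : ∀ ε : ℝ, ∀ y ∈ D, φ y = 0 → w (ε, y) ∈ c.total.target := by
    intro ε y hy h0
    have : w (ε, y) = (jetSec c s y).1 := by simp [w, h0, jetSec, u]
    rw [this]; exact hs.jetSec_mem hy
  set A : Set (ℝ × BModel k) := (univ ×ˢ D) ∩ w ⁻¹' c.total.target with hA
  have hAo : IsOpen A :=
    hw.continuousOn.isOpen_inter_preimage (isOpen_univ.prod hDo) c.total.open_target
  have hA0 : ({0} : Set ℝ) ×ˢ tsupport φ ⊆ A := by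
    rintro ⟨ε, y⟩ ⟨hε, hy⟩
    have hε' : ε = 0 := hε
    subst hε'
    refine ⟨⟨mem_univ _, hφD hy⟩, ?_⟩
    have : w (0, y) = (jetSec c s y).1 := by simp [w, jetSec, u]
    rw [mem_preimage, this]; exact hs.jetSec_mem (hφD hy)
  -- for small parameters, the varied section stays in the range of the chart above the compact
  -- support of `φ`, and elsewhere it is not varied
  obtain ⟨I, J, hI, hJ, hI0, hJφ, hIJ⟩ := generalized_tube_lemma isCompact_singleton hφc hAo hA0
  obtain ⟨δ, hδ, hδI⟩ := Metric.isOpen_iff.1 hI 0 (hI0 rfl)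
  have hwt : ∀ ε ∈ Ioo (-δ) δ, ∀ y ∈ D, w (ε, y) ∈ c.total.target := by
    intro ε hε y hy
    by_cases h : y ∈ tsupport φ
    · refine (hIJ (mk_mem_prod (hδI ?_) (hJφ h))).2
      rw [Metric.mem_ball, Real.dist_eq, sub_zero, abs_lt]; exact hε
    · exact hw0 ε y hy (image_eq_zero_of_notMem_tsupport h)
  set X : Set M := c.base.source ∩ c.base ⁻¹' D with hX
  have hXo : IsOpen X := c.base.isOpen_inter_preimage hDo
  have hXU : X ⊆ U := fun x hx => by
    have := hx.2.2.1
    rwa [c.base.left_inv hx.1] at this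
  have hXs : ∀ x ∈ X, s x ∈ c.total.source := fun x hx => by
    have := hx.2.2.2
    rwa [c.base.left_inv hx.1] at this
  -- outside of the domain `X` of the coordinates, the variation is constant
  let σ : ℝ → M → E := fun ε x => if x ∈ X then c.total.symm (w (ε, c.base x)) else s x
  have hsymm : ∀ y ∈ D, c.base.symm y ∈ X := fun y hy =>
    ⟨c.base.map_target hy.1, by rw [mem_preimage, c.base.right_inv hy.1]; exact hy⟩
  have hKc : IsCompact (c.base.symm '' tsupport φ) :=
    hφc.isCompact.image_of_continuousOn
      (c.base.continuousOn_symm.mono fun y hy => (hφD hy).1)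
  have hs0 : ∀ ε : ℝ, ∀ x ∈ X, φ (c.base x) = 0 ∨ ε = 0 → c.total.symm (w (ε, c.base x)) = s x := by
    intro ε x hx h0
    have h1 : w (ε, c.base x) = c.total (s x) := by
      have h2 := hs.total_eq hx.2
      rw [c.base.left_inv hx.1] at h2
      rw [h2]
      rcases h0 with h0 | h0 <;> simp [w, h0, u]
    rw [h1, c.total.left_inv (hXs x hx)]
  have hoff : ∀ ε : ℝ, ∀ x, x ∉ c.base.symm '' tsupport φ → σ ε x = s x := by
    intro ε x hx
    by_cases hxX : x ∈ X
    · simp only [σ, if_pos hxX]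
      refine hs0 ε x hxX (Or.inl (image_eq_zero_of_notMem_tsupport fun h => hx ?_))
      exact ⟨_, h, c.base.left_inv hxX.1⟩
    · simp only [σ, if_neg hxX]
  have hvar : IsVariation P s U (c.base.symm '' tsupport φ) δ σ := by
    refine ⟨?_, fun ε hε x hx => ?_, fun x hx => ?_, fun ε _ x hx => hoff ε x hx.2⟩
    · rintro ⟨ε, x⟩ ⟨hε, hx⟩
      by_cases hxX : x ∈ X
      · have h1 : ContMDiffOn (𝓘(ℝ, ℝ).prod 𝓘(ℝ, BModel k)) 𝓘(ℝ, ℝ × BModel k) ∞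
            (fun z : ℝ × M => (z.1, c.base z.2)) (Ioo (-δ) δ ×ˢ X) :=
          contMDiffOn_fst.prodMk_space
            (c.base_smooth.comp contMDiffOn_snd fun z hz => hz.2.1)
        have h2 : ContMDiffOn (𝓘(ℝ, ℝ).prod 𝓘(ℝ, BModel k)) 𝓘(ℝ, BModel k × FModel n) ∞
            (fun z : ℝ × M => c.total.symm (w (z.1, c.base z.2))) (Ioo (-δ) δ ×ˢ X) :=
          c.total_symm_smooth.comp (hw.contMDiffOn.comp h1 fun z hz => ⟨mem_univ _, hz.2.2⟩)
            fun z hz => hwt _ hz.1 _ hz.2.2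
        have hm : Ioo (-δ) δ ×ˢ X ∈ 𝓝 (ε, x) := (isOpen_Ioo.prod hXo).mem_nhds ⟨hε, hxX⟩
        refine ((h2.contMDiffAt hm).congr_of_eventuallyEq ?_).contMDiffWithinAt
        filter_upwards [hm] with z hz
        simp only [σ, if_pos hz.2]
      · have hxK : x ∉ c.base.symm '' tsupport φ := by
          rintro ⟨y, hy, rfl⟩
          exact hxX (hsymm y (hφD hy))
        have h2 : ContMDiffOn (𝓘(ℝ, ℝ).prod 𝓘(ℝ, BModel k)) 𝓘(ℝ, BModel k × FModel n) ∞
            (fun z : ℝ × M => s z.2) (univ ×ˢ U) :=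
          hs.1.comp contMDiffOn_snd fun z hz => hz.2
        have hm : univ ×ˢ U ∈ 𝓝 (ε, x) := (isOpen_univ.prod hU).mem_nhds ⟨mem_univ _, hx⟩
        refine ((h2.contMDiffAt hm).congr_of_eventuallyEq ?_).contMDiffWithinAt
        filter_upwards [(isOpen_univ.prod hKc.isClosed.isOpen_compl).mem_nhds
          (⟨mem_univ _, hxK⟩ : (ε, x) ∈ univ ×ˢ (c.base.symm '' tsupport φ)ᶜ)] with z hz
        exact hoff _ _ hz.2
    · by_cases hxX : x ∈ X
      · simp only [σ, if_pos hxX]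
        have h1 := hwt ε hε _ hxX.2
        have h2 := c.total.map_target h1
        refine c.base.injOn (c.proj_mem _ h2) hxX.1 ?_
        rw [← c.fst_total _ h2, c.total.right_inv h1]
      · simp only [σ, if_neg hxX]; exact hs.2 x hx
    · by_cases hxX : x ∈ X
      · simp only [σ, if_pos hxX]; exact hs0 0 x hxX (Or.inr rfl)
      · simp only [σ, if_neg hxX]
  refine ⟨δ, hδ, σ, hvar, fun y hy => ?_⟩
  have h1 := hvar.hasDerivAt_varCoord hU hδ hy
  have h2 : HasDerivAt (fun ε : ℝ => u y + (ε * φ y) • a) (φ y • a) 0 := by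
    have h3 : HasDerivAt (fun ε : ℝ => ε * φ y) (φ y) 0 := by
      simpa using (hasDerivAt_id (0 : ℝ)).mul_const (φ y)
    exact (h3.smul_const a).const_add (u y)
  refine h1.unique (h2.congr_of_eventuallyEq ?_)
  filter_upwards [Ioo_mem_nhds (by simpa using hδ : -δ < 0) hδ] with ε hε
  change (c.total (σ ε (c.base.symm y))).2 = _
  simp only [σ, if_pos (hsymm y hy)]
  rw [c.base.right_inv hy.1, c.total.right_inv (hwt ε hε y hy)]

/-- A critical section satisfies the Euler–Lagrange equations. -/
theorem IsCritical.eulerLagrange_eq_zero (hL : ContMDiff 𝓘(ℝ, JModel k n) 𝓘(ℝ, ℝ) ∞ L)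
    (hU : IsOpen U) (hs : IsSectionOn P s U) (η : VolumeForm k M) (h : IsCritical η L U s)
    (c : FibredChart P) {y : BModel k} (hy : y ∈ secDom c s U) : eulerLagrange η L c s y = 0 := by
  have hDo : IsOpen (secDom c s U) := isOpen_secDom hU hs
  ext1 a
  have hcont : ContinuousOn (fun y => eulerLagrange η L c s y a) (secDom c s U) :=
    (hs.continuousOn_eulerLagrange hL hU η).clm_apply continuousOn_const
  have hae : ∀ᵐ y ∂(volume : Measure (BModel k)), y ∈ secDom c s U →
      eulerLagrange η L c s y a = 0 := by
    refine hDo.ae_eq_zero_of_integral_contDiff_smul_eq_zero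
      (hcont.locallyIntegrableOn hDo.measurableSet) fun φ hφ hφc hφD => ?_
    obtain ⟨δ, hδ, σ, hσ, hV⟩ := exists_variation hU hs c hφ hφc hφD a
    have hKc : IsCompact (c.base.symm '' tsupport φ) :=
      hφc.isCompact.image_of_continuousOn
        (c.base.continuousOn_symm.mono fun y hy => (hφD hy).1)
    have hKU : c.base.symm '' tsupport φ ⊆ U := by
      rintro _ ⟨y, hy, rfl⟩; exact (hφD hy).2.1
    have h1 := hσ.hasDerivAt_action hL hU hδ hs η hKc hKU
    have h2 := h1.unique (h _ hKU hKc δ hδ σ hσ)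
    rw [hσ.integral_deriv_eq (c := c) hL hU hδ hs η hKc hKU
      (by rintro _ ⟨y, hy, rfl⟩; exact (hφD hy).2.2)] at h2
    have h3 : c.base.target ∩ c.base.symm ⁻¹' (c.base.symm '' tsupport φ) = tsupport φ := by
      ext z
      constructor
      · rintro ⟨hz, y, hy, hyz⟩
        rwa [← c.base.symm.injOn (hφD hy).1 hz hyz]
      · intro hz; exact ⟨(hφD hz).1, z, hz, rfl⟩
    rw [h3] at h2
    rw [← h2, ← setIntegral_eq_integral_of_forall_compl_eq_zero (s := tsupport φ)]
    · refine setIntegral_congr_fun (isClosed_tsupport φ).measurableSet fun y hy => ?_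
      simp only [hV y (hφD hy), map_smul]
    · intro y hy
      rw [image_eq_zero_of_notMem_tsupport hy, zero_smul]
  have h1 : (fun y => eulerLagrange η L c s y a) =ᵐ[volume.restrict (secDom c s U)] fun _ => 0 :=
    (ae_restrict_iff' hDo.measurableSet).2 hae
  exact Measure.eqOn_open_of_ae_eq h1 hDo hcont continuousOn_const hy

end Critical

/-! ### The exterior derivative in an arbitrary chart -/

section ExteriorDerivative

variable {V N : Type*} [NormedAddCommGroup V] [NormedSpace ℝ V] [TopologicalSpace N]
  [ChartedSpace V N] {q : ℕ}

/-- The representative of a form in a chart `e`: the pullback under the inverse of the chart. -/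
def formRep (α : DForm V N q) (e : OpenPartialHomeomorph N V) (y : V) : V [⋀^Fin q]→L[ℝ] ℝ :=
  (α (e.symm y)).compContinuousLinearMap (tmap (V := V) e.symm y)

variable [IsManifold 𝓘(ℝ, V) ∞ N]

/-- The exterior derivative, defined with the preferred charts, can be computed in any chart, since
it commutes with the pullback under the change of coordinates. -/
theorem extD_eq_extDeriv_formRep (α : DForm V N q) {e : OpenPartialHomeomorph N V}
    (he : ContMDiffOn 𝓘(ℝ, V) 𝓘(ℝ, V) ∞ e e.source)
    (he' : ContMDiffOn 𝓘(ℝ, V) 𝓘(ℝ, V) ∞ e.symm e.target) {p : N} (hp : p ∈ e.source)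
    (hα : DifferentiableAt ℝ (formRep α e) (e p)) :
    extD α p = (extDeriv (formRep α e) (e p)).compContinuousLinearMap (tmap (V' := V) e p) := by
  set f := chartAt V p
  have hf : ContMDiffOn 𝓘(ℝ, V) 𝓘(ℝ, V) ∞ f f.source := contMDiffOn_chart
  have hf' : ContMDiffOn 𝓘(ℝ, V) 𝓘(ℝ, V) ∞ f.symm f.target := contMDiffOn_chart_symm
  have hpf : p ∈ f.source := mem_chart_source _ _
  have hinv : f.symm (f p) = p := f.left_inv hpf
  have hm : (f.symm.trans e).source ∈ 𝓝 (f p) := by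
    refine (f.symm.trans e).open_source.mem_nhds ?_
    rw [OpenPartialHomeomorph.trans_source]
    exact ⟨f.map_source hpf, by rw [mem_preimage, hinv]; exact hp⟩
  have hτ : ContDiffOn ℝ ∞ (fun y => e (f.symm y)) (f.symm.trans e).source := by
    rw [← contMDiffOn_iff_contDiffOn, OpenPartialHomeomorph.trans_source]
    exact he.comp (hf'.mono fun z hz => hz.1) fun z hz => hz.2
  have hd : ∀ y ∈ (f.symm.trans e).source, DifferentiableAt ℝ (fun y => e (f.symm y)) y :=
    fun y hy => ((hτ.contDiffAt ((f.symm.trans e).open_source.mem_nhds hy)).differentiableAt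
      (by simp))
  have hde : ∀ x ∈ e.source, MDifferentiableAt 𝓘(ℝ, V) 𝓘(ℝ, V) e x := fun x hx =>
    (he.contMDiffAt (e.open_source.mem_nhds hx)).mdifferentiableAt (by simp)
  have hde' : ∀ y ∈ e.target, MDifferentiableAt 𝓘(ℝ, V) 𝓘(ℝ, V) e.symm y := fun y hy =>
    (he'.contMDiffAt (e.open_target.mem_nhds hy)).mdifferentiableAt (by simp)
  have hdf : MDifferentiableAt 𝓘(ℝ, V) 𝓘(ℝ, V) f p :=
    (hf.contMDiffAt (f.open_source.mem_nhds hpf)).mdifferentiableAt (by simp)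
  -- the two representatives are related by the change of coordinates
  have h1 : chartRep α p =ᶠ[𝓝 (f p)] fun y =>
      (formRep α e (e (f.symm y))).compContinuousLinearMap
        (fderiv ℝ (fun y => e (f.symm y)) y) := by
    filter_upwards [hm] with y hy
    have hy' := hy
    rw [OpenPartialHomeomorph.trans_source] at hy'
    have h2 := tmap_comp (g := e.symm) (f := fun y => e (f.symm y)) (p := y)
      (hde' _ (e.map_source hy'.2)) (hd y hy).mdifferentiableAt
    rw [tmap_eq_fderiv] at h2
    have h3 : (tmap f.symm y : V →L[ℝ] V) = tmap (fun y => e.symm (e (f.symm y))) y := by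
      refine tmap_congr ?_
      filter_upwards [(f.symm.trans e).open_source.mem_nhds hy] with z hz
      rw [OpenPartialHomeomorph.trans_source] at hz
      exact (e.left_inv hz.2).symm
    have h4 : e.symm (e (f.symm y)) = f.symm y := e.left_inv hy'.2
    rw [formRep, h4]
    change (α (f.symm y)).compContinuousLinearMap (tmap (V := V) f.symm y) = _
    rw [h3, h2]
    rfl
  have h5 : e (f.symm (f p)) = e p := congrArg e hinv
  rw [extD, h1.extDeriv_eq, extDeriv_pullback (r := ∞) (f := fun y => e (f.symm y))
    (by rw [h5]; exact hα) (hτ.contDiffAt hm)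
    (by rw [minSmoothness_of_isRCLikeNormedField]; exact WithTop.coe_le_coe.2 le_top), h5]
  have h6 := tmap_comp (g := fun y => e (f.symm y)) (f := f) (p := p)
    (hd _ (mem_of_mem_nhds hm)).mdifferentiableAt hdf
  rw [tmap_eq_fderiv] at h6
  have h7 : (tmap e p : V →L[ℝ] V) = tmap (fun x => e (f.symm (f x))) p := by
    refine tmap_congr ?_
    filter_upwards [f.open_source.mem_nhds hpf] with z hz
    rw [f.left_inv hz]
  rw [h7, h6]
  rfl

end ExteriorDerivative

/-! ### The Cartan form in coordinates -/

-- Shortcut instances, whose synthesis for these iterated products is slow.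

instance (k n : ℕ) : ContinuousSMul ℝ (FModel n →L[ℝ] BModel k) := IsBoundedSMul.continuousSMul

instance (k n : ℕ) : ContinuousSMul ℝ (JModel k n) := IsBoundedSMul.continuousSMul

instance (k n : ℕ) : ContinuousSMul ℝ (WModel k n) := IsBoundedSMul.continuousSMul

instance (k n : ℕ) : CompleteSpace (WModel k n) := FiniteDimensional.complete ℝ _

section Naturality

variable {T T' G G' B B' : Type*} [NormedAddCommGroup T] [NormedSpace ℝ T] [NormedAddCommGroup T']
  [NormedSpace ℝ T'] [NormedAddCommGroup G] [NormedSpace ℝ G] [NormedAddCommGroup G']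
  [NormedSpace ℝ G'] [NormedAddCommGroup B] [NormedSpace ℝ B] [NormedAddCommGroup B']
  [NormedSpace ℝ B'] {k : ℕ}

/-- Naturality of `multiplierForm` under a map `A` that covers the map `S` of the bases. -/
theorem multiplierForm_comp_of_comp_eq (μ : B [⋀^Fin (k + 1)]→L[ℝ] ℝ) {b : T →L[ℝ] B}
    {θ : T →L[ℝ] G} {S : B' →L[ℝ] B} {q : G →L[ℝ] G'} (p : G' →L[ℝ] B') {A : T' →L[ℝ] T}
    {b' : T' →L[ℝ] B'} {θ' : T' →L[ℝ] G'} (hb : ∀ v, b (A v) = S (b' v))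
    (hθ : ∀ v, q (θ (A v)) = θ' v) :
    (multiplierForm μ b θ (S.comp (p.comp q))).compContinuousLinearMap A =
      multiplierForm (μ.compContinuousLinearMap S) b' θ' p := by
  ext v
  rw [ContinuousAlternatingMap.compContinuousLinearMap_apply, multiplierForm_apply,
    multiplierForm_apply]
  refine Finset.sum_congr rfl fun i _ => ?_
  rw [ContinuousAlternatingMap.compContinuousLinearMap_apply]
  congr 2
  ext l
  refine Fin.cases ?_ (fun l => ?_) l
  · simp [Matrix.vecCons, hθ]
  · simp [Matrix.vecCons, Fin.removeNth, hb]

theorem smul_add_compContinuousLinearMap (a : ℝ) (f g : B [⋀^Fin k]→L[ℝ] ℝ) (S : B' →L[ℝ] B) :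
    (a • f + g).compContinuousLinearMap S =
      a • f.compContinuousLinearMap S + g.compContinuousLinearMap S := rfl

end Naturality

section Cartan

variable {k n : ℕ} {M E Q : Type*} [TopologicalSpace M] [ChartedSpace (BModel k) M]
  [TopologicalSpace E] [ChartedSpace (BModel k × FModel n) E] [TopologicalSpace Q]
  [ChartedSpace (FModel n) Q] {P : SmoothFibreBundle k n M E Q}
  [IsManifold 𝓘(ℝ, BModel k) ∞ M] [IsManifold 𝓘(ℝ, FModel n) ∞ Q]

theorem mdiff_jetChart_symm (c : FibredChart P) (j₀ : Jet1 P) {z : JModel k n}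
    (hz : z.1 ∈ c.total.target) :
    MDifferentiableAt 𝓘(ℝ, JModel k n) 𝓘(ℝ, JModel k n) (jetChart c j₀).symm z := by
  obtain ⟨-, h2, -, h4⟩ := contMDiffOn_jetChart c j₀
  exact (h2.contMDiffAt (h4.mem_nhds hz)).mdifferentiableAt (by simp)

theorem jetChart_symm_pt (c : FibredChart P) (j₀ : Jet1 P) {z : JModel k n}
    (hz : z.1 ∈ c.total.target) : ((jetChart c j₀).symm z).pt = c.total.symm z.1 := by
  classical
  change (dite _ _ _ : Jet1 P).pt = _
  rw [dif_pos hz]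

/-- In coordinates, the projection of jets to `E` is `((x, u), u_x) ↦ (x, u)`. -/
theorem tmap_pt_comp (c : FibredChart P) (j : Jet1 P) (hj : j.pt ∈ c.total.source) (j₀ : Jet1 P) :
    (tmap Jet1.pt j : JModel k n →L[ℝ] BModel k × FModel n).comp
      (tmap (jetChart c j₀).symm (jetCoord c j) : JModel k n →L[ℝ] JModel k n) =
      (c.Ti j.pt).comp (ContinuousLinearMap.fst ℝ _ _) := by
  have hz : (jetCoord c j).1 ∈ c.total.target := c.total.map_source hj
  have hinv : (jetChart c j₀).symm (jetCoord c j) = j := (jetChart c j₀).left_inv hj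
  have h6 := tmap_comp (g := (Jet1.pt : Jet1 P → E)) (f := (jetChart c j₀).symm)
    (p := jetCoord c j) ((contMDiff_pt _).mdifferentiableAt (by simp)) (mdiff_jetChart_symm c j₀ hz)
  rw [hinv] at h6
  have h7 := tmap_comp (V := JModel k n) (V' := BModel k × FModel n) (g := c.total.symm)
    (f := (Prod.fst : JModel k n → BModel k × FModel n)) (p := jetCoord c j)
    (c.mdiff_total_symm hz) (mdifferentiableAt_iff_differentiableAt.2 differentiableAt_fst)
  rw [tmap_eq_fderiv, fderiv_fst] at h7
  refine (h6.symm.trans (tmap_congr ?_)).trans h7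
  filter_upwards [(isOpen_jetTarget c).mem_nhds hz] with z hz
  exact jetChart_symm_pt c j₀ hz

/-- In coordinates, the projection of jets to `M` is `((x, u), u_x) ↦ x`. -/
theorem tmap_base_comp (c : FibredChart P) (j : Jet1 P) (hj : j.pt ∈ c.total.source)
    (j₀ : Jet1 P) : (tmap Jet1.base j : JModel k n →L[ℝ] BModel k).comp
      (tmap (jetChart c j₀).symm (jetCoord c j) : JModel k n →L[ℝ] JModel k n) =
      (c.Si (P.proj j.pt)).comp
        ((ContinuousLinearMap.fst ℝ _ _).comp (ContinuousLinearMap.fst ℝ _ _)) := by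
  rw [tmap_base, ContinuousLinearMap.comp_assoc, tmap_pt_comp c j hj]
  refine ContinuousLinearMap.ext fun v => ?_
  have h1 := c.fst_T hj (c.Ti j.pt v.1)
  rw [c.T_Ti hj] at h1
  have h2 := congrArg (c.Si (P.proj j.pt)) h1
  rw [c.Si_S (c.proj_mem _ hj)] at h2
  exact h2.symm

/-- The contact form has coordinates `du - u_x dx`. -/
theorem snd_T_theta_comp (c : FibredChart P) (j : Jet1 P) (hj : j.pt ∈ c.total.source)
    (j₀ : Jet1 P) : ((ContinuousLinearMap.snd ℝ (BModel k) (FModel n)).comp (c.T j.pt)).comp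
      ((theta j).comp (tmap (jetChart c j₀).symm (jetCoord c j) : JModel k n →L[ℝ] JModel k n)) =
      (ContinuousLinearMap.snd ℝ _ _).comp (ContinuousLinearMap.fst ℝ _ _) -
        (jetCoord c j).2.comp
          ((ContinuousLinearMap.fst ℝ _ _).comp (ContinuousLinearMap.fst ℝ _ _)) := by
  rw [theta, ContinuousLinearMap.sub_comp, ContinuousLinearMap.comp_assoc, tmap_pt_comp c j hj,
    ContinuousLinearMap.comp_assoc, tmap_base_comp c j hj]
  refine ContinuousLinearMap.ext fun v => ?_
  change (c.T j.pt (c.Ti j.pt v.1 - j.lin (c.Si (P.proj j.pt) v.1.1))).2 = _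
  rw [map_sub, c.T_Ti hj]
  rfl

variable {η : VolumeForm k M} {L : Jet1 P → ℝ}

/-- The fibred chart `((x, u, u_x), p)` of `W` as a partial homeomorphism. -/
def cartanHomeo (c : FibredChart P) (w₀ : CartanBundle P η L) :
    OpenPartialHomeomorph (CartanBundle P η L) (WModel k n) :=
  (cartanAtlas P η L).toCore.openPartialHomeomorph (cartanChart c w₀) ⟨c, w₀, rfl⟩

theorem contMDiffOn_cartanHomeo (c : FibredChart P) (w₀ : CartanBundle P η L) :
    ContMDiffOn 𝓘(ℝ, WModel k n) 𝓘(ℝ, WModel k n) ∞ (cartanHomeo c w₀) (cartanHomeo c w₀).source ∧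
    ContMDiffOn 𝓘(ℝ, WModel k n) 𝓘(ℝ, WModel k n) ∞ (cartanHomeo c w₀).symm
      (cartanHomeo c w₀).target := by
  have h : cartanHomeo c w₀ ∈ atlas (WModel k n) (CartanBundle P η L) :=
    Set.mem_iUnion₂.2 ⟨cartanChart c w₀, ⟨c, w₀, rfl⟩, rfl⟩
  have h' := IsManifold.subset_maximalAtlas (I := 𝓘(ℝ, WModel k n)) (n := ∞) h
  exact ⟨contMDiffOn_of_mem_maximalAtlas h', contMDiffOn_symm_of_mem_maximalAtlas h'⟩

theorem isOpen_cartanTarget (c : FibredChart P) :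
    IsOpen {z : WModel k n | z.1.1 ∈ c.total.target} :=
  c.total.open_target.preimage (continuous_fst.comp continuous_fst)

theorem cartanHomeo_symm_jet (c : FibredChart P) (w₀ : CartanBundle P η L) {z : WModel k n}
    (hz : z.1.1 ∈ c.total.target) :
    ((cartanHomeo c w₀).symm z).jet = (jetChart c w₀.jet).symm z.1 :=
  cartanChart_symm_jet c w₀ hz

variable (η L) in
theorem contMDiff_jet : ContMDiff 𝓘(ℝ, WModel k n) 𝓘(ℝ, JModel k n) ∞
    (CartanBundle.jet : CartanBundle P η L → Jet1 P) := by
  intro w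
  obtain ⟨c, hc⟩ := exists_fibredChart P w.jet.pt
  obtain ⟨h1, -⟩ := contMDiffOn_cartanHomeo c w
  obtain ⟨-, h2, -, h4⟩ := contMDiffOn_jetChart c w.jet
  have h3 : (cartanHomeo c w).source ∈ 𝓝 w := (cartanHomeo c w).open_source.mem_nhds hc
  have h5 : ContMDiffOn 𝓘(ℝ, WModel k n) 𝓘(ℝ, JModel k n) ∞
      (Prod.fst : WModel k n → JModel k n) (cartanHomeo c w).target :=
    (contMDiff_iff_contDiff.2 contDiff_fst).contMDiffOn
  have h6 := h2.comp (h5.comp h1 fun x hx => (cartanHomeo c w).map_source hx)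
    fun x hx => c.total.map_source hx
  refine (h6.contMDiffAt h3).congr_of_eventuallyEq ?_
  filter_upwards [h3] with x hx
  exact ((jetChart c w.jet).left_inv hx).symm

/-- In coordinates, the projection `W → J¹π` is `((x, u, u_x), p) ↦ (x, u, u_x)`. -/
theorem tmap_jet_comp (c : FibredChart P) (w w₀ : CartanBundle P η L)
    (hw : w.jet.pt ∈ c.total.source) :
    (tmap CartanBundle.jet w : WModel k n →L[ℝ] JModel k n).comp
      (tmap (cartanHomeo c w₀).symm (cartanCoord c w) : WModel k n →L[ℝ] WModel k n) =
      (tmap (jetChart c w₀.jet).symm (jetCoord c w.jet) : JModel k n →L[ℝ] JModel k n).comp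
        (ContinuousLinearMap.fst ℝ _ _) := by
  have hz : (cartanCoord c w).1.1 ∈ c.total.target := c.total.map_source hw
  have hinv : (cartanHomeo c w₀).symm (cartanCoord c w) = w := (cartanHomeo c w₀).left_inv hw
  have h6 := tmap_comp (g := (CartanBundle.jet : CartanBundle P η L → Jet1 P))
    (f := (cartanHomeo c w₀).symm) (p := cartanCoord c w)
    ((contMDiff_jet η L _).mdifferentiableAt (by simp))
    (((contMDiffOn_cartanHomeo c w₀).2.contMDiffAt
      ((cartanHomeo c w₀).open_target.mem_nhds hz)).mdifferentiableAt (by simp))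
  rw [hinv] at h6
  have h7 := tmap_comp (V := WModel k n) (V' := JModel k n) (g := (jetChart c w₀.jet).symm)
    (f := (Prod.fst : WModel k n → JModel k n)) (p := cartanCoord c w)
    (mdiff_jetChart_symm c w₀.jet hz)
    (mdifferentiableAt_iff_differentiableAt.2 differentiableAt_fst)
  rw [tmap_eq_fderiv, fderiv_fst] at h7
  refine (h6.symm.trans (tmap_congr ?_)).trans h7
  filter_upwards [(isOpen_cartanTarget c).mem_nhds hz] with z hz
  exact cartanHomeo_symm_jet c w₀ hz

variable (k n) in
/-- The differential `dx` of the base coordinates of `W`. -/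
abbrev dxW : WModel k n →L[ℝ] BModel k :=
  (ContinuousLinearMap.fst ℝ _ _).comp
    ((ContinuousLinearMap.fst ℝ _ _).comp (ContinuousLinearMap.fst ℝ _ _))

variable (k n) in
/-- The differential `du` of the fibre coordinates of `E`, on `W`. -/
abbrev duW : WModel k n →L[ℝ] FModel n :=
  (ContinuousLinearMap.snd ℝ _ _).comp
    ((ContinuousLinearMap.fst ℝ _ _).comp (ContinuousLinearMap.fst ℝ _ _))

/-- The Cartan form `ℓ μ + p (du - u_x dx) ⌟ μ` in the coordinates `((x, u, u_x), p)`, where `μ` is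
a volume form in the coordinates `x` and `ℓ` a Lagrangian in the coordinates `(x, u, u_x)`. -/
def localCartan (μ : BModel k → BModel k [⋀^Fin (k + 1)]→L[ℝ] ℝ) (ℓ : JModel k n → ℝ)
    (z : WModel k n) : WModel k n [⋀^Fin (k + 1)]→L[ℝ] ℝ :=
  ℓ z.1 • (μ z.1.1.1).compContinuousLinearMap (dxW k n) +
    multiplierForm (μ z.1.1.1) (dxW k n) (duW k n - z.1.2.comp (dxW k n)) z.2

/-- The volume form, in the coordinates of `W`. -/
theorem pullback_base_comp (η : VolumeForm k M) (c : FibredChart P) (j j₀ : Jet1 P)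
    (hj : j.pt ∈ c.total.source) :
    (pullback Jet1.base η.form j).compContinuousLinearMap
      ((tmap (jetChart c j₀).symm (jetCoord c j) : JModel k n →L[ℝ] JModel k n).comp
        (ContinuousLinearMap.fst ℝ (JModel k n) (FModel n →L[ℝ] BModel k))) =
      ((η.form j.base).compContinuousLinearMap
        (c.Si (P.proj j.pt))).compContinuousLinearMap (dxW k n) := by
  have e : ((tmap Jet1.base j : JModel k n →L[ℝ] BModel k).comp
      (tmap (jetChart c j₀).symm (jetCoord c j) : JModel k n →L[ℝ] JModel k n)).comp
      (ContinuousLinearMap.fst ℝ (JModel k n) (FModel n →L[ℝ] BModel k)) =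
      (c.Si (P.proj j.pt)).comp (dxW k n) := by
    rw [tmap_base_comp c j hj]; rfl
  exact congrArg (η.form j.base).compContinuousLinearMap e

/-- The element of the contact subbundle with multipliers `p`, in the coordinates of `W`. -/
theorem multForm_comp (η : VolumeForm k M) (c : FibredChart P) (j j₀ : Jet1 P)
    (hj : j.pt ∈ c.total.source) (p : FModel n →L[ℝ] BModel k) :
    (multForm η c j p).compContinuousLinearMap
      ((tmap (jetChart c j₀).symm (jetCoord c j) : JModel k n →L[ℝ] JModel k n).comp
        (ContinuousLinearMap.fst ℝ (JModel k n) (FModel n →L[ℝ] BModel k))) =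
      multiplierForm ((η.form j.base).compContinuousLinearMap (c.Si (P.proj j.pt)))
        (dxW k n) (duW k n - (jetCoord c j).2.comp (dxW k n)) p := by
  exact multiplierForm_comp_of_comp_eq (η.form j.base) p
    (fun v => congrArg (fun f => f v.1) (tmap_base_comp c j hj j₀))
    (fun v => congrArg (fun f => f v.1) (snd_T_theta_comp c j hj j₀))

/-- The Cartan form of `W`, in a fibred chart. -/
theorem formRep_cartanForm (c : FibredChart P) (w₀ : CartanBundle P η L) {z : WModel k n}
    (hz : z.1.1 ∈ c.total.target) :
    formRep (cartanForm P η L) (cartanHomeo c w₀) z =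
      localCartan (formRep η.form c.base) (lagCoord L c) z := by
  set w := (cartanHomeo c w₀).symm z with hw
  have hwc : w.jet.pt ∈ c.total.source := (cartanHomeo c w₀).map_target hz
  have hz' : cartanCoord c w = z := (cartanHomeo c w₀).right_inv hz
  have hj : jetCoord c w.jet = z.1 := congrArg Prod.fst hz'
  have hp : multCoord c w = z.2 := congrArg Prod.snd hz'
  have hx : z.1.1.1 = c.base (P.proj w.jet.pt) := by
    rw [← c.fst_total _ hwc, ← hj]; rfl
  have hform : w.form = L w.jet • pullback Jet1.base η.form w.jet + multForm η c w.jet z.2 := by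
    rw [← hp, multForm_multCoord c w hwc, alt_add_sub']
  have hlag : lagCoord L c z.1 = L w.jet := by rw [← hj]; exact lagCoord_jetCoord L c hwc
  have h1 : formRep (cartanForm P η L) (cartanHomeo c w₀) z = w.form.compContinuousLinearMap
      ((tmap CartanBundle.jet w : WModel k n →L[ℝ] JModel k n).comp
      (tmap (cartanHomeo c w₀).symm (cartanCoord c w) : WModel k n →L[ℝ] WModel k n)) := by
    rw [hz']; rfl
  have hom : formRep η.form c.base z.1.1.1 =
      (η.form w.jet.base).compContinuousLinearMap (c.Si (P.proj w.jet.pt)) := by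
    rw [formRep, hx, c.base.left_inv (c.proj_mem _ hwc)]; rfl
  rw [h1, tmap_jet_comp c w w₀ hwc, hform, smul_add_compContinuousLinearMap,
    multForm_comp η c w.jet w₀.jet hwc, pullback_base_comp η c w.jet w₀.jet hwc, hj, localCartan,
    hom, hlag]

end Cartan

/-! ### The exterior derivative of the Cartan form in coordinates -/

theorem differentiableAt_smul_add_multiplierForm {V T G B : Type*} [NormedAddCommGroup V]
    [NormedSpace ℝ V] [NormedAddCommGroup T] [NormedSpace ℝ T]
    [NormedAddCommGroup G] [NormedSpace ℝ G]
    [NormedAddCommGroup B] [NormedSpace ℝ B] {k : ℕ} {μ : V → B [⋀^Fin (k + 1)]→L[ℝ] ℝ}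
    {θ : V → T →L[ℝ] G} {Φ : V → G →L[ℝ] B} {a : V → ℝ} {z : V} (ha : DifferentiableAt ℝ a z)
    (hμ : DifferentiableAt ℝ μ z) (b : T →L[ℝ] B)
    (hθ : DifferentiableAt ℝ θ z) (hΦ : DifferentiableAt ℝ Φ z) :
    DifferentiableAt ℝ (fun z => a z • (μ z).compContinuousLinearMap b +
      multiplierForm (μ z) b (θ z) (Φ z)) z := by
  have h1 : DifferentiableAt ℝ (fun z => (μ z).curryLeft) z :=
    DifferentiableAt.fun_comp' (𝕜 := ℝ) z
      (g := ⇑(ContinuousAlternatingMap.curryLeftLI (𝕜 := ℝ) (E := B) (F := ℝ)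
        (n := k)).toContinuousLinearMap) (ContinuousLinearMap.differentiableAt _) hμ
  have h2 : DifferentiableAt ℝ (fun z => (μ z).curryLeft.comp ((Φ z).comp (θ z))) z :=
    h1.clm_comp (hΦ.clm_comp hθ)
  have h3 : DifferentiableAt ℝ (fun z =>
      (ContinuousAlternatingMap.compContinuousLinearMapCLM (𝕜 := ℝ) (F := ℝ) (ι := Fin k) b).comp
        ((μ z).curryLeft.comp ((Φ z).comp (θ z)))) z :=
    (differentiableAt_const _).clm_comp h2
  have h4 : DifferentiableAt ℝ (fun z => multiplierForm (μ z) b (θ z) (Φ z)) z :=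
    (ContinuousAlternatingMap.alternatizeUncurryFinCLM ℝ T ℝ
      (n := k)).differentiableAt.fun_comp' z h3
  exact (ha.fun_smul (hμ.continuousAlternatingMapCompContinuousLinearMap
    (differentiableAt_const b))).fun_add h4

section LocalCartan

variable {k n : ℕ}

theorem map_cons_removeNth_single (f : BModel k [⋀^Fin (k + 1)]→L[ℝ] ℝ) (x : BModel k)
    (i : Fin (k + 1)) {v : Fin (k + 1) → BModel k}
    (hv : ∀ i, v i = EuclideanSpace.single i (1 : ℝ)) :
    f (Matrix.vecCons x (i.removeNth v)) =
      (-1) ^ (i : ℕ) * (x i * f fun i => EuclideanSpace.single i (1 : ℝ)) := by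
  rw [map_cons_removeNth, map_update_basis f
    (e := (EuclideanSpace.basisFun (Fin (k + 1)) ℝ).toBasis) (fun i => by simp [hv]) x i,
    funext hv]
  simp

/-- The value of the Cartan form on vectors that project to the standard basis of the base. -/
theorem localCartan_apply (μ : BModel k → BModel k [⋀^Fin (k + 1)]→L[ℝ] ℝ) (ℓ : JModel k n → ℝ)
    (z : WModel k n) {γ : Fin (k + 1) → WModel k n}
    (hγ : ∀ i, (γ i).1.1.1 = EuclideanSpace.single i (1 : ℝ)) :
    localCartan μ ℓ z γ = (μ z.1.1.1 fun i => EuclideanSpace.single i (1 : ℝ)) *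
      (ℓ z.1 + ∑ i, (z.2 ((γ i).1.1.2 - z.1.2 (EuclideanSpace.single i (1 : ℝ)))) i) := by
  rw [localCartan, ContinuousAlternatingMap.add_apply, ContinuousAlternatingMap.smul_apply,
    multiplierForm_apply, ContinuousAlternatingMap.compContinuousLinearMap_apply]
  have h1 : (dxW k n ∘ γ) = fun i => EuclideanSpace.single i (1 : ℝ) := funext hγ
  rw [h1, mul_add, smul_eq_mul, mul_comm, Finset.mul_sum]
  congr 1
  refine Finset.sum_congr rfl fun i _ => ?_
  have h2 := map_cons_removeNth_single (μ z.1.1.1)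
    (z.2 ((duW k n - z.1.2.comp (dxW k n)) (γ i))) i (v := fun l => (γ l).1.1.1) hγ
  have h3 : (fun l => dxW k n (i.removeNth γ l)) = i.removeNth fun l => (γ l).1.1.1 := rfl
  have h4 : (duW k n - z.1.2.comp (dxW k n)) (γ i) =
      (γ i).1.1.2 - z.1.2 (EuclideanSpace.single i (1 : ℝ)) := by
    rw [← hγ i]; rfl
  rw [h3, h2, h4, ← mul_assoc, ← mul_pow]
  simp [mul_comm]

/-- The value of the Cartan form on such vectors, one of which is replaced by a vertical vector `X`:
the multipliers applied to the component `X_u`. -/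
theorem localCartan_cons_apply (μ : BModel k → BModel k [⋀^Fin (k + 1)]→L[ℝ] ℝ)
    (ℓ : JModel k n → ℝ) (z : WModel k n) {γ : Fin (k + 1) → WModel k n}
    (hγ : ∀ i, (γ i).1.1.1 = EuclideanSpace.single i (1 : ℝ)) {X : WModel k n} (hX : X.1.1.1 = 0)
    (j : Fin (k + 1)) :
    localCartan μ ℓ z (Matrix.vecCons X (j.removeNth γ)) =
      (-1) ^ (j : ℕ) *
        ((μ z.1.1.1 fun i => EuclideanSpace.single i (1 : ℝ)) * (z.2 X.1.1.2) j) := by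
  rw [localCartan, ContinuousAlternatingMap.add_apply, ContinuousAlternatingMap.smul_apply,
    multiplierForm_apply, ContinuousAlternatingMap.compContinuousLinearMap_apply,
    Fin.sum_univ_succ, Finset.sum_eq_zero, ContinuousAlternatingMap.map_coord_zero _ 0]
  · have h2 := map_cons_removeNth_single (μ z.1.1.1)
      (z.2 X.1.1.2) j (v := fun l => (γ l).1.1.1) hγ
    have h4 : (duW k n - z.1.2.comp (dxW k n)) X = X.1.1.2 := by
      change X.1.1.2 - z.1.2 X.1.1.1 = _
      rw [hX, map_zero, sub_zero]
    have h3 : (fun l => dxW k n ((Fin.removeNth 0 (Matrix.vecCons X (j.removeNth γ) :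
        Fin (k + 1) → WModel k n)) l)) = j.removeNth fun l => (γ l).1.1.1 := by
      ext1 l
      simp [Fin.removeNth]
    rw [h3, Matrix.cons_val_zero, h4, h2]
    simp [mul_comm]
  · exact hX
  · intro i _
    obtain ⟨l, hl⟩ := Fin.exists_succAbove_eq (Fin.succ_ne_zero i).symm
    rw [ContinuousAlternatingMap.map_coord_zero _ l.succ, mul_zero]
    change dxW k n ((Matrix.vecCons X (j.removeNth γ) : Fin (k + 1) → WModel k n)
      (i.succ.succAbove l)) = 0
    rw [hl]
    exact hX

theorem differentiableAt_localCartan {μ : BModel k → BModel k [⋀^Fin (k + 1)]→L[ℝ] ℝ}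
    {ℓ : JModel k n → ℝ} {z : WModel k n} (hμ : DifferentiableAt ℝ μ z.1.1.1)
    (hℓ : DifferentiableAt ℝ ℓ z.1) : DifferentiableAt ℝ (localCartan μ ℓ) z := by
  have h1 : DifferentiableAt ℝ (fun z : WModel k n => μ z.1.1.1) z :=
    DifferentiableAt.fun_comp' z (g := μ) (f := fun z : WModel k n => z.1.1.1) hμ (by fun_prop)
  have h2 : DifferentiableAt ℝ (fun z : WModel k n => ℓ z.1) z :=
    DifferentiableAt.fun_comp' z (g := ℓ) (f := fun z : WModel k n => z.1) hℓ (by fun_prop)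
  exact differentiableAt_smul_add_multiplierForm h2 h1 (dxW k n)
    (θ := fun z : WModel k n => duW k n - z.1.2.comp (dxW k n)) (Φ := fun z : WModel k n => z.2)
    (by fun_prop) (by fun_prop)

/-- The contraction of the exterior derivative of the Cartan form with a vertical vector, evaluated
on the tangent vectors of a section of `W → M` with coordinates `g`. By the formula for the exterior
derivative with constant arguments, only the values of the Cartan form on the tangent vectors, and
on `X` and all but one of them, have to be differentiated. -/
theorem extDeriv_localCartan {μ : BModel k → BModel k [⋀^Fin (k + 1)]→L[ℝ] ℝ}
    {ℓ : JModel k n → ℝ} {g : BModel k → WModel k n} {y : BModel k} (hg : DifferentiableAt ℝ g y)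
    (hgy : ∀ᶠ y' in 𝓝 y, (g y').1.1.1 = y') (hμ : DifferentiableAt ℝ μ y)
    (hℓ : DifferentiableAt ℝ ℓ (g y).1) {X : WModel k n} (hX : X.1.1.1 = 0) :
    extDeriv (localCartan μ ℓ) (g y) (Matrix.vecCons X fun i =>
        fderiv ℝ g y (EuclideanSpace.single i (1 : ℝ))) =
      (μ y fun i => EuclideanSpace.single i (1 : ℝ)) * (fderiv ℝ ℓ (g y).1 X.1 +
        ∑ i, (X.2 (fderiv ℝ (fun y => (g y).1.1.2) y (EuclideanSpace.single i (1 : ℝ)) -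
          (g y).1.2 (EuclideanSpace.single i (1 : ℝ))) -
            (g y).2 (X.1.2 (EuclideanSpace.single i (1 : ℝ)))) i) -
      ∑ j, fderiv ℝ (fun y => (μ y fun i => EuclideanSpace.single i (1 : ℝ)) *
        ((g y).2 X.1.1.2) j) y (EuclideanSpace.single j (1 : ℝ)) := by
  set r : BModel k → ℝ := fun y => μ y fun i => EuclideanSpace.single i (1 : ℝ) with hr
  set γ : Fin (k + 1) → WModel k n := fun i => fderiv ℝ g y (EuclideanSpace.single i (1 : ℝ))
    with hγ
  have hy : (g y).1.1.1 = y := hgy.self_of_nhds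
  have hrd : DifferentiableAt ℝ r y := by
    exact hμ.continuousAlternatingMap_apply fun i => differentiableAt_const _
  have hγ1 : ∀ i, (γ i).1.1.1 = EuclideanSpace.single i (1 : ℝ) := by
    intro i
    have h1 : fderiv ℝ (fun y => (g y).1.1.1) y = ContinuousLinearMap.id ℝ _ := by
      rw [Filter.EventuallyEq.fderiv_eq (f := fun y => y) hgy]
      exact fderiv_fun_id
    have h2 : fderiv ℝ (fun y => (g y).1.1.1) y = (dxW k n).comp (fderiv ℝ g y) :=
      ((dxW k n).hasFDerivAt.comp y hg.hasFDerivAt).fderiv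
    exact congrArg (fun f => f (EuclideanSpace.single i (1 : ℝ))) (h2.symm.trans h1)
  have hγ2 : ∀ i, (γ i).1.1.2 =
      fderiv ℝ (fun y => (g y).1.1.2) y (EuclideanSpace.single i (1 : ℝ)) := by
    intro i
    have h2 : fderiv ℝ (fun y => (g y).1.1.2) y = (duW k n).comp (fderiv ℝ g y) :=
      ((duW k n).hasFDerivAt.comp y hg.hasFDerivAt).fderiv
    rw [h2]; rfl
  have hcar : DifferentiableAt ℝ (localCartan μ ℓ) (g y) :=
    differentiableAt_localCartan (by rw [hy]; exact hμ) hℓ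
  have hcar' : ∀ v : Fin (k + 1) → WModel k n,
      DifferentiableAt ℝ (fun z => localCartan μ ℓ z v) (g y) := fun v =>
    hcar.continuousAlternatingMap_apply fun i => differentiableAt_const _
  rw [extDeriv_apply hcar, Fin.sum_univ_succ]
  -- the derivative in the direction of `X` of the values on the tangent vectors of the section
  have hfirst : fderiv ℝ (fun z => localCartan μ ℓ z γ) (g y) X =
      r y * (fderiv ℝ ℓ (g y).1 X.1 +
        ∑ i, (X.2 ((γ i).1.1.2 - (g y).1.2 (EuclideanSpace.single i (1 : ℝ))) -
            (g y).2 (X.1.2 (EuclideanSpace.single i (1 : ℝ)))) i) := by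
    have h1 := (hcar' γ).hasFDerivAt.hasLineDerivAt X
    rw [HasLineDerivAt] at h1
    refine h1.unique ?_
    have h2 : HasDerivAt (fun t : ℝ => ℓ ((g y).1 + t • X.1)) (fderiv ℝ ℓ (g y).1 X.1) 0 :=
      hℓ.hasFDerivAt.hasLineDerivAt X.1
    -- along the line `g y + t X`, the values are quadratic in `t`
    have h3 : ∀ a b d : ℝ, HasDerivAt (fun t : ℝ => a + t * b - t * t * d) b 0 := by
      intro a b d
      have h := (((hasDerivAt_id (0 : ℝ)).mul_const b).const_add a).sub
        (((hasDerivAt_id (0 : ℝ)).mul (hasDerivAt_id (0 : ℝ))).mul_const d)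
      exact (h.congr_deriv (by simp)).congr_of_eventuallyEq (Eventually.of_forall fun t => by simp)
    have h4 := (h2.add (HasDerivAt.fun_sum fun i (_ : i ∈ Finset.univ) => h3
      (((g y).2 ((γ i).1.1.2 - (g y).1.2 (EuclideanSpace.single i (1 : ℝ)))) i)
      ((X.2 ((γ i).1.1.2 - (g y).1.2 (EuclideanSpace.single i (1 : ℝ))) -
            (g y).2 (X.1.2 (EuclideanSpace.single i (1 : ℝ)))) i)
      ((X.2 (X.1.2 (EuclideanSpace.single i (1 : ℝ)))) i))).const_mul (r y)
    refine h4.congr_of_eventuallyEq (Eventually.of_forall fun t => ?_)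
    change localCartan μ ℓ (g y + t • X) γ = _
    have h5 : (g y + t • X).1.1.1 = y := by
      change (g y).1.1.1 + t • X.1.1.1 = y
      rw [hX, smul_zero, add_zero, hy]
    rw [localCartan_apply μ ℓ _ hγ1, h5]
    change r y * (ℓ ((g y).1 + t • X.1) + _) = r y * (ℓ ((g y).1 + t • X.1) + _)
    congr 2
    refine Finset.sum_congr rfl fun i _ => ?_
    change (((g y).2 + t • X.2) ((γ i).1.1.2 - ((g y).1.2 + t • X.1.2)
      (EuclideanSpace.single i (1 : ℝ)))) i = _
    simp only [add_apply, smul_apply, map_sub, map_add, map_smul,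
      PiLp.add_apply, PiLp.sub_apply, PiLp.smul_apply, smul_eq_mul]
    ring
  -- the derivatives along the section of the values on `X` and the other tangent vectors
  have hrest : ∀ j : Fin (k + 1), fderiv ℝ (fun z => localCartan μ ℓ z
      (Matrix.vecCons X (j.removeNth γ))) (g y) (γ j) =
      (-1) ^ (j : ℕ) * fderiv ℝ (fun y => r y * ((g y).2 X.1.1.2) j) y
        (EuclideanSpace.single j (1 : ℝ)) := by
    intro j
    have h1 : (fun z => localCartan μ ℓ z (Matrix.vecCons X (j.removeNth γ))) = fun z =>
      (-1) ^ (j : ℕ) * (r z.1.1.1 * (z.2 X.1.1.2) j) :=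
      funext fun z => localCartan_cons_apply μ ℓ z hγ1 hX j
    have h2 := ((hcar' (Matrix.vecCons X (j.removeNth γ))).hasFDerivAt.comp y
      hg.hasFDerivAt).const_smul ((-1 : ℝ) ^ (j : ℕ))
    have h : ((-1 : ℝ)) ^ (j : ℕ) * (-1) ^ (j : ℕ) = 1 := by rw [← mul_pow]; simp
    have h3 : (fun y => r y * ((g y).2 X.1.1.2) j) =ᶠ[𝓝 y] (-1 : ℝ) ^ (j : ℕ) •
        ((fun z => localCartan μ ℓ z (Matrix.vecCons X (j.removeNth γ))) ∘ g) := by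
      rw [h1]
      filter_upwards [hgy] with y' hy'
      simp only [Pi.smul_apply, Function.comp_apply, hy', smul_eq_mul, ← mul_assoc, h, one_mul]
    rw [h3.fderiv_eq, h2.fderiv, smul_apply, smul_eq_mul, ← mul_assoc, h, one_mul]
    rfl
  have h0 : (Fin.removeNth 0 (Matrix.vecCons X γ : Fin (k + 2) → WModel k n)) = γ := by
    ext1 l; simp [Fin.removeNth]
  have hs : ∀ j : Fin (k + 1), (j.succ.removeNth (Matrix.vecCons X γ :
      Fin (k + 2) → WModel k n)) = Matrix.vecCons X (j.removeNth γ) := by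
    intro j
    ext1 l
    refine Fin.cases ?_ (fun l => ?_) l <;> simp [Fin.removeNth]
  -- the signs `(-1) ^ (j + 1)` of the exterior derivative cancel those of the reordered arguments
  simp only [h0, hs, Matrix.cons_val_zero, Matrix.cons_val_succ, hfirst, hrest, hγ2]
  rw [sub_eq_add_neg, ← Finset.sum_neg_distrib]
  congr 1
  · simp [hr]
  · refine Finset.sum_congr rfl fun j _ => ?_
    have h : ((-1 : ℝ)) ^ (j : ℕ) * (-1) ^ (j : ℕ) = 1 := by rw [← mul_pow]; simp
    rw [zsmul_eq_mul, Fin.val_succ, pow_succ]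
    push_cast
    linear_combination (-fderiv ℝ (fun y => r y * ((g y).2 X.1.1.2) j) y
        (EuclideanSpace.single j (1 : ℝ))) * h

end LocalCartan

/-! ### Vector fields in coordinates -/

section Fields

variable {V N : Type*} [NormedAddCommGroup V] [NormedSpace ℝ V] [CompleteSpace V]
  [TopologicalSpace N] [ChartedSpace V N] [IsManifold 𝓘(ℝ, V) ∞ N]

/-- The vector field with constant coordinates `v` in the chart `e`, multiplied by the function `ψ`,
which is meant to be supported in the domain of the chart. -/
def coordField (e : OpenPartialHomeomorph N V) (ψ : N → ℝ) (v : V) (x : N) :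
    TangentSpace 𝓘(ℝ, V) x :=
  ψ x • VectorField.mpullback 𝓘(ℝ, V) 𝓘(ℝ, V) e (fun _ => v) x

variable {e : OpenPartialHomeomorph N V} {ψ : N → ℝ}

theorem mfderiv_isInvertible (he : ContMDiffOn 𝓘(ℝ, V) 𝓘(ℝ, V) ∞ e e.source)
    (he' : ContMDiffOn 𝓘(ℝ, V) 𝓘(ℝ, V) ∞ e.symm e.target) {x : N} (hx : x ∈ e.source) :
    (mfderiv 𝓘(ℝ, V) 𝓘(ℝ, V) e x).IsInvertible := by
  have h : e.MDifferentiable 𝓘(ℝ, V) 𝓘(ℝ, V) :=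
    ⟨he.mdifferentiableOn (by simp), he'.mdifferentiableOn (by simp)⟩
  exact ⟨h.mfderiv hx, rfl⟩

theorem tmap_coordField (he : ContMDiffOn 𝓘(ℝ, V) 𝓘(ℝ, V) ∞ e e.source)
    (he' : ContMDiffOn 𝓘(ℝ, V) 𝓘(ℝ, V) ∞ e.symm e.target) (v : V) {x : N} (hx : x ∈ e.source) :
    (tmap e x : V →L[ℝ] V) (coordField e ψ v x) = ψ x • v := by
  have h1 := (mfderiv_isInvertible he he' hx).self_apply_inverse v
  have h2 : (tmap e x : V →L[ℝ] V) (coordField e ψ v x) =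
    ψ x • (mfderiv 𝓘(ℝ, V) 𝓘(ℝ, V) e x) ((mfderiv 𝓘(ℝ, V) 𝓘(ℝ, V) e x).inverse v) :=
    map_smul (tmap e x : V →L[ℝ] V) _ _
  rw [h2]
  exact congrArg (fun w => ψ x • w) h1

theorem isSmoothField_coordField [IsManifold 𝓘(ℝ, V) 1 N]
    (he : ContMDiffOn 𝓘(ℝ, V) 𝓘(ℝ, V) ∞ e e.source)
    (he' : ContMDiffOn 𝓘(ℝ, V) 𝓘(ℝ, V) ∞ e.symm e.target)
    (hψ : ContMDiff 𝓘(ℝ, V) 𝓘(ℝ, ℝ) ∞ ψ) (hψe : tsupport ψ ⊆ e.source) (v : V) :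
    IsSmoothField (N := N) (coordField e ψ v) := by
  refine ContMDiffOn.smul_section_of_tsupport (V := fun x : N => TangentSpace 𝓘(ℝ, V) x)
    (s := VectorField.mpullback 𝓘(ℝ, V) 𝓘(ℝ, V) e (fun _ => v)) hψ.contMDiffOn
    e.open_source hψe ?_
  intro x hx
  have h1 : ContMDiffAt 𝓘(ℝ, V) 𝓘(ℝ, V).tangent ∞
      (fun y : V => (⟨y, v⟩ : TangentBundle 𝓘(ℝ, V) V)) (e x) :=
    contMDiffAt_vectorSpace_iff_contDiffAt.2 contDiffAt_const
  exact (ContMDiffAt.mpullback_vectorField_preimage (n := ∞) h1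
    (he.contMDiffAt (e.open_source.mem_nhds hx))
    (mfderiv_isInvertible he he' hx) (by simp)).contMDiffWithinAt

end Fields

section Vertical

variable {k n : ℕ} {M E Q : Type*} [TopologicalSpace M] [ChartedSpace (BModel k) M]
  [TopologicalSpace E] [ChartedSpace (BModel k × FModel n) E] [TopologicalSpace Q]
  [ChartedSpace (FModel n) Q] {P : SmoothFibreBundle k n M E Q}
  [IsManifold 𝓘(ℝ, BModel k) ∞ M] [IsManifold 𝓘(ℝ, FModel n) ∞ Q]
  {η : VolumeForm k M} {L : Jet1 P → ℝ}

theorem mdiff_cartanHomeo (c : FibredChart P) (w₀ w : CartanBundle P η L)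
    (hw : w.jet.pt ∈ c.total.source) :
    MDifferentiableAt 𝓘(ℝ, WModel k n) 𝓘(ℝ, WModel k n) (cartanHomeo c w₀) w :=
  ((contMDiffOn_cartanHomeo c w₀).1.contMDiffAt
    ((cartanHomeo c w₀).open_source.mem_nhds hw)).mdifferentiableAt (by simp)

/-- In fibred charts, the projection `W → M` is `((x, u, u_x), p) ↦ x`. -/
theorem S_tmap_base (c : FibredChart P) (w₀ w : CartanBundle P η L)
    (hw : w.jet.pt ∈ c.total.source) (X : WModel k n) :
    c.S w.base ((tmap CartanBundle.base w : WModel k n →L[ℝ] BModel k) X) =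
      ((tmap (cartanHomeo c w₀) w : WModel k n →L[ℝ] WModel k n) X).1.1.1 := by
  have hb : w.base ∈ c.base.source := c.proj_mem _ hw
  have hj : MDifferentiableAt 𝓘(ℝ, WModel k n) 𝓘(ℝ, BModel k)
      (CartanBundle.base : CartanBundle P η L → M) w :=
    MDifferentiableAt.comp (g := P.proj) (f := fun w : CartanBundle P η L => w.jet.pt) w
      (LFT.mdiff_proj _) ((contMDiff_pt.comp (contMDiff_jet η L) w).mdifferentiableAt (by simp))
  have h1 := tmap_comp (g := c.base) (f := (CartanBundle.base : CartanBundle P η L → M)) (p := w)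
    (c.mdiff_base hb) hj
  have h2 := tmap_comp (V' := WModel k n) (V'' := BModel k) (g := dxW k n)
    (f := cartanHomeo c w₀) (p := w)
    ((dxW k n).differentiableAt.mdifferentiableAt) (mdiff_cartanHomeo c w₀ w hw)
  rw [tmap_eq_fderiv, ContinuousLinearMap.fderiv] at h2
  have h3 : (tmap (fun w : CartanBundle P η L => c.base w.base) w :
      WModel k n →L[ℝ] BModel k) = tmap (fun w => dxW k n (cartanHomeo c w₀ w)) w := by
    refine tmap_congr ?_
    filter_upwards [(cartanHomeo c w₀).open_source.mem_nhds hw] with w' hw'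
    exact (c.fst_total _ hw').symm
  exact congrArg (fun f => f X) (h1.symm.trans (h3.trans h2))

/-- Every vertical tangent vector of `W` extends to a smooth vertical vector field. The cut-off
function is pulled back from `E`, which is Hausdorff by assumption. -/
theorem exists_vertical_field [T2Space E] [IsManifold 𝓘(ℝ, BModel k × FModel n) ∞ E]
    (c : FibredChart P) (w : CartanBundle P η L)
    (hw : w.jet.pt ∈ c.total.source) {X₀ : WModel k n} (hX₀ : X₀.1.1.1 = 0) :
    ∃ X : ∀ w : CartanBundle P η L, TangentSpace 𝓘(ℝ, WModel k n) w,
      IsSmoothField X ∧ IsVertical X ∧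
        (tmap (cartanHomeo c w) w : WModel k n →L[ℝ] WModel k n) (X w) = X₀ := by
  obtain ⟨φ, -, hφ⟩ := (SmoothBumpFunction.nhds_basis_tsupport
    (I := 𝓘(ℝ, BModel k × FModel n)) w.jet.pt).mem_iff.1 (c.total.open_source.mem_nhds hw)
  obtain ⟨h1, h2⟩ := contMDiffOn_cartanHomeo c w
  have hpt : ContMDiff 𝓘(ℝ, WModel k n) 𝓘(ℝ, BModel k × FModel n) ∞
      (fun w : CartanBundle P η L => w.jet.pt) := contMDiff_pt.comp (contMDiff_jet η L)
  have hψ : ContMDiff 𝓘(ℝ, WModel k n) 𝓘(ℝ, ℝ) ∞ (fun w : CartanBundle P η L => φ w.jet.pt) :=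
    φ.contMDiff.comp hpt
  have hsupp : tsupport (fun w : CartanBundle P η L => φ w.jet.pt) ⊆ (cartanHomeo c w).source := by
    refine (tsupport_comp_subset_preimage φ hpt.continuous).trans fun w' hw' => hφ hw'
  refine ⟨coordField (cartanHomeo c w) (fun w => φ w.jet.pt) X₀,
    isSmoothField_coordField h1 h2 hψ hsupp X₀, fun w' => ?_, ?_⟩
  · by_cases hw' : w'.jet.pt ∈ c.total.source
    · have h3 := S_tmap_base c w w' hw' (coordField (cartanHomeo c w) (fun w => φ w.jet.pt) X₀ w')
      rw [tmap_coordField h1 h2 X₀ hw'] at h3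
      have h4 : (φ w'.jet.pt • X₀).1.1.1 = 0 := by
        change φ w'.jet.pt • X₀.1.1.1 = 0
        rw [hX₀, smul_zero]
      rw [h4] at h3
      have h5 := congrArg (c.Si w'.base) h3
      rwa [c.Si_S (x := w'.base) (c.proj_mem _ hw'), map_zero] at h5
    · have h3 : φ w'.jet.pt = 0 := by
        by_contra h
        exact hw' (hsupp (subset_tsupport _ h))
      have h4 : coordField (cartanHomeo c w) (fun w => φ w.jet.pt) X₀ w' = (0 : WModel k n) := by
        rw [coordField, h3]
        exact zero_smul ℝ (A := WModel k n) _
      rw [h4]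
      exact map_zero (tmap CartanBundle.base w' : WModel k n →L[ℝ] BModel k)
  · rw [tmap_coordField h1 h2 X₀ hw, φ.eq_one, one_smul]

end Vertical

/-! ### The pullback of the contracted form in coordinates -/

section Pullback

/-- A form of top degree vanishes if it vanishes on the image of the standard basis under a
surjective linear map. -/
theorem top_form_eq_zero_of_comp {k : ℕ} {f : BModel k [⋀^Fin (k + 1)]→L[ℝ] ℝ}
    {A A' : BModel k →L[ℝ] BModel k} (hA : ∀ v, A (A' v) = v)
    (h : (f fun i => A (EuclideanSpace.single i (1 : ℝ))) = 0) : f = 0 := by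
  have h1 : f.compContinuousLinearMap A = 0 := by
    by_contra hne
    exact apply_single_ne_zero hne h
  ext v
  have h2 := congrArg (fun g : BModel k [⋀^Fin (k + 1)]→L[ℝ] ℝ => g fun i => A' (v i)) h1
  simpa [Function.comp_def, hA] using h2

variable {k n : ℕ} {M E Q : Type*} [TopologicalSpace M] [ChartedSpace (BModel k) M]
  [TopologicalSpace E] [ChartedSpace (BModel k × FModel n) E] [TopologicalSpace Q]
  [ChartedSpace (FModel n) Q] {P : SmoothFibreBundle k n M E Q}

/-- In a chart, a form of top degree is its density times a constant form, and the density is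
smooth. -/
theorem differentiableAt_formRep [IsManifold 𝓘(ℝ, BModel k) ∞ M] (η : VolumeForm k M)
    {e : OpenPartialHomeomorph M (BModel k)} (h : IsSmoothChart e) {y : BModel k}
    (hy : y ∈ e.target) : DifferentiableAt ℝ (formRep η.form e) y := by
  have h0 : formDensity η e y ≠ 0 := h.formDensity_ne_zero η hy
  have h1 : formRep η.form e = fun y' =>
      (formDensity η e y' / formDensity η e y) • formRep η.form e y := by
    ext1 y'
    rw [← sub_eq_zero]
    refine top_form_eq_zero_of_comp (A := ContinuousLinearMap.id ℝ _)
      (A' := ContinuousLinearMap.id ℝ _) (fun v => rfl) ?_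
    change formDensity η e y' - formDensity η e y' / formDensity η e y * formDensity η e y = 0
    field_simp
    ring
  rw [h1]
  have h2 : DifferentiableAt ℝ (formDensity η e) y :=
    ((h.contDiffOn_formDensity η).contDiffAt (e.open_target.mem_nhds hy)).differentiableAt (by simp)
  have h3 : DifferentiableAt ℝ (fun y' => formDensity η e y' / formDensity η e y) y := by
    simp only [div_eq_mul_inv]
    exact h2.mul_const _
  exact h3.smul_const _

variable [IsManifold 𝓘(ℝ, BModel k) ∞ M] [IsManifold 𝓘(ℝ, FModel n) ∞ Q]
  {η : VolumeForm k M} {L : Jet1 P → ℝ} {Γ : M → CartanBundle P η L} {U : Set M}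

/-- The coordinates of a section of `W → M`. -/
def cartanSec (c : FibredChart P) (Γ : M → CartanBundle P η L) (y : BModel k) : WModel k n :=
  cartanCoord c (Γ (c.base.symm y))

theorem cartanSec_base (c : FibredChart P) (Γ : M → CartanBundle P η L) {x : M}
    (hx : x ∈ c.base.source) : cartanSec c Γ (c.base x) = cartanCoord c (Γ x) := by
  rw [cartanSec, c.base.left_inv hx]

variable {c : FibredChart P} {x : M}

theorem base_mem_of_section (hb : ∀ x ∈ U, (Γ x).base = x) (hx : x ∈ U)
    (hc : (Γ x).jet.pt ∈ c.total.source) : x ∈ c.base.source := by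
  have h := c.proj_mem _ hc
  have h1 : P.proj (Γ x).jet.pt = x := hb x hx
  rwa [h1] at h

theorem eventually_pt_mem (hU : IsOpen U) (hΓ : ContMDiffOn 𝓘(ℝ, BModel k) 𝓘(ℝ, WModel k n) ∞ Γ U)
    (hx : x ∈ U) (hc : (Γ x).jet.pt ∈ c.total.source) :
    ∀ᶠ x' in 𝓝 x, x' ∈ U ∧ (Γ x').jet.pt ∈ c.total.source := by
  have h : ContinuousAt (fun x => (Γ x).jet.pt) x :=
    ContinuousAt.comp (g := fun w : CartanBundle P η L => w.jet.pt)
      (contMDiff_pt.comp (contMDiff_jet η L)).continuous.continuousAt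
      (hΓ.continuousOn.continuousAt (hU.mem_nhds hx))
  filter_upwards [hU.mem_nhds hx, h (c.total.open_source.mem_nhds hc)] with x' h1 h2
  exact ⟨h1, h2⟩

theorem contDiffAt_cartanSec (hU : IsOpen U)
    (hΓ : ContMDiffOn 𝓘(ℝ, BModel k) 𝓘(ℝ, WModel k n) ∞ Γ U) (hb : ∀ x ∈ U, (Γ x).base = x)
    (hx : x ∈ U) (hc : (Γ x).jet.pt ∈ c.total.source) :
    ContDiffAt ℝ ∞ (cartanSec c Γ) (c.base x) := by
  have hbx := base_mem_of_section hb hx hc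
  have hy := c.base.map_source hbx
  have hinv : c.base.symm (c.base x) = x := c.base.left_inv hbx
  rw [← contMDiffAt_iff_contDiffAt]
  refine ContMDiffAt.comp (c.base x) (g := cartanHomeo c (Γ x))
    (f := fun y => Γ (c.base.symm y))
    (I' := 𝓘(ℝ, WModel k n)) ?_ (ContMDiffAt.comp (c.base x) (g := Γ) (I' := 𝓘(ℝ, BModel k)) ?_
      (c.base_symm_smooth.contMDiffAt (c.base.open_target.mem_nhds hy)))
  · rw [hinv]
    exact (contMDiffOn_cartanHomeo c (Γ x)).1.contMDiffAt
      ((cartanHomeo c (Γ x)).open_source.mem_nhds hc)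
  · rw [hinv]
    exact hΓ.contMDiffAt (hU.mem_nhds hx)

theorem eventually_cartanSec_base (hU : IsOpen U)
    (hΓ : ContMDiffOn 𝓘(ℝ, BModel k) 𝓘(ℝ, WModel k n) ∞ Γ U) (hb : ∀ x ∈ U, (Γ x).base = x)
    (hx : x ∈ U) (hc : (Γ x).jet.pt ∈ c.total.source) :
    ∀ᶠ y in 𝓝 (c.base x), (cartanSec c Γ y).1.1.1 = y := by
  have hbx := base_mem_of_section hb hx hc
  have hy := c.base.map_source hbx
  have hinv : c.base.symm (c.base x) = x := c.base.left_inv hbx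
  have h1 : ContinuousAt c.base.symm (c.base x) := c.base.symm.continuousAt hy
  have h2 := eventually_pt_mem hU hΓ hx hc
  rw [← hinv] at h2
  filter_upwards [c.base.open_target.mem_nhds hy, h1.eventually h2] with y hy1 hy2
  have h3 : (cartanSec c Γ y).1.1.1 = c.base (Γ (c.base.symm y)).base := c.fst_total _ hy2.2
  rw [h3, hb _ hy2.1, c.base.right_inv hy1]

/-- The tangent vectors of a section of `W → M` are the derivatives of its coordinates. -/
theorem tmap_cartanHomeo_section (hU : IsOpen U)
    (hΓ : ContMDiffOn 𝓘(ℝ, BModel k) 𝓘(ℝ, WModel k n) ∞ Γ U) (hb : ∀ x ∈ U, (Γ x).base = x)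
    (hx : x ∈ U) (hc : (Γ x).jet.pt ∈ c.total.source) (v : BModel k) :
    (tmap (cartanHomeo c (Γ x)) (Γ x) : WModel k n →L[ℝ] WModel k n)
      ((tmap Γ x : BModel k →L[ℝ] WModel k n) (c.Si x v)) =
        fderiv ℝ (cartanSec c Γ) (c.base x) v := by
  have hbx := base_mem_of_section hb hx hc
  have hy := c.base.map_source hbx
  have hinv : c.base.symm (c.base x) = x := c.base.left_inv hbx
  have hΓx : MDifferentiableAt 𝓘(ℝ, BModel k) 𝓘(ℝ, WModel k n) Γ x :=
    (hΓ.contMDiffAt (hU.mem_nhds hx)).mdifferentiableAt (by simp)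
  have h1 := tmap_comp (g := Γ) (f := c.base.symm) (p := c.base x) (by rw [hinv]; exact hΓx)
    (c.mdiff_base_symm hy)
  have h2 := tmap_comp (g := cartanHomeo c (Γ x)) (f := fun y => Γ (c.base.symm y)) (p := c.base x)
    (by rw [hinv]; exact mdiff_cartanHomeo c _ _ hc)
    (MDifferentiableAt.comp (c.base x) (by rw [hinv]; exact hΓx) (c.mdiff_base_symm hy))
  rw [h1, hinv] at h2
  have h3 : (tmap (fun y => cartanHomeo c (Γ x) (Γ (c.base.symm y))) (c.base x) :
      BModel k →L[ℝ] WModel k n) = fderiv ℝ (cartanSec c Γ) (c.base x) := tmap_eq_fderiv _ _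
  exact (congrArg (fun f => f v) (h3.symm.trans h2)).symm

/-- The exterior derivative of the Cartan form on a vector `X` and the tangent vectors of a section
of `W → M`, in the coordinates of a fibred chart. -/
theorem extD_cartanForm_section (hU : IsOpen U)
    (hΓ : ContMDiffOn 𝓘(ℝ, BModel k) 𝓘(ℝ, WModel k n) ∞ Γ U) (hb : ∀ x ∈ U, (Γ x).base = x)
    (hx : x ∈ U) (hc : (Γ x).jet.pt ∈ c.total.source)
    (hL : ContMDiff 𝓘(ℝ, JModel k n) 𝓘(ℝ, ℝ) ∞ L) (X : WModel k n) :
    extD (cartanForm P η L) (Γ x) (Matrix.vecCons X fun i =>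
      (tmap Γ x : BModel k →L[ℝ] WModel k n) (c.Si x (EuclideanSpace.single i (1 : ℝ)))) =
    extDeriv (localCartan (formRep η.form c.base) (lagCoord L c)) (cartanSec c Γ (c.base x))
      (Matrix.vecCons ((tmap (cartanHomeo c (Γ x)) (Γ x) : WModel k n →L[ℝ] WModel k n) X)
        fun i => fderiv ℝ (cartanSec c Γ) (c.base x) (EuclideanSpace.single i (1 : ℝ))) := by
  have hbx := base_mem_of_section hb hx hc
  have hy := c.base.map_source hbx
  have hz : (cartanCoord c (Γ x)).1.1 ∈ c.total.target := c.total.map_source hc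
  obtain ⟨h1, h2⟩ := contMDiffOn_cartanHomeo c (Γ x)
  have h3 : formRep (cartanForm P η L) (cartanHomeo c (Γ x)) =ᶠ[𝓝 (cartanCoord c (Γ x))]
      localCartan (formRep η.form c.base) (lagCoord L c) := by
    filter_upwards [(isOpen_cartanTarget c).mem_nhds hz] with z hz
    exact formRep_cartanForm c _ hz
  have h4 : (cartanCoord c (Γ x)).1.1.1 = c.base x := by
    have h : (cartanCoord c (Γ x)).1.1.1 = c.base (Γ x).base := c.fst_total _ hc
    rw [h, hb x hx]
  have h5 : DifferentiableAt ℝ (localCartan (formRep η.form c.base) (lagCoord L c))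
      (cartanCoord c (Γ x)) := by
    refine differentiableAt_localCartan ?_ ?_
    · rw [h4]; exact differentiableAt_formRep η c.isSmoothChart hy
    · exact ((contDiffOn_lagCoord hL c).contDiffAt
        ((isOpen_jetTarget c).mem_nhds hz)).differentiableAt (by simp)
  have h6 := extD_eq_extDeriv_formRep (cartanForm P η L) h1 h2 (p := Γ x) hc
    (h5.congr_of_eventuallyEq h3)
  have h7 : cartanHomeo c (Γ x) (Γ x) = cartanCoord c (Γ x) := rfl
  rw [h6, h7, h3.extDeriv_eq, cartanSec_base c Γ hbx,
    ContinuousAlternatingMap.compContinuousLinearMap_apply]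
  congr 1
  ext1 i
  refine Fin.cases rfl (fun i => ?_) i
  exact tmap_cartanHomeo_section hU hΓ hb hx hc _

/-- The condition `Γ^*(X ⌟ dλ) = 0` at a point, in the coordinates of a fibred chart. A form of top
degree on `M` is determined by its value on the coordinate vectors `∂₁, …, ∂_m`. -/
theorem pullback_interior_eq_zero_iff (hU : IsOpen U)
    (hΓ : ContMDiffOn 𝓘(ℝ, BModel k) 𝓘(ℝ, WModel k n) ∞ Γ U) (hb : ∀ x ∈ U, (Γ x).base = x)
    (hx : x ∈ U) (hc : (Γ x).jet.pt ∈ c.total.source) (hL : ContMDiff 𝓘(ℝ, JModel k n) 𝓘(ℝ, ℝ) ∞ L)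
    (X : ∀ w : CartanBundle P η L, TangentSpace 𝓘(ℝ, WModel k n) w) :
    (pullback Γ (interior X (extD (cartanForm P η L))) : DForm (BModel k) M (k + 1)) x = 0 ↔
    extDeriv (localCartan (formRep η.form c.base) (lagCoord L c)) (cartanSec c Γ (c.base x))
      (Matrix.vecCons ((tmap (cartanHomeo c (Γ x)) (Γ x) : WModel k n →L[ℝ] WModel k n) (X (Γ x)))
        fun i => fderiv ℝ (cartanSec c Γ) (c.base x) (EuclideanSpace.single i (1 : ℝ))) = 0 := by
  have hbx := base_mem_of_section hb hx hc
  refine Iff.trans ?_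
    (Eq.congr_left (extD_cartanForm_section hU hΓ hb hx hc hL (X (Γ x))).symm).symm
  constructor
  · intro h
    exact congrArg (fun f : BModel k [⋀^Fin (k + 1)]→L[ℝ] ℝ => f fun i =>
      c.Si x (EuclideanSpace.single i (1 : ℝ))) h
  · intro h
    exact top_form_eq_zero_of_comp (A := c.Si x) (A' := c.S x) (fun v => c.Si_S hbx v) h

end Pullback

/-! ### The momenta -/

section Equations

variable {k n : ℕ}

theorem apply_leg (ℓ : (BModel k →L[ℝ] FModel n) →L[ℝ] ℝ) (κ : BModel k →L[ℝ] ℝ) (a : FModel n) :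
    κ (leg ℓ a) = ℓ (κ.smulRight a) := by
  have h1 : κ.smulRight a = ∑ i, κ (EuclideanSpace.single i (1 : ℝ)) •
      ((EuclideanSpace.proj i : BModel k →L[ℝ] ℝ).smulRight a) := by
    refine ContinuousLinearMap.ext fun b => ?_
    have hb : b = ∑ i, b i • EuclideanSpace.single i (1 : ℝ) := by
      have := (EuclideanSpace.basisFun (Fin (k + 1)) ℝ).sum_repr b
      simpa using this.symm
    have h2 : κ b = ∑ i, b i * κ (EuclideanSpace.single i (1 : ℝ)) := by
      conv_lhs => rw [hb]
      simp
    simp only [ContinuousLinearMap.smulRight_apply, sum_apply, smul_apply, h2, Finset.sum_smul,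
      smul_smul]
    refine Finset.sum_congr rfl fun i _ => ?_
    rw [mul_comm]; rfl
  have h3 : leg ℓ a = ∑ i, (leg ℓ a) i • EuclideanSpace.single i (1 : ℝ) := by
    have := (EuclideanSpace.basisFun (Fin (k + 1)) ℝ).sum_repr (leg ℓ a)
    simpa using this.symm
  rw [h1, h3]
  simp only [map_sum, map_smul, smul_eq_mul, leg_apply]
  exact Finset.sum_congr rfl fun i _ => mul_comm _ _

/-- The transpose of a functional composed with changes of coordinates of base and fibre, which is
the behaviour of `∂L/∂u_x` under a change of fibred charts. -/
theorem leg_comp (ℓ ℓ' : (BModel k →L[ℝ] FModel n) →L[ℝ] ℝ) (A : FModel n →L[ℝ] FModel n)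
    (B : BModel k →L[ℝ] BModel k) (h : ∀ ν, ℓ' ν = ℓ (A.comp (ν.comp B))) :
    leg ℓ' = B.comp ((leg ℓ).comp A) := by
  refine ContinuousLinearMap.ext fun a => PiLp.ext fun i => ?_
  have h1 := apply_leg ℓ ((EuclideanSpace.proj i : BModel k →L[ℝ] ℝ).comp B) (A a)
  rw [leg_apply, h]
  refine Eq.trans ?_ h1.symm
  congr 1
  refine ContinuousLinearMap.ext fun b => ?_
  simp

/-- The trace pairing determines the momenta. -/
theorem eq_leg_of_sum {ℓ : (BModel k →L[ℝ] FModel n) →L[ℝ] ℝ} {p : FModel n →L[ℝ] BModel k}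
    (h : ∀ ν, ℓ ν = ∑ i, (p (ν (EuclideanSpace.single i (1 : ℝ)))) i) : p = leg ℓ := by
  refine ContinuousLinearMap.ext fun a => PiLp.ext fun i => ?_
  rw [leg_apply, h, Finset.sum_eq_single i]
  · simp
  · intro j _ hj
    simp [hj.symm]
  · simp

/-- The trace pairing is nondegenerate. -/
theorem eq_of_forall_sum_eq_zero {A : BModel k →L[ℝ] FModel n}
    (h : ∀ q : FModel n →L[ℝ] BModel k, ∑ i, (q (A (EuclideanSpace.single i (1 : ℝ)))) i = 0) :
    A = 0 := by
  have h1 : ∀ j, A (EuclideanSpace.single j (1 : ℝ)) = 0 := by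
    intro j
    have h2 := h ((innerSL ℝ (A (EuclideanSpace.single j (1 : ℝ)))).smulRight
      (EuclideanSpace.single j (1 : ℝ)))
    rw [Finset.sum_eq_single j] at h2
    · simpa using h2
    · intro i _ hi
      simp [hi]
    · simp
  refine ContinuousLinearMap.ext fun b => ?_
  have hb : b = ∑ i, b i • EuclideanSpace.single i (1 : ℝ) := by
    have := (EuclideanSpace.basisFun (Fin (k + 1)) ℝ).sum_repr b
    simpa using this.symm
  rw [hb]
  simp [h1]

variable {M E Q : Type*} [TopologicalSpace M] [ChartedSpace (BModel k) M]
  [TopologicalSpace E] [ChartedSpace (BModel k × FModel n) E] [TopologicalSpace Q]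
  [ChartedSpace (FModel n) Q] {P : SmoothFibreBundle k n M E Q}
  [IsManifold 𝓘(ℝ, BModel k) ∞ M] [IsManifold 𝓘(ℝ, FModel n) ∞ Q]
  {η : VolumeForm k M} {L : Jet1 P → ℝ} {U : Set M} {s : M → E} {c c' : FibredChart P}

/-- The Lagrangian is a function on jets: its coordinate expressions are related by the change of
jet coordinates. -/
theorem lagCoord_change {z : JModel k n} (hz : z.1 ∈ c'.dom c) :
    lagCoord L c' z = lagCoord L c (jetChange c' c z) := by
  obtain ⟨h1, h2⟩ := (c'.mem_dom c).1 hz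
  let j : Jet1 P := ⟨c'.total.symm z.1, linOfCoord c' (c'.total.symm z.1) z.2,
    linOfCoord_isSection c' (c'.total.map_target h1) z.2⟩
  have h3 : j.pt ∈ c'.total.source := c'.total.map_target h1
  have h5 := lagCoord_eq L c' j h1
  have h6 : (jetChart c' j).symm z = j := by
    classical
    change (dite _ _ _ : Jet1 P) = j
    rw [dif_pos h1]
  have h4 : jetCoord c' j = z := by
    have := (jetChart c' j).right_inv (x := z) h1
    rwa [h6] at this
  rw [h5, h6, ← lagCoord_jetCoord L c (j := j) h2, jetCoord_change c' c j h3 h2, h4]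

/-- The coordinates `∂L/∂u_x` of the Legendre transform change as the coordinates `p` of `W` do. -/
theorem momentum_change (hL : ContMDiff 𝓘(ℝ, JModel k n) 𝓘(ℝ, ℝ) ∞ L) (hU : IsOpen U)
    (hs : IsSectionOn P s U) {x : M} (hx : x ∈ U) (hc : s x ∈ c.total.source)
    (hc' : s x ∈ c'.total.source) : momentum L c' s (c'.base x) =
      (fderiv ℝ (c.Φ c') (c.base x)).comp ((momentum L c s (c.base x)).comp
        ((ContinuousLinearMap.snd ℝ _ _).comp ((fderiv ℝ (c'.Ψ c) (c'.total (s x))).comp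
          (ContinuousLinearMap.inr ℝ (BModel k) (FModel n))))) := by
  have hj := hs.jetCoord_jet hU hx hc
  have hj' := hs.jetCoord_jet hU hx hc'
  have hch := jetCoord_change c' c (hs.jet hU hx) hc' hc
  rw [hj, hj'] at hch
  have hy := hs.mem_secDom hx hc
  have hy' := hs.mem_secDom hx hc'
  have hz' : jetSec c' s (c'.base x) = (c'.total (s x), (jetSec c' s (c'.base x)).2) := by
    refine Prod.ext ?_ rfl
    rw [← hj']; rfl
  have hbase : (c'.Ψ c (c'.total (s x))).1 = c.base x := by
    change (c.total (c'.total.symm (c'.total (s x)))).1 = _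
    rw [c'.total.left_inv hc', c.fst_total _ hc, hs.2 x hx]
  have hdom : c'.total (s x) ∈ c'.dom c :=
    (c'.mem_dom c).2 ⟨c'.total.map_source hc', by rw [c'.total.left_inv hc']; exact hc⟩
  have hd : ∀ (c : FibredChart P), s x ∈ c.total.source →
      DifferentiableAt ℝ (lagCoord L c) (jetSec c s (c.base x)) := fun c hc =>
    ((contDiffOn_lagCoord hL c).contDiffAt ((isOpen_jetTarget c).mem_nhds
      (hs.jetSec_mem (hs.mem_secDom hx hc)))).differentiableAt (by simp)
  refine leg_comp _ _ _ _ fun ν => ?_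
  -- compare the derivatives of the two coordinate Lagrangians along the line of jets `u_x + t ν`
  -- over a fixed point of `E`, which the change of jet coordinates maps to such a line
  have h1 := (hd c' hc').hasFDerivAt.hasLineDerivAt (0, ν)
  have h2 := (hd c hc).hasFDerivAt.hasLineDerivAt (0, ((ContinuousLinearMap.snd ℝ _ _).comp
    ((fderiv ℝ (c'.Ψ c) (c'.total (s x))).comp (ContinuousLinearMap.inr ℝ (BModel k)
      (FModel n)))).comp (ν.comp (fderiv ℝ (c.Φ c') (c.base x))))
  rw [HasLineDerivAt] at h1 h2
  refine h1.unique (h2.congr_of_eventuallyEq (Eventually.of_forall fun t => ?_))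
  set v := (jetSec c' s (c'.base x)).2
  have e1 : jetSec c' s (c'.base x) + t • ((0, ν) : JModel k n) = (c'.total (s x), v + t • ν) := by
    rw [hz']
    refine Prod.ext ?_ rfl
    change _ + t • (0 : BModel k × FModel n) = _
    rw [smul_zero, add_zero]
  change lagCoord L c' (jetSec c' s (c'.base x) + t • (0, ν)) =
    lagCoord L c (jetSec c s (c.base x) + t • (0, _))
  rw [e1, lagCoord_change (c := c) hdom, hch, hz']
  congr 1
  refine Prod.ext ?_ ?_
  · change _ = _ + t • (0 : BModel k × FModel n)
    rw [smul_zero, add_zero]; rfl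
  · refine ContinuousLinearMap.ext fun b => ?_
    simp only [jetChange, hbase]
    change (fderiv ℝ (c'.Ψ c) (c'.total (s x)) (fderiv ℝ (c.Φ c') (c.base x) b,
      (v + t • ν) (fderiv ℝ (c.Φ c') (c.base x) b))).2 =
      (fderiv ℝ (c'.Ψ c) (c'.total (s x)) (fderiv ℝ (c.Φ c') (c.base x) b,
        v (fderiv ℝ (c.Φ c') (c.base x) b))).2 +
      t • (fderiv ℝ (c'.Ψ c) (c'.total (s x)) (0, ν (fderiv ℝ (c.Φ c') (c.base x) b))).2
    rw [← Prod.smul_snd, ← Prod.snd_add, ← map_smul, ← map_add]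
    simp

end Equations

/-! ### The contracted form and the Euler–Lagrange expression -/

section Comparison

variable {k n : ℕ} {M E Q : Type*} [TopologicalSpace M] [ChartedSpace (BModel k) M]
  [TopologicalSpace E] [ChartedSpace (BModel k × FModel n) E] [TopologicalSpace Q]
  [ChartedSpace (FModel n) Q] {P : SmoothFibreBundle k n M E Q}
  [IsManifold 𝓘(ℝ, BModel k) ∞ M] [IsManifold 𝓘(ℝ, FModel n) ∞ Q]
  {η : VolumeForm k M} {L : Jet1 P → ℝ} {U : Set M} {s : M → E} {c : FibredChart P}

/-- The Euler–Lagrange expression in terms of the density of `η` itself instead of its absolute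
value: the sign of the density is locally constant. -/
theorem eulerLagrange_eq_sign (hL : ContMDiff 𝓘(ℝ, JModel k n) 𝓘(ℝ, ℝ) ∞ L) (hU : IsOpen U)
    (hs : IsSectionOn P s U) (η : VolumeForm k M) {y : BModel k} (hy : y ∈ secDom c s U)
    (a : FModel n) : eulerLagrange η L c s y a = (SignType.sign (formDensity η c.base y) : ℝ) *
      (formDensity η c.base y * fderiv ℝ (lagCoord L c) (jetSec c s y) ((0, a), 0) -
        ∑ j, fderiv ℝ (fun y => formDensity η c.base y * (momentum L c s y a) j) y
          (EuclideanSpace.single j (1 : ℝ))) := by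
  have hne := c.isSmoothChart.formDensity_ne_zero η hy.1
  have hρ : ContinuousAt (formDensity η c.base) y :=
    ((c.isSmoothChart.contDiffOn_formDensity η).contDiffAt
      (c.base.open_target.mem_nhds hy.1)).continuousAt
  have hnhds := (isOpen_secDom hU hs).mem_nhds hy
  set ε : ℝ := (SignType.sign (formDensity η c.base y) : ℝ) with hε
  have habs : ∀ᶠ y' in 𝓝 y, |formDensity η c.base y'| = ε * formDensity η c.base y' := by
    rcases lt_or_gt_of_ne hne with h | h
    · filter_upwards [hρ.eventually (gt_mem_nhds h)] with y' hy'
      rw [hε, sign_neg h, abs_of_neg hy']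
      simp
    · filter_upwards [hρ.eventually (lt_mem_nhds h)] with y' hy'
      rw [hε, sign_pos h, abs_of_pos hy']
      simp
  have hmd : DifferentiableAt ℝ (momentumDensity η L c s) y :=
    ((hs.contDiffOn_momentumDensity hL hU η).contDiffAt hnhds).differentiableAt (by simp)
  have h1 : ∀ j, (fderiv ℝ (momentumDensity η L c s) y (EuclideanSpace.single j (1 : ℝ)) a) j =
      ε * fderiv ℝ (fun y => formDensity η c.base y * (momentum L c s y a) j) y
          (EuclideanSpace.single j (1 : ℝ)) := by
    intro j
    let ev : (FModel n →L[ℝ] BModel k) →L[ℝ] ℝ :=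
      (EuclideanSpace.proj j).comp (ContinuousLinearMap.apply ℝ (BModel k) a)
    have h2 := ev.hasFDerivAt.comp y hmd.hasFDerivAt
    have h3 : (fun y => formDensity η c.base y * (momentum L c s y a) j) =ᶠ[𝓝 y]
        ε • (ev ∘ momentumDensity η L c s) := by
      filter_upwards [habs] with y' hy'
      have h4 : (ev ∘ momentumDensity η L c s) y' =
        |formDensity η c.base y'| * (momentum L c s y' a) j := rfl
      have h5 : ε * ε = 1 := by
        rcases lt_or_gt_of_ne hne with h | h
        · rw [hε, sign_neg h]; simp
        · rw [hε, sign_pos h]; simp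
      rw [Pi.smul_apply, h4, hy', smul_eq_mul]
      linear_combination (-(formDensity η c.base y' * (momentum L c s y' a) j)) * h5
    have h5 : ε * ε = 1 := by
      rcases lt_or_gt_of_ne hne with h | h
      · rw [hε, sign_neg h]; simp
      · rw [hε, sign_pos h]; simp
    rw [h3.fderiv_eq, (h2.const_smul ε).fderiv, smul_apply, smul_eq_mul, ← mul_assoc, h5, one_mul]
    rfl
  have h6 : eulerLagrange η L c s y a = |formDensity η c.base y| *
      fderiv ℝ (lagCoord L c) (jetSec c s y) ((0, a), 0) -
        ∑ j, (fderiv ℝ (momentumDensity η L c s) y (EuclideanSpace.single j (1 : ℝ)) a) j := by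
    rw [eulerLagrange, sub_apply, sum_apply]
    rfl
  rw [h6, habs.self_of_nhds, mul_sub, Finset.mul_sum, mul_assoc]
  simp only [h1]

/-- The value of the contraction of `dλ` with the vertical vector `X`, on the tangent vectors
of a section `Γ` of `W → M`, where `s` is the underlying section of `E`. -/
theorem extDeriv_localCartan_cartanSec {Γ : M → CartanBundle P η L}
    (hL : ContMDiff 𝓘(ℝ, JModel k n) 𝓘(ℝ, ℝ) ∞ L) (hU : IsOpen U) (hs : IsSectionOn P s U)
    (hΓ : ContMDiffOn 𝓘(ℝ, BModel k) 𝓘(ℝ, WModel k n) ∞ Γ U) (hb : ∀ x ∈ U, (Γ x).base = x)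
    (hpt : ∀ x ∈ U, (Γ x).jet.pt = s x) {x : M} (hx : x ∈ U) (hc : s x ∈ c.total.source)
    {X : WModel k n} (hX : X.1.1.1 = 0) :
    extDeriv (localCartan (formRep η.form c.base) (lagCoord L c)) (cartanSec c Γ (c.base x))
      (Matrix.vecCons X
        fun i => fderiv ℝ (cartanSec c Γ) (c.base x) (EuclideanSpace.single i (1 : ℝ))) =
      formDensity η c.base (c.base x) *
        (fderiv ℝ (lagCoord L c) (cartanSec c Γ (c.base x)).1 X.1 +
        ∑ i, (X.2 ((fderiv ℝ (secCoord c s) (c.base x) - (cartanSec c Γ (c.base x)).1.2)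
          (EuclideanSpace.single i (1 : ℝ))) -
            (cartanSec c Γ (c.base x)).2 (X.1.2 (EuclideanSpace.single i (1 : ℝ)))) i) -
      ∑ j, fderiv ℝ (fun y => formDensity η c.base y * ((cartanSec c Γ y).2 X.1.1.2) j)
        (c.base x) (EuclideanSpace.single j (1 : ℝ)) := by
  have hc' : (Γ x).jet.pt ∈ c.total.source := by rw [hpt x hx]; exact hc
  have hbx := hs.base_mem hx hc
  have hy := c.base.map_source hbx
  have hz : (cartanSec c Γ (c.base x)).1.1 ∈ c.total.target := by
    rw [cartanSec_base c Γ hbx]; exact c.total.map_source hc'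
  have h1 := extDeriv_localCartan (μ := formRep η.form c.base) (ℓ := lagCoord L c)
    ((contDiffAt_cartanSec hU hΓ hb hx hc').differentiableAt (by simp))
    (eventually_cartanSec_base hU hΓ hb hx hc') (differentiableAt_formRep η c.isSmoothChart hy)
    (((contDiffOn_lagCoord hL c).contDiffAt
        ((isOpen_jetTarget c).mem_nhds hz)).differentiableAt (by simp)) hX
  have h2 : (fun y => (cartanSec c Γ y).1.1.2) =ᶠ[𝓝 (c.base x)] secCoord c s := by
    filter_upwards [(isOpen_secDom hU hs).mem_nhds (hs.mem_secDom hx hc)] with y hy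
    change (c.total (Γ (c.base.symm y)).jet.pt).2 = _
    rw [hpt _ hy.2.1]; rfl
  rw [h2.fderiv_eq] at h1
  exact h1

end Comparison

/-! ### Sections of `W` and the Euler–Lagrange equations -/

section Reverse

variable {k n : ℕ} {M E Q : Type*} [TopologicalSpace M] [ChartedSpace (BModel k) M]
  [TopologicalSpace E] [ChartedSpace (BModel k × FModel n) E] [TopologicalSpace Q]
  [ChartedSpace (FModel n) Q] {P : SmoothFibreBundle k n M E Q}
  [IsManifold 𝓘(ℝ, BModel k) ∞ M] [IsManifold 𝓘(ℝ, FModel n) ∞ Q]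
  {η : VolumeForm k M} {L : Jet1 P → ℝ} {U : Set M} {s : M → E} {c : FibredChart P}
  {Γ : M → CartanBundle P η L}

/-- A section of `W → M` that satisfies the equations `Γ^*(X ⌟ dλ) = 0` is the Legendre transform of
the jet of the underlying section of `E`: the vertical vectors in the direction of the multipliers
show that the jet is holonomic, those in the direction of the velocities that the multipliers are
the momenta. -/
theorem cartanSec_eq [T2Space E] [IsManifold 𝓘(ℝ, BModel k × FModel n) ∞ E]
    (hL : ContMDiff 𝓘(ℝ, JModel k n) 𝓘(ℝ, ℝ) ∞ L) (hU : IsOpen U) (hs : IsSectionOn P s U)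
    (hΓ : ContMDiffOn 𝓘(ℝ, BModel k) 𝓘(ℝ, WModel k n) ∞ Γ U) (hb : ∀ x ∈ U, (Γ x).base = x)
    (hpt : ∀ x ∈ U, (Γ x).jet.pt = s x)
    (h : ∀ {x : M}, x ∈ U → s x ∈ c.total.source → ∀ X : WModel k n, X.1.1.1 = 0 →
      extDeriv (localCartan (formRep η.form c.base) (lagCoord L c)) (cartanSec c Γ (c.base x))
        (Matrix.vecCons X fun i =>
          fderiv ℝ (cartanSec c Γ) (c.base x) (EuclideanSpace.single i (1 : ℝ))) = 0)
    {x : M} (hx : x ∈ U) (hc : s x ∈ c.total.source) :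
    cartanSec c Γ (c.base x) = (jetSec c s (c.base x), momentum L c s (c.base x)) := by
  have hbx := hs.base_mem hx hc
  have hne := c.isSmoothChart.formDensity_ne_zero η (c.base.map_source hbx)
  have h1 : (cartanSec c Γ (c.base x)).1.1 = (c.base x, secCoord c s (c.base x)) := by
    have h2 := hs.total_eq (hs.mem_secDom hx hc)
    rw [c.base.left_inv hbx] at h2
    rw [← h2, cartanSec_base c Γ hbx, ← hpt x hx]
    rfl
  have h2 : fderiv ℝ (secCoord c s) (c.base x) - (cartanSec c Γ (c.base x)).1.2 = 0 := by
    refine eq_of_forall_sum_eq_zero fun q => ?_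
    -- test with the vector `(0, q)` in the direction of the multipliers
    have h3 := h hx hc (0, q) rfl
    rw [extDeriv_localCartan_cartanSec hL hU hs hΓ hb hpt hx hc rfl] at h3
    simpa [hne] using h3
  have h3 : (cartanSec c Γ (c.base x)).1 = jetSec c s (c.base x) :=
    Prod.ext h1 (sub_eq_zero.1 h2).symm
  refine Prod.ext h3 ?_
  refine eq_leg_of_sum fun ν => ?_
  -- test with the vector `ν` in the direction of the velocities
  have h4 := h hx hc ((0, ν), 0) rfl
  rw [extDeriv_localCartan_cartanSec hL hU hs hΓ hb hpt hx hc rfl, h3] at h4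
  have h5 : fderiv ℝ (lagCoord L c) (jetSec c s (c.base x)) (0, ν) -
      ∑ i, ((cartanSec c Γ (c.base x)).2 (ν (EuclideanSpace.single i (1 : ℝ)))) i = 0 := by
    simpa [hne, sub_eq_add_neg] using h4
  exact sub_eq_zero.1 h5

/-- A section of `E` that lifts to a solution `Γ` of the equations `Γ^*(X ⌟ dλ) = 0` satisfies the
Euler–Lagrange equations: `Γ` is the Legendre transform, and the vertical vectors in the direction
of the fibre coordinates `u` give these equations. -/
theorem eulerLagrange_eq_zero_of_section [T2Space E] [IsManifold 𝓘(ℝ, BModel k × FModel n) ∞ E]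
    (hL : ContMDiff 𝓘(ℝ, JModel k n) 𝓘(ℝ, ℝ) ∞ L) (hU : IsOpen U) (hs : IsSectionOn P s U)
    (hΓ : ContMDiffOn 𝓘(ℝ, BModel k) 𝓘(ℝ, WModel k n) ∞ Γ U) (hb : ∀ x ∈ U, (Γ x).base = x)
    (hpt : ∀ x ∈ U, (Γ x).jet.pt = s x)
    (h : ∀ X : (∀ w : CartanBundle P η L, TangentSpace 𝓘(ℝ, WModel k n) w),
      IsSmoothField X → IsVertical X → ∀ x ∈ U,
        (pullback Γ (interior X (extD (cartanForm P η L))) : DForm (BModel k) M (k + 1)) x = 0)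
    {y : BModel k} (hy : y ∈ secDom c s U) : eulerLagrange η L c s y = 0 := by
  have h' : ∀ {x : M}, x ∈ U → s x ∈ c.total.source → ∀ X : WModel k n, X.1.1.1 = 0 →
      extDeriv (localCartan (formRep η.form c.base) (lagCoord L c)) (cartanSec c Γ (c.base x))
        (Matrix.vecCons X fun i =>
          fderiv ℝ (cartanSec c Γ) (c.base x) (EuclideanSpace.single i (1 : ℝ))) = 0 := by
    intro x hx hc X₀ hX₀
    have hc' : (Γ x).jet.pt ∈ c.total.source := by rw [hpt x hx]; exact hc
    obtain ⟨X, hX, hXv, hX0⟩ := exists_vertical_field c (Γ x) hc' hX₀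
    have h1 := (pullback_interior_eq_zero_iff hU hΓ hb hx hc' hL X).1 (h X hX hXv x hx)
    rwa [hX0] at h1
  have hsec : ∀ y ∈ secDom c s U, cartanSec c Γ y = (jetSec c s y, momentum L c s y) := by
    intro y hy
    have h1 := cartanSec_eq hL hU hs hΓ hb hpt h' hy.2.1 hy.2.2
    rwa [c.base.right_inv hy.1] at h1
  refine ContinuousLinearMap.ext fun a => ?_
  -- test with the vector `a` in the direction of the fibre coordinates
  have h1 := h' hy.2.1 hy.2.2 (((0, a), 0), 0) rfl
  rw [extDeriv_localCartan_cartanSec hL hU hs hΓ hb hpt hy.2.1 hy.2.2 rfl, c.base.right_inv hy.1,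
    hsec y hy] at h1
  have h2 : ∀ j, fderiv ℝ (fun y => formDensity η c.base y *
      ((cartanSec c Γ y).2 a) j) y (EuclideanSpace.single j (1 : ℝ)) =
      fderiv ℝ (fun y => formDensity η c.base y * (momentum L c s y a) j) y
        (EuclideanSpace.single j (1 : ℝ)) := by
    intro j
    congr 1
    refine Filter.EventuallyEq.fderiv_eq ?_
    filter_upwards [(isOpen_secDom hU hs).mem_nhds hy] with y' hy'
    rw [hsec y' hy']
  rw [eulerLagrange_eq_sign hL hU hs η hy a]
  simp only [h2] at h1
  have h3 : formDensity η c.base y * fderiv ℝ (lagCoord L c) (jetSec c s y) ((0, a), 0) -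
        ∑ j, fderiv ℝ (fun y => formDensity η c.base y * (momentum L c s y a) j) y
          (EuclideanSpace.single j (1 : ℝ)) = 0 := by
    simpa using h1
  rw [h3, mul_zero, zero_apply]

end Reverse

section Forward

variable {k n : ℕ} {M E Q : Type*} [TopologicalSpace M] [ChartedSpace (BModel k) M]
  [TopologicalSpace E] [ChartedSpace (BModel k × FModel n) E] [TopologicalSpace Q]
  [ChartedSpace (FModel n) Q] {P : SmoothFibreBundle k n M E Q}
  [IsManifold 𝓘(ℝ, BModel k) ∞ M] [IsManifold 𝓘(ℝ, FModel n) ∞ Q]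
  {L : Jet1 P → ℝ} {U : Set M} {s : M → E} {c : FibredChart P}

/-- The Legendre transform of the jet of a section: the point of `W` over the jet whose multipliers
are the momenta `∂L/∂u_x`, computed in a chosen fibred chart around the value of the section. -/
def legendreLift (η : VolumeForm k M) (L : Jet1 P → ℝ) (hU : IsOpen U) (hs : IsSectionOn P s U)
    {x : M} (hx : x ∈ U) : CartanBundle P η L where
  jet := hs.jet hU hx
  form := L (hs.jet hU hx) • pullback Jet1.base η.form (hs.jet hU hx) +
    multForm η (exists_fibredChart P (s x)).choose (hs.jet hU hx)
      (momentum L (exists_fibredChart P (s x)).choose s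
        ((exists_fibredChart P (s x)).choose.base x))
  mem := by rw [alt_add_sub]; exact multForm_mem η _ _ _

/-- The coordinates of the Legendre transform in an arbitrary fibred chart, which show that it does
not depend on the chosen one. -/
theorem cartanCoord_legendreLift (η : VolumeForm k M) (hL : ContMDiff 𝓘(ℝ, JModel k n) 𝓘(ℝ, ℝ) ∞ L)
    (hU : IsOpen U) (hs : IsSectionOn P s U) {x : M} (hx : x ∈ U) (hc : s x ∈ c.total.source) :
    cartanCoord c (legendreLift η L hU hs hx) =
      (jetSec c s (c.base x), momentum L c s (c.base x)) := by
  set c₀ := (exists_fibredChart P (s x)).choose with hc₀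
  have hcc : s x ∈ c₀.total.source := (exists_fibredChart P (s x)).choose_spec
  have h1 : multCoord c₀ (legendreLift η L hU hs hx) = momentum L c₀ s (c₀.base x) :=
    multCoord_eq c₀ (legendreLift η L hU hs hx) hcc (alt_add_sub _ _)
  refine Prod.ext (hs.jetCoord_jet hU hx hc) ?_
  have h2 := congrArg Prod.snd (cartanCoord_change c₀ c (legendreLift η L hU hs hx) hcc hc)
  refine h2.trans ?_
  have h3 : c₀.Ψ c (cartanCoord c₀ (legendreLift η L hU hs hx)).1.1 = c.total (s x) :=
    congrArg c.total (c₀.total.left_inv hcc)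
  have h4 : (cartanCoord c₀ (legendreLift η L hU hs hx)).1.1.1 = c₀.base x := by
    have h : (cartanCoord c₀ (legendreLift η L hU hs hx)).1.1.1 = c₀.base (P.proj (s x)) :=
      c₀.fst_total _ hcc
    rw [h, hs.2 x hx]
  have h5 : (cartanCoord c₀ (legendreLift η L hU hs hx)).2 = momentum L c₀ s (c₀.base x) := h1
  rw [momentum_change (c := c₀) hL hU hs hx hcc hc]
  simp only [cartanChange]
  rw [h3, h4, h5]

open Classical in
/-- Every section of `E` over `U` lifts to a smooth section of `W → M` over `U`, its Legendre
transform. The values outside of `U` are arbitrary. -/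
theorem exists_legendre_section (η : VolumeForm k M)
    (hL : ContMDiff 𝓘(ℝ, JModel k n) 𝓘(ℝ, ℝ) ∞ L) (hU : IsOpen U) (hs : IsSectionOn P s U) :
    ∃ Γ : M → CartanBundle P η L, ContMDiffOn 𝓘(ℝ, BModel k) 𝓘(ℝ, WModel k n) ∞ Γ U ∧
      ∀ x ∈ U, (Γ x).jet.pt = s x ∧ ∀ c : FibredChart P, s x ∈ c.total.source →
        cartanCoord c (Γ x) = (jetSec c s (c.base x), momentum L c s (c.base x)) := by
  have hne : ∀ x : M, Nonempty (CartanBundle P η L) := by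
    intro x
    obtain ⟨c, hc⟩ := exists_fibredChart P (s x)
    let j : Jet1 P := ⟨s x, linOfCoord c (s x) 0, linOfCoord_isSection c hc 0⟩
    exact ⟨⟨j, L j • pullback Jet1.base η.form j + 0, by
      rw [alt_add_sub]; exact Submodule.zero_mem _⟩⟩
  let Γ : M → CartanBundle P η L := fun x =>
    if hx : x ∈ U then legendreLift η L hU hs hx else (hne x).some
  have hΓ : ∀ x (hx : x ∈ U), Γ x = legendreLift η L hU hs hx := fun x hx => dif_pos hx
  have hpt : ∀ x ∈ U, (Γ x).jet.pt = s x := fun x hx => by rw [hΓ x hx]; rfl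
  have hco : ∀ x ∈ U, ∀ c : FibredChart P, s x ∈ c.total.source →
        cartanCoord c (Γ x) = (jetSec c s (c.base x), momentum L c s (c.base x)) := by
    intro x hx c hc
    rw [hΓ x hx]
    exact cartanCoord_legendreLift η hL hU hs hx hc
  refine ⟨Γ, fun x hx => ContMDiffAt.contMDiffWithinAt ?_, fun x hx => ⟨hpt x hx, hco x hx⟩⟩
  obtain ⟨c, hc⟩ := exists_fibredChart P (s x)
  have hbx := hs.base_mem hx hc
  have hnhds := (isOpen_secDom hU hs).mem_nhds (hs.mem_secDom hx hc)
  have h1 : ContDiffAt ℝ ∞ (fun y => (jetSec c s y, momentum L c s y)) (c.base x) :=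
    ((hs.contDiffOn_jetSec hU).contDiffAt hnhds).prodMk
      ((hs.contDiffOn_momentum hL hU).contDiffAt hnhds)
  have h2 : (jetSec c s (c.base x), momentum L c s (c.base x)) ∈
      (cartanHomeo c (Γ x)).target := by
    rw [← hco x hx c hc]
    exact (cartanHomeo c (Γ x)).map_source (show (Γ x).jet.pt ∈ _ by rw [hpt x hx]; exact hc)
  have h3 : ContMDiffAt 𝓘(ℝ, BModel k) 𝓘(ℝ, WModel k n) ∞ (fun x' => (cartanHomeo c (Γ x)).symm
      (jetSec c s (c.base x'), momentum L c s (c.base x'))) x :=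
    ContMDiffAt.comp x (g := (cartanHomeo c (Γ x)).symm) (I' := 𝓘(ℝ, WModel k n))
      ((contMDiffOn_cartanHomeo c (Γ x)).2.contMDiffAt
        ((cartanHomeo c (Γ x)).open_target.mem_nhds h2))
      (ContMDiffAt.comp x (g := fun y => (jetSec c s y, momentum L c s y)) (I' := 𝓘(ℝ, BModel k))
        h1.contMDiffAt (c.base_smooth.contMDiffAt (c.base.open_source.mem_nhds hbx)))
  refine h3.congr_of_eventuallyEq ?_
  filter_upwards [hU.mem_nhds hx, (hs.1.continuousOn.continuousAt (hU.mem_nhds hx))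
    (c.total.open_source.mem_nhds hc)] with x' hx' hc'
  rw [← hco x' hx' c hc']
  exact ((cartanHomeo c (Γ x)).left_inv
    (show (Γ x').jet.pt ∈ c.total.source by rw [hpt x' hx']; exact hc')).symm

/-- On the Legendre transform of a section, the contraction of `dλ` with vertical vectors reduces to
the Euler–Lagrange expression. -/
theorem pullback_interior_eq_zero_of_eulerLagrange {η : VolumeForm k M}
    (hL : ContMDiff 𝓘(ℝ, JModel k n) 𝓘(ℝ, ℝ) ∞ L) (hU : IsOpen U) (hs : IsSectionOn P s U)
    {Γ : M → CartanBundle P η L} (hΓ : ContMDiffOn 𝓘(ℝ, BModel k) 𝓘(ℝ, WModel k n) ∞ Γ U)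
    (hpt : ∀ x ∈ U, (Γ x).jet.pt = s x) (hco : ∀ x ∈ U, s x ∈ c.total.source →
        cartanCoord c (Γ x) = (jetSec c s (c.base x), momentum L c s (c.base x)))
    {X : ∀ w : CartanBundle P η L, TangentSpace 𝓘(ℝ, WModel k n) w} (hX : IsVertical X)
    {x : M} (hx : x ∈ U) (hc : s x ∈ c.total.source)
    (h : eulerLagrange η L c s (c.base x) = 0) :
    (pullback Γ (interior X (extD (cartanForm P η L))) : DForm (BModel k) M (k + 1)) x = 0 := by
  have hb : ∀ x ∈ U, (Γ x).base = x := fun x hx => by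
    change P.proj (Γ x).jet.pt = x
    rw [hpt x hx, hs.2 x hx]
  have hbx := hs.base_mem hx hc
  have hy := hs.mem_secDom hx hc
  have hc' : (Γ x).jet.pt ∈ c.total.source := by rw [hpt x hx]; exact hc
  have hsec : ∀ y ∈ secDom c s U, cartanSec c Γ y = (jetSec c s y, momentum L c s y) := by
    intro y hy
    have h1 := hco _ hy.2.1 hy.2.2
    rwa [c.base.right_inv hy.1] at h1
  rw [pullback_interior_eq_zero_iff hU hΓ hb hx hc' hL X]
  set X₀ : WModel k n :=
    (tmap (cartanHomeo c (Γ x)) (Γ x) : WModel k n →L[ℝ] WModel k n) (X (Γ x)) with hX₀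
  have hX0 : X₀.1.1.1 = 0 := by
    rw [hX₀, ← S_tmap_base c (Γ x) (Γ x) hc' (X (Γ x)), hX (Γ x), map_zero]
  rw [extDeriv_localCartan_cartanSec hL hU hs hΓ hb hpt hx hc hX0, hsec _ hy]
  have h2 : ∀ j, fderiv ℝ (fun y => formDensity η c.base y *
      ((cartanSec c Γ y).2 X₀.1.1.2) j) (c.base x) (EuclideanSpace.single j (1 : ℝ)) =
      fderiv ℝ (fun y => formDensity η c.base y * (momentum L c s y X₀.1.1.2) j) (c.base x)
        (EuclideanSpace.single j (1 : ℝ)) := by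
    intro j
    congr 1
    refine Filter.EventuallyEq.fderiv_eq ?_
    filter_upwards [(isOpen_secDom hU hs).mem_nhds hy] with y' hy'
    rw [hsec y' hy']
  simp only [h2]
  have h3 := eulerLagrange_eq_sign hL hU hs η hy X₀.1.1.2
  rw [h, zero_apply] at h3
  have hne := c.isSmoothChart.formDensity_ne_zero η (c.base.map_source hbx)
  have h4 := (mul_eq_zero.1 h3.symm).resolve_left (by
    rcases lt_or_gt_of_ne hne with h | h
    · rw [sign_neg h]; simp
    · rw [sign_pos h]; simp)
  have h5 : X₀.1 = ((0, X₀.1.1.2), 0) + (0, X₀.1.2) := by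
    refine Prod.ext (Prod.ext ?_ ?_) ?_
    · change X₀.1.1.1 = 0 + 0
      rw [hX0, add_zero]
    · exact (add_zero _).symm
    · exact (zero_add _).symm
  have h6 : fderiv ℝ (lagCoord L c) (jetSec c s (c.base x)) (0, X₀.1.2) =
      ∑ i, (momentum L c s (c.base x) (X₀.1.2 (EuclideanSpace.single i (1 : ℝ)))) i :=
    (sum_leg_apply ((fderiv ℝ (lagCoord L c) (jetSec c s (c.base x))).comp
      (ContinuousLinearMap.inr ℝ (BModel k × FModel n) (BModel k →L[ℝ] FModel n))) X₀.1.2).symm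
  have h7 : ∀ i, (X₀.2 ((fderiv ℝ (secCoord c s) (c.base x) - (jetSec c s (c.base x)).2)
      (EuclideanSpace.single i (1 : ℝ))) -
        momentum L c s (c.base x) (X₀.1.2 (EuclideanSpace.single i (1 : ℝ)))) i =
      -(momentum L c s (c.base x) (X₀.1.2 (EuclideanSpace.single i (1 : ℝ)))) i := by
    intro i
    have : fderiv ℝ (secCoord c s) (c.base x) - (jetSec c s (c.base x)).2 = 0 := sub_self _
    rw [this]
    simp
  have h8 : fderiv ℝ (lagCoord L c) (jetSec c s (c.base x)) X₀.1 =
      fderiv ℝ (lagCoord L c) (jetSec c s (c.base x)) ((0, X₀.1.1.2), 0) +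
        ∑ i, (momentum L c s (c.base x) (X₀.1.2 (EuclideanSpace.single i (1 : ℝ)))) i := by
    conv_lhs => rw [h5]
    rw [map_add, h6]
  simp only [h7]
  rw [h8, Finset.sum_neg_distrib, add_neg_cancel_right]
  exact h4

end Forward

end LFT

end

theorem mainTheorem6 {k n : ℕ} {M E Q : Type*}
    [TopologicalSpace M] [ChartedSpace (LFT.BModel k) M] [IsManifold 𝓘(ℝ, LFT.BModel k) ∞ M]
    [T2Space M] [SecondCountableTopology M] [MeasurableSpace M] [BorelSpace M]
    [TopologicalSpace E] [ChartedSpace (LFT.BModel k × LFT.FModel n) E]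
    [IsManifold 𝓘(ℝ, LFT.BModel k × LFT.FModel n) ∞ E]
    [T2Space E] [SecondCountableTopology E]
    [TopologicalSpace Q] [ChartedSpace (LFT.FModel n) Q] [IsManifold 𝓘(ℝ, LFT.FModel n) ∞ Q]
    [T2Space Q] [SecondCountableTopology Q]
    (P : LFT.SmoothFibreBundle k n M E Q) (η : LFT.VolumeForm k M)
    (L : LFT.Jet1 P → ℝ) (hL : ContMDiff 𝓘(ℝ, LFT.JModel k n) 𝓘(ℝ, ℝ) ∞ L)
    (U : Set M) (hU : IsOpen U) (s : M → E) (hs : LFT.IsSectionOn P s U) :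
    LFT.IsCritical η L U s ↔
      ∃ Γ : M → LFT.CartanBundle P η L,
        ContMDiffOn 𝓘(ℝ, LFT.BModel k) 𝓘(ℝ, LFT.WModel k n) ∞ Γ U ∧
        (∀ x ∈ U, (Γ x).base = x) ∧
        (∀ x ∈ U, (Γ x).jet.pt = s x) ∧
        ∀ X : (∀ w : LFT.CartanBundle P η L, TangentSpace 𝓘(ℝ, LFT.WModel k n) w),
          LFT.IsSmoothField X → LFT.IsVertical X →
            ∀ x ∈ U,
              (LFT.pullback Γ (LFT.interior X (LFT.extD (LFT.cartanForm P η L))) :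
                LFT.DForm (LFT.BModel k) M (k + 1)) x = 0 := by
  constructor
  · intro h
    obtain ⟨Γ, hΓ, hΓs⟩ := LFT.exists_legendre_section η hL hU hs
    have hpt : ∀ x ∈ U, (Γ x).jet.pt = s x := fun x hx => (hΓs x hx).1
    refine ⟨Γ, hΓ, fun x hx => ?_, hpt, fun X _ hX x hx => ?_⟩
    · change P.proj (Γ x).jet.pt = x
      rw [hpt x hx, hs.2 x hx]
    · obtain ⟨c, hc⟩ := LFT.exists_fibredChart P (s x)
      exact LFT.pullback_interior_eq_zero_of_eulerLagrange hL hU hs hΓ hpt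
        (fun x hx => (hΓs x hx).2 c) hX hx hc
        (h.eulerLagrange_eq_zero hL hU hs η c (hs.mem_secDom hx hc))
  · rintro ⟨Γ, hΓ, hb, hpt, h⟩
    exact LFT.isCritical_of_eulerLagrange hL hU hs η fun c y hy =>
      LFT.eulerLagrange_eq_zero_of_section hL hU hs hΓ hb hpt h hy
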